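/- Let $J_0,S\in\mathbb N$ with $J_0\ge 1$, and let $\gamma,M>0$, $\delta>1/2$, $0<\alpha<1$ be real numbers with $S>\max(\gamma,1/2)$. Let $\{\psi_{lk}: l\ge J_0-1,\ k\in\mathcal Z_l\}$ be an orthonormal basis of the real space $L^2=L^2([0,1])$ with $|\mathcal Z_l|=2^l$ for $l\ge J_0$ (the wavelets) and $\mathcal Z_{J_0-1}$ finite (the scaling functions), which is $S$-regular: every $\psi_{lk}$ is $S$ times differentiable on $[0,1]$ with all derivatives of order at most $S$ in $L^2$. This includes $S$-regular Cohen–Daubechies–Vial (CDV) wavelet bases. Put $a_l=\max(2,2^l)$ and $$\|f\|_{\gamma,\infty}=\sup_{l,k}2^{l(\gamma+1/2)}|\langle\psi_{lk},f\rangle|,\qquad \|f\|_{H}^2=\sum_{l,k}a_l^{-1}(\log a_l)^{-2\delta}|\langle\psi_{lk},f\rangle|^2 ,$$ let $C^\gamma=\{f\in C([0,1]):\|f\|_{\gamma,\infty}<\infty\}$, and let $H=H(\delta)\supset L^2$ be the Hilbert space of all coefficient arrays $(c_{lk})$, $c_{lk}=:\langle\psi_{lk},c\rangle$, with finite $\|\cdot\|_{H}$-norm.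 Let $\mathbb W$ be Gaussian white noise, that is, the random element of $H$ whose coefficients are i.i.d. $N(0,1)$. For $f\in L^2$ and $n\ge1$ let $P^n_f$ be the law on $H$ of $$\mathbb X^{(n)}=f+\tfrac1{\sqrt n}\,\mathbb W .$$ Let the prior $\Pi$ be the law on $L^2$ of the random series $U_{\gamma,M}=\sum_{l\ge J_0-1}\sum_{k\in\mathcal Z_l}2^{-l(\gamma+1/2)}u_{lk}\psi_{lk}$ with $u_{lk}$ i.i.d. uniform on $[-M,M]$, let $\Pi(\cdot\mid\mathbb X^{(n)})$ be the posterior distribution (the conditional law of $f$ given $\mathbb X^{(n)}$ when $f\sim\Pi$ and $\mathbb X^{(n)}\mid f\sim P^n_f$), and let $\bar f_n=\int f\,d\Pi(f\mid\mathbb X^{(n)})$ be the posterior mean. Let $f_0\in C^\gamma$ be fixed with $\|f_0\|_{\gamma,\infty}<M$, and let $R_n=R_n(\mathbb X^{(n)})$ be such that, for all $n\ge1$, $P^n_{f_0}$-almost surely, $$\Pi\bigl(f:\|f-\bar f_n\|_{H}\le R_n/\sqrt n\,\big|\,\mathbb X^{(n)}\bigr)=1-\alpha .$$ Define the credible set $$C'_n=\bigl\{f:\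 \|f\|_{\gamma,\infty}\le M,\ \|f-\bar f_n\|_{H}\le R_n/\sqrt n\bigr\}.$$ Then, as $n\to\infty$, $$P^n_{f_0}\bigl(f_0\in C'_n\bigr)\to 1-\alpha ,$$ and there is $\kappa>0$ such that the $L^2$-diameter $|C'_n|_2$ of $C'_n$ satisfies $$|C'_n|_2=O_{P}\bigl(n^{-\gamma/(2\gamma+1)}(\log n)^{\kappa}\bigr)$$ under $P^n_{f_0}$, that is, for every $\varepsilon>0$ there is $C$ such that $P^n_{f_0}\bigl(|C'_n|_2>C\,n^{-\gamma/(2\gamma+1)}(\log n)^\kappa\bigr)\le\varepsilon$ for all large $n$. -/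

import Mathlib

open MeasureTheory ProbabilityTheory Filter Topology
open scoped ENNReal NNReal

namespace WhiteNoise

noncomputable section

/-- Lebesgue measure on `[0,1]`. -/
abbrev leb01 : Measure ℝ := volume.restrict (Set.Icc (0 : ℝ) 1)

/-- The real Hilbert space `L²([0,1])`. -/
abbrev L2 : Type := Lp ℝ 2 leb01

/-- `L²([0,1])` carries its Borel `σ`-algebra. -/
instance instMeasurableSpaceL2 : MeasurableSpace L2 := borel L2

instance instBorelSpaceL2 : BorelSpace L2 := ⟨rfl⟩

instance instStandardBorelSpaceL2 : StandardBorelSpace L2 := by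
  have : Fact ((2 : ℝ≥0∞) ≠ ∞) := ⟨by simp⟩
  have : SecondCountableTopology L2 := Lp.SecondCountableTopology
  infer_instance

/-! ### Wavelet-type bases -/

/-- Number of basis functions at level `l`: there are `2 ^ l` wavelets at each level `l ≥ J₀`,
and `K` scaling functions, which by convention form the level `J₀ - 1`. -/
def levelSize (J₀ K l : ℕ) : ℕ :=
  if J₀ ≤ l then 2 ^ l else if l + 1 = J₀ then K else 0

/-- The index set of pairs `(l, k)`, `l ≥ J₀ - 1`. -/
abbrev Idx (J₀ K : ℕ) : Type := Σ l : ℕ, Fin (levelSize J₀ K l)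

variable {J₀ K : ℕ}

/-- The orthonormal basis `ψ` is `S`-regular: each `ψ_lk` is (represented by) a function that is
`S` times differentiable on `[0,1]`, with all derivatives of order at most `S` in `L²`. -/
def IsRegularBasis (S : ℕ) (ψ : HilbertBasis (Idx J₀ K) ℝ L2) : Prop :=
  ∀ i, ∃ g : ℝ → ℝ, (ψ i : ℝ → ℝ) =ᵐ[leb01] g ∧
    (∀ m < S, DifferentiableOn ℝ (iteratedDerivWithin m g (Set.Icc 0 1)) (Set.Icc 0 1)) ∧
    ∀ m ≤ S, MemLp (iteratedDerivWithin m g (Set.Icc 0 1)) 2 leb01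

/-- The coefficient `⟨ψ_lk, f⟩`. -/
def coeff (ψ : HilbertBasis (Idx J₀ K) ℝ L2) (f : L2) (i : Idx J₀ K) : ℝ :=
  inner ℝ (ψ i) f

/-! ### The Hölder scale -/

/-- `‖f‖_{s,∞} = sup_{l,k} 2^{l(s+1/2)} |⟨ψ_lk, f⟩|`, with values in `[0,∞]`. -/
def holderNorm (ψ : HilbertBasis (Idx J₀ K) ℝ L2) (s : ℝ) (f : L2) : ℝ≥0∞ :=
  ⨆ i : Idx J₀ K, ENNReal.ofReal ((2 : ℝ) ^ ((i.1 : ℝ) * (s + 1 / 2)) * |coeff ψ f i|)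

/-- The Hölder-type space `C^s`: the (classes of) continuous functions on `[0,1]` with
`‖f‖_{s,∞} < ∞`. -/
def holderSpace (ψ : HilbertBasis (Idx J₀ K) ℝ L2) (s : ℝ) : Set L2 :=
  {f | (∃ g : ℝ → ℝ, ContinuousOn g (Set.Icc 0 1) ∧ (f : ℝ → ℝ) =ᵐ[leb01] g) ∧
    holderNorm ψ s f < ∞}

/-! ### The logarithmic Sobolev space `H(δ)` of order `-1/2` -/

/-- The characteristic sequence `a_l = 2 ^ l`, read as `2` at level `l = 0` so that
`log a_l > 0` throughout. -/
def charSeq (l : ℕ) : ℝ := max 2 ((2 : ℝ) ^ l)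

/-- The weight `a_l^{-1} (log a_l)^{-2δ}`. -/
def weight (δ : ℝ) (l : ℕ) : ℝ := (charSeq l)⁻¹ * Real.log (charSeq l) ^ (-2 * δ)

lemma charSeq_ge (l : ℕ) : 2 ≤ charSeq l := le_max_left _ _

lemma weight_nonneg (δ : ℝ) (l : ℕ) : 0 ≤ weight δ l := by
  have h := charSeq_ge l
  have h1 : 0 ≤ Real.log (charSeq l) := Real.log_nonneg (by linarith)
  unfold weight
  positivity

lemma weight_bdd (δ : ℝ) : ∃ C : ℝ, ∀ l, weight δ l ≤ C := by
  rcases le_or_gt 0 δ with hδ | hδ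
  · refine ⟨Real.log 2 ^ (-2 * δ), fun l => ?_⟩
    have h := charSeq_ge l
    have h2 : 0 < Real.log 2 := Real.log_pos (by norm_num)
    have h3 : Real.log 2 ≤ Real.log (charSeq l) := Real.log_le_log (by norm_num) h
    have h4 : Real.log (charSeq l) ^ (-2 * δ) ≤ Real.log 2 ^ (-2 * δ) :=
      Real.rpow_le_rpow_of_nonpos h2 h3 (by linarith)
    have h5 : (charSeq l)⁻¹ ≤ 1 := inv_le_one_of_one_le₀ (by linarith)
    have h6 : 0 ≤ Real.log (charSeq l) ^ (-2 * δ) := Real.rpow_nonneg (by linarith) _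
    unfold weight
    nlinarith
  · refine ⟨(-2 * δ) ^ (-2 * δ), fun l => ?_⟩
    have h := charSeq_ge l
    have hp : 0 < -2 * δ := by linarith
    set p := -2 * δ with hpdef
    have h0 : 0 ≤ Real.log (charSeq l) := Real.log_nonneg (by linarith)
    have h1 := Real.log_le_rpow_div (x := charSeq l) (by linarith) (inv_pos.mpr hp)
    rw [div_inv_eq_mul] at h1
    have h2 : Real.log (charSeq l) ^ p ≤ charSeq l * p ^ p := by
      refine (Real.rpow_le_rpow h0 h1 hp.le).trans_eq ?_
      rw [Real.mul_rpow (by positivity) hp.le, ← Real.rpow_mul (by linarith),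
        inv_mul_cancel₀ hp.ne', Real.rpow_one]
    unfold weight
    rw [inv_mul_le_iff₀ (by linarith)]
    exact h2

/-- `H(δ)`, each element being identified with its array of coefficients: the arrays `c` with
`∑_{l,k} a_l^{-1} (log a_l)^{-2δ} c_lk² < ∞`. It carries the `σ`-algebra generated by the
coefficients, which is also its Borel `σ`-algebra. -/
def H (J₀ K : ℕ) (δ : ℝ) : Submodule ℝ (Idx J₀ K → ℝ) where
  carrier := {c | Summable fun i => weight δ i.1 * c i ^ 2}
  zero_mem' := by simp [summable_zero]
  add_mem' := by
    intro c d hc hd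
    refine Summable.of_nonneg_of_le (fun i => mul_nonneg (weight_nonneg δ i.1) (sq_nonneg _))
      (fun i => ?_) ((hc.add hd).mul_left 2)
    have h := weight_nonneg δ i.1
    have h' : (c i + d i) ^ 2 ≤ 2 * (c i ^ 2 + d i ^ 2) := by nlinarith [sq_nonneg (c i - d i)]
    calc weight δ i.1 * ((c + d) i) ^ 2 ≤ weight δ i.1 * (2 * (c i ^ 2 + d i ^ 2)) :=
          mul_le_mul_of_nonneg_left h' h
      _ = _ := by ring
  smul_mem' := by
    intro a c hc
    have := hc.mul_left (a ^ 2)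
    refine this.congr fun i => ?_
    simp only [Pi.smul_apply, smul_eq_mul]
    ring

/-- `‖c‖_{H(δ)}`. -/
def hNorm {δ : ℝ} (c : H J₀ K δ) : ℝ :=
  √(∑' i : Idx J₀ K, weight δ i.1 * (c : Idx J₀ K → ℝ) i ^ 2)

lemma coeff_mem_H (ψ : HilbertBasis (Idx J₀ K) ℝ L2) (δ : ℝ) (f : L2) : coeff ψ f ∈ H J₀ K δ := by
  obtain ⟨C, hC⟩ := weight_bdd δ
  have h : Summable fun i => ‖inner ℝ (ψ i) f‖ ^ 2 := ψ.orthonormal.inner_products_summable f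
  refine Summable.of_nonneg_of_le (fun i => mul_nonneg (weight_nonneg δ i.1) (sq_nonneg _))
    (fun i => ?_) (h.mul_left C)
  rw [Real.norm_eq_abs, sq_abs]
  exact mul_le_mul_of_nonneg_right (hC i.1) (sq_nonneg _)

/-- The inclusion `L² ⊂ H(δ)`. -/
def toH (ψ : HilbertBasis (Idx J₀ K) ℝ L2) (δ : ℝ) (f : L2) : H J₀ K δ :=
  ⟨coeff ψ f, coeff_mem_H ψ δ f⟩

lemma measurable_toH (ψ : HilbertBasis (Idx J₀ K) ℝ L2) (δ : ℝ) : Measurable (toH ψ δ) := by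
  refine Measurable.subtype_mk (measurable_pi_lambda _ fun i => ?_)
  exact Continuous.measurable (by unfold coeff; fun_prop)

/-! ### The Gaussian white noise model -/

/-- The canonical Gaussian measure `𝒩` on `H(δ)` (law of white noise, for `δ > 1/2`): the
coefficients are independent standard normal variables. -/
def gaussianH (J₀ K : ℕ) (δ : ℝ) : Measure (H J₀ K δ) :=
  (Measure.infinitePi fun _ : Idx J₀ K => gaussianReal 0 1).comap Subtype.val

instance (J₀ K : ℕ) (δ : ℝ) : IsFiniteMeasure (gaussianH J₀ K δ) := by
  unfold gaussianH; infer_instance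

/-- The observation `f + n^{-1/2} w` in `H(δ)` for signal `f` and noise `w`. -/
def observe (ψ : HilbertBasis (Idx J₀ K) ℝ L2) (δ : ℝ) (n : ℕ) (f : L2) (w : H J₀ K δ) :
    H J₀ K δ :=
  toH ψ δ f + (√(n : ℝ))⁻¹ • w

lemma measurable_observe (ψ : HilbertBasis (Idx J₀ K) ℝ L2) (δ : ℝ) (n : ℕ) :
    Measurable fun p : L2 × H J₀ K δ => observe ψ δ n p.1 p.2 := by
  refine Measurable.subtype_mk (measurable_pi_lambda _ fun i => ?_)
  have h1 : Measurable fun p : L2 × H J₀ K δ => coeff ψ p.1 i :=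
    ((measurable_pi_apply i).comp (measurable_subtype_coe.comp (measurable_toH ψ δ))).comp
      measurable_fst
  have h2 : Measurable fun p : L2 × H J₀ K δ => (p.2 : Idx J₀ K → ℝ) i :=
    (measurable_pi_apply i).comp (measurable_subtype_coe.comp measurable_snd)
  exact h1.add (h2.const_mul _)

/-- The sampling model: `P_f^n` is the law of `f + n^{-1/2} 𝕎` on `H(δ)`, `𝕎 ∼ 𝒩`. -/
def model (ψ : HilbertBasis (Idx J₀ K) ℝ L2) (δ : ℝ) (n : ℕ) : Kernel L2 (H J₀ K δ) where
  toFun f := (gaussianH J₀ K δ).map (observe ψ δ n f)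
  measurable' := by
    refine Measure.measurable_of_measurable_coe _ fun s hs => ?_
    have hm := measurable_observe ψ δ n
    have h : ∀ f, (gaussianH J₀ K δ).map (observe ψ δ n f) s =
        gaussianH J₀ K δ (Prod.mk f ⁻¹' ((fun p => observe ψ δ n p.1 p.2) ⁻¹' s)) := fun f =>
      Measure.map_apply (hm.comp measurable_prodMk_left) hs
    simp_rw [h]
    exact measurable_measure_prodMk_left (hm hs)

instance (ψ : HilbertBasis (Idx J₀ K) ℝ L2) (δ : ℝ) (n : ℕ) : IsFiniteKernel (model ψ δ n) := by
  refine ⟨gaussianH J₀ K δ Set.univ, measure_lt_top _ _, fun f => ?_⟩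
  change (gaussianH J₀ K δ).map (observe ψ δ n f) Set.univ ≤ _
  exact (Measure.map_apply ((measurable_observe ψ δ n).comp measurable_prodMk_left)
    MeasurableSet.univ).trans_le (measure_mono (Set.subset_univ _))

/-! ### The uniform wavelet prior, its posterior and the credible set -/

/-- The law of an array of independent variables, uniform on `[-M, M]`. -/
def uniformArray (J₀ K : ℕ) (M : ℝ) : Measure (Idx J₀ K → ℝ) :=
  Measure.infinitePi fun _ => ProbabilityTheory.cond volume (Set.Icc (-M) M)

/-- The series `∑_{l,k} 2^{-l(γ+1/2)} u_lk ψ_lk` in `L²`. -/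
def waveletSeries (ψ : HilbertBasis (Idx J₀ K) ℝ L2) (γ : ℝ) (u : Idx J₀ K → ℝ) : L2 :=
  ∑' i : Idx J₀ K, ((2 : ℝ) ^ (-(i.1 : ℝ) * (γ + 1 / 2)) * u i) • ψ i

/-- The uniform wavelet prior `Π`: the law of the random series `U_{γ,M}`. -/
def uniformPrior (ψ : HilbertBasis (Idx J₀ K) ℝ L2) (γ M : ℝ) : Measure L2 :=
  (uniformArray J₀ K M).map (waveletSeries ψ γ)

instance (J₀ K : ℕ) (M : ℝ) : IsFiniteMeasure (uniformArray J₀ K M) := by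
  unfold uniformArray
  by_cases h : ∀ _ : Idx J₀ K, IsProbabilityMeasure
      (ProbabilityTheory.cond (volume : Measure ℝ) (Set.Icc (-M) M))
  · infer_instance
  · unfold Measure.infinitePi
    rw [dif_neg h]
    infer_instance

instance (ψ : HilbertBasis (Idx J₀ K) ℝ L2) (γ M : ℝ) : IsFiniteMeasure (uniformPrior ψ γ M) := by
  unfold uniformPrior; infer_instance

/-- The posterior distribution `Π(· | 𝕏⁽ⁿ⁾ = x)`: the conditional law of `f` given the observation
when `f ∼ Π` and `𝕏⁽ⁿ⁾ | f ∼ P_f^n`. -/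
def uniformPosterior (ψ : HilbertBasis (Idx J₀ K) ℝ L2) (γ M δ : ℝ) (n : ℕ) :
    Kernel (H J₀ K δ) L2 :=
  posterior (model ψ δ n) (uniformPrior ψ γ M)

/-- The posterior mean (a Bochner integral in `L²`). -/
def posteriorMean (ψ : HilbertBasis (Idx J₀ K) ℝ L2) (γ M δ : ℝ) (n : ℕ) (x : H J₀ K δ) : L2 :=
  ∫ f, f ∂(uniformPosterior ψ γ M δ n x)

/-- The elements of `L²` in the `H(δ)`-ball `{f : ‖f - g‖_{H(δ)} ≤ r}`. -/
def hBall (ψ : HilbertBasis (Idx J₀ K) ℝ L2) (δ : ℝ) (g : L2) (r : ℝ) : Set L2 :=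
  {f | hNorm (toH ψ δ f - toH ψ δ g) ≤ r}

/-- The credible set
`C'_n = {f : ‖f‖_{γ,∞} ≤ M, ‖f - f̄_n‖_{H(δ)} ≤ R / √n}` for the data `x`. The first condition
forces `f ∈ L²`. -/
def credibleSet (ψ : HilbertBasis (Idx J₀ K) ℝ L2) (γ M δ : ℝ) (n : ℕ) (R : ℝ) (x : H J₀ K δ) :
    Set L2 :=
  {f | holderNorm ψ γ f ≤ ENNReal.ofReal M} ∩ hBall ψ δ (posteriorMean ψ γ M δ n x) (R / √(n : ℝ))

end

end WhiteNoise

namespace WhiteNoise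

noncomputable section

/-! ### Product kernels and coordinatewise Bayes' rule -/

section ProductMeasures

variable {ι : Type*} {X Y : ι → Type*} [∀ i, MeasurableSpace (X i)] [∀ i, MeasurableSpace (Y i)]

/-! In wavelet coordinates every ingredient is a product. The prior is a product of uniform laws on
`[-a_i, a_i]` with `a = halfWidth J₀ K γ M`, and the data are independent `N(f_i, 1/n)`. Bayes' rule
therefore acts coordinate by coordinate, and the posterior is the product of the laws `N(x_i, 1/n)`
conditioned on `[-a_i, a_i]` (`uniformIcc_compProd_swap`, `productPosterior_joint`). A posterior is
only determined up to null sets of the marginal law of the data; since all the laws `P_f^n`, `f ∈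
L²`, are mutually absolutely continuous (`model_absolutelyContinuous`), the explicit formula holds
almost surely under `P_{f₀}^n` (`ae_uniformPosterior_eq`).

Coverage. Write the data as `f₀ + w/√n`, fix the noise `w`, and magnify the posterior by `√n` around
the data. It becomes a product of standard normals conditioned on intervals that contain `-w_i` for
every `n` and exhaust the line, because `|f_i| < a_i` strictly. The first fact bounds the second
moments by `2 + w_i²` uniformly in `n` (`integral_sq_truncatedNormal_le`). The weights are summable
for `δ > 1/2` and `w` has finite energy almost surely, so high frequencies are negligible uniformly
in `n`, the rescaled posterior behaves in `H(δ)` like white noise, and its mean tends to zero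
(`tendsto_infinitePi_truncatedNormal_energy_le`). Let `signalDepth` be the posterior mass of the
ball around the posterior mean whose boundary passes through `f₀`. By the above it converges almost
surely to `G(energy of w)`, where `G` is the distribution function of the energy of white noise.
This law has no atoms (`measure_energy_eq`), so the limit is uniform on `[0,1]`. Up to null sets,
coverage contains `{depth < 1 - α}` and is contained in `{depth ≤ 1 - α}`, whence its probability
tends to `1 - α` (`tendsto_measure_of_tendsto_cdf`). No convergence of the radii `R_n` is needed.

Diameter. The posterior puts mass `α` outside the ball, while its mean squared spread in `H(δ)` is
of order `1/n`; Markov's inequality thus gives `R_n = O_P(1)` (`ae_radius_le`). Two elements of the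
credible set are then within order `n^{-1/2}` in `H(δ)` and differ by at most `2 a_i` in coordinate
`i`. Splitting the `L²` norm at the level `L` with `2^L ≈ n^{1/(2γ+1)}` balances `2^L L^{2δ} / n`
against `2^{-2γL}` (`norm_sq_le_of_energy_le`, `exists_level_rate`). -/

lemma lintegral_finsetProd_infinitePi (μ : ∀ i, Measure (X i)) [∀ i, IsProbabilityMeasure (μ i)]
    (s : Finset ι) {f : ∀ i, X i → ℝ≥0∞} (hf : ∀ i, Measurable (f i)) :
    ∫⁻ x, ∏ i ∈ s, f i (x i) ∂(Measure.infinitePi μ) = ∏ i ∈ s, ∫⁻ x, f i x ∂(μ i) := by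
  refine (lintegral_prod_eq_prod_lintegral_of_indepFun s
    (fun i (x : ∀ i, X i) => f i (x i))
    (iIndepFun_infinitePi (fun i => hf i))
    (fun i => (hf i).comp (measurable_pi_apply i))).trans ?_
  refine Finset.prod_congr rfl fun i _ => ?_
  rw [← (measurePreserving_eval_infinitePi μ i).lintegral_comp (hf i)]

/-- The product of a family of Markov kernels, acting coordinatewise. -/
def piKernel (k : ∀ i, Kernel (X i) (Y i)) [∀ i, IsMarkovKernel (k i)] :
    Kernel (∀ i, X i) (∀ i, Y i) where
  toFun x := Measure.infinitePi fun i => k i (x i)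
  measurable' := by
    refine Measurable.measure_of_isPiSystem_of_isProbabilityMeasure
      (generateFrom_squareCylinders (α := Y)).symm
      (isPiSystem_squareCylinders (fun _ => MeasurableSpace.isPiSystem_measurableSet)
        (fun _ => MeasurableSet.univ)) ?_
    rintro _ ⟨s, t, ht, rfl⟩
    have ht' : ∀ i, MeasurableSet (t i) := fun i => ht i (Set.mem_univ i)
    have h : ∀ x : ∀ i, X i, Measure.infinitePi (fun i => k i (x i)) (Set.pi s t) =
        ∏ i ∈ s, k i (x i) (t i) := fun x => Measure.infinitePi_pi _ fun i _ => ht' i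
    simp_rw [h]
    exact Finset.measurable_fun_prod _ fun i _ =>
      ((k i).measurable_coe (ht' i)).comp (measurable_pi_apply i)

lemma piKernel_apply (k : ∀ i, Kernel (X i) (Y i)) [∀ i, IsMarkovKernel (k i)] (x : ∀ i, X i) :
    piKernel k x = Measure.infinitePi fun i => k i (x i) := rfl

instance (k : ∀ i, Kernel (X i) (Y i)) [∀ i, IsMarkovKernel (k i)] :
    IsMarkovKernel (piKernel k) :=
  ⟨fun x => by rw [piKernel_apply]; infer_instance⟩

/-- Zipping the two arrays into an array of pairs gives a measure that agrees with the product
measure on boxes; unzipping inverts this map. -/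
lemma infinitePi_compProd_piKernel (μ : ∀ i, Measure (X i)) [∀ i, IsProbabilityMeasure (μ i)]
    (k : ∀ i, Kernel (X i) (Y i)) [∀ i, IsMarkovKernel (k i)] :
    Measure.infinitePi μ ⊗ₘ piKernel k =
      (Measure.infinitePi fun i => μ i ⊗ₘ k i).map fun z => (fun i => (z i).1, fun i => (z i).2) := by
  have hm : Measurable fun p : (∀ i, X i) × (∀ i, Y i) => fun i => (p.1 i, p.2 i) := by fun_prop
  have key : (Measure.infinitePi μ ⊗ₘ piKernel k).map (fun p i => (p.1 i, p.2 i)) =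
      Measure.infinitePi fun i => μ i ⊗ₘ k i := by
    refine Measure.eq_infinitePi _ fun s t ht => ?_
    have hst : MeasurableSet (Set.pi (s : Set ι) t) := MeasurableSet.pi s.countable_toSet
      fun i _ => ht i
    rw [Measure.map_apply hm hst, Measure.compProd_apply (hm hst)]
    have : ∀ x : ∀ i, X i, piKernel k x (Prod.mk x ⁻¹' ((fun p i => (p.1 i, p.2 i)) ⁻¹' Set.pi s t))
        = ∏ i ∈ s, k i (x i) (Prod.mk (x i) ⁻¹' t i) := by
      intro x
      rw [piKernel_apply, ← Measure.infinitePi_pi (fun i => k i (x i))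
        (fun i _ => measurable_prodMk_left (ht i))]
      rfl
    simp_rw [this]
    rw [lintegral_finsetProd_infinitePi μ s
      (f := fun i x => k i x (Prod.mk x ⁻¹' t i))
      (fun i => Kernel.measurable_kernel_prodMk_left (ht i))]
    exact Finset.prod_congr rfl fun i _ => (Measure.compProd_apply (ht i)).symm
  rw [← key, Measure.map_map (by fun_prop) hm]
  exact Measure.map_id.symm

/-- Coordinatewise Bayes' rule. -/
lemma infinitePi_compProd_piKernel_swap {μ : ∀ i, Measure (X i)} {ν : ∀ i, Measure (Y i)}
    [∀ i, IsProbabilityMeasure (μ i)] [∀ i, IsProbabilityMeasure (ν i)]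
    {k : ∀ i, Kernel (X i) (Y i)} {η : ∀ i, Kernel (Y i) (X i)}
    [∀ i, IsMarkovKernel (k i)] [∀ i, IsMarkovKernel (η i)]
    (h : ∀ i, ν i ⊗ₘ η i = (μ i ⊗ₘ k i).map Prod.swap) :
    Measure.infinitePi ν ⊗ₘ piKernel η = (Measure.infinitePi μ ⊗ₘ piKernel k).map Prod.swap := by
  have : ∀ i, IsProbabilityMeasure ((μ i ⊗ₘ k i).map Prod.swap) := fun i => by
    rw [← h]; infer_instance
  rw [infinitePi_compProd_piKernel, infinitePi_compProd_piKernel]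
  simp_rw [h]
  rw [← Measure.infinitePi_map_pi (fun i => μ i ⊗ₘ k i) (fun i => measurable_swap),
    Measure.map_map (by fun_prop) (by fun_prop), Measure.map_map (by fun_prop) (by fun_prop)]
  rfl

end ProductMeasures

/-! ### Absolute continuity of infinite product measures -/

section AbsoluteContinuity

/-- A `Q`-null set `A` is approximated in `P + Q` measure by a set `t` of the ring, with error `r`.
Then `Q t ≤ r` and `P A ≤ P t + r`, so the inequality for `t` forces `P A = 0` as `r → 0`. -/
lemma absolutelyContinuous_of_sq_le {α : Type*} {mα : MeasurableSpace α} {P Q : Measure α}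
    [IsFiniteMeasure P] [IsFiniteMeasure Q] {𝒞 : Set (Set α)} (h𝒞 : IsSetRing 𝒞)
    (huniv : Set.univ ∈ 𝒞) (hgen : mα = MeasurableSpace.generateFrom 𝒞) {C : ℝ≥0∞} (hC : C ≠ ∞)
    (h : ∀ A ∈ 𝒞, P A ^ 2 ≤ C * Q A) : P ≪ Q := by
  refine Measure.AbsolutelyContinuous.mk fun A hA hQA => ?_
  have key : ∀ ε : ℝ≥0∞, 0 < ε → ∃ r ≤ ε, P A ^ 2 ≤ C * r + 2 * r * P Set.univ + r ^ 2 := by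
    intro ε hε
    obtain ⟨t, ht, hts⟩ := exists_measure_symmDiff_lt_of_generateFrom_isSetRing (μ := P + Q) h𝒞
      ⟨{Set.univ}, Set.countable_singleton _, by simpa using huniv, by simp⟩ hgen hA hε
    refine ⟨(P + Q) (symmDiff t A), hts.le, ?_⟩
    set r := (P + Q) (symmDiff t A)
    have h1 : P A ≤ P t + r := by
      calc P A ≤ P (t ∪ symmDiff t A) := measure_mono fun x hx => by
            by_cases hxt : x ∈ t
            · exact Or.inl hxt
            · exact Or.inr (Or.inr ⟨hx, hxt⟩)
        _ ≤ P t + P (symmDiff t A) := measure_union_le _ _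
        _ ≤ P t + r := by gcongr; exact Measure.le_iff'.1 (Measure.le_add_right le_rfl) _
    have h2 : Q t ≤ r := by
      calc Q t ≤ Q (A ∪ symmDiff t A) := measure_mono fun x hx => by
            by_cases hxt : x ∈ A
            · exact Or.inl hxt
            · exact Or.inr (Or.inl ⟨hx, hxt⟩)
        _ ≤ Q A + Q (symmDiff t A) := measure_union_le _ _
        _ ≤ r := by rw [hQA, zero_add]; exact Measure.le_iff'.1 (Measure.le_add_left le_rfl) _
    calc P A ^ 2 ≤ (P t + r) ^ 2 := by gcongr
      _ = P t ^ 2 + 2 * r * P t + r ^ 2 := by ring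
      _ ≤ C * r + 2 * r * P Set.univ + r ^ 2 := by
          gcongr
          · exact (h t ht).trans (by gcongr)
          · exact Set.subset_univ _
  have h0 : P A ^ 2 ≤ 0 := by
    have hlim : Tendsto (fun r : ℝ≥0∞ => C * r + 2 * r * P Set.univ + r ^ 2) (𝓝 0)
        (𝓝 (C * 0 + 2 * 0 * P Set.univ + 0 ^ 2)) := by
      refine Tendsto.add (Tendsto.add ?_ ?_) ?_
      · exact ENNReal.Tendsto.const_mul tendsto_id (Or.inr hC)
      · exact ENNReal.Tendsto.mul_const (ENNReal.Tendsto.const_mul tendsto_id (Or.inr (by simp)))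
          (Or.inr (measure_ne_top _ _))
      · exact (ENNReal.continuous_pow 2).tendsto 0
    have hlim' := hlim.mono_left (nhdsWithin_le_nhds (s := Set.Ioi 0))
    simp only [mul_zero, zero_mul, add_zero, ne_eq, OfNat.ofNat_ne_zero, not_false_eq_true, zero_pow] at hlim'
    refine ge_of_tendsto hlim' ?_
    filter_upwards [self_mem_nhdsWithin] with ε hε
    obtain ⟨r, hr, hle⟩ := key ε hε
    exact hle.trans (by gcongr)
  simpa using h0

lemma isSetRing_measurableCylinders {ι : Type*} (X : ι → Type*) [∀ i, MeasurableSpace (X i)] :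
    IsSetRing (measurableCylinders X) where
  empty_mem := empty_mem_measurableCylinders X
  union_mem _ _ hs ht := union_mem_measurableCylinders hs ht
  sdiff_mem _ _ hs ht := sdiff_mem_measurableCylinders hs ht

lemma pi_withDensity {ι : Type*} [Fintype ι] {X : ι → Type*} [∀ i, MeasurableSpace (X i)]
    (Q : ∀ i, Measure (X i)) [∀ i, IsProbabilityMeasure (Q i)]
    {g : ∀ i, X i → ℝ≥0∞} (hg : ∀ i, Measurable (g i))
    [∀ i, IsProbabilityMeasure ((Q i).withDensity (g i))] :
    Measure.pi (fun i => (Q i).withDensity (g i)) =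
      (Measure.pi Q).withDensity fun x => ∏ i, g i (x i) := by
  refine Measure.pi_eq fun s hs => ?_
  rw [withDensity_apply _ (MeasurableSet.univ_pi hs),
    ← lintegral_indicator (MeasurableSet.univ_pi hs)]
  have : ∀ x : ∀ i, X i, (Set.univ.pi s).indicator (fun x => ∏ i, g i (x i)) x =
      ∏ i, (s i).indicator (g i) (x i) := by
    intro x
    by_cases hx : x ∈ Set.univ.pi s
    · rw [Set.indicator_of_mem hx]
      exact Finset.prod_congr rfl fun i _ => (Set.indicator_of_mem (hx i (Set.mem_univ i)) _).symm
    · rw [Set.indicator_of_notMem hx]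
      simp only [Set.mem_pi, Set.mem_univ, true_imp_iff, not_forall] at hx
      obtain ⟨i, hi⟩ := hx
      exact (Finset.prod_eq_zero (Finset.mem_univ i) (Set.indicator_of_notMem hi _)).symm
  simp_rw [this]
  rw [← Measure.infinitePi_eq_pi, lintegral_finsetProd_infinitePi Q Finset.univ
    (f := fun i => (s i).indicator (g i)) (fun i => (hg i).indicator (hs i))]
  refine Finset.prod_congr rfl fun i _ => ?_
  rw [lintegral_indicator (hs i), withDensity_apply _ (hs i)]

variable {ι : Type*} {X : ι → Type*} [∀ i, MeasurableSpace (X i)]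

/-- If the `χ²`-type integrals of the coordinate densities have bounded finite products, the
product measures are absolutely continuous. -/
lemma infinitePi_absolutelyContinuous (P Q : ∀ i, Measure (X i))
    [∀ i, IsProbabilityMeasure (P i)] [∀ i, IsProbabilityMeasure (Q i)]
    {g : ∀ i, X i → ℝ≥0∞} (hg : ∀ i, Measurable (g i)) (hP : ∀ i, P i = (Q i).withDensity (g i))
    {C : ℝ≥0∞} (hC : C ≠ ∞) (h : ∀ s : Finset ι, ∏ i ∈ s, ∫⁻ x, g i x ^ 2 ∂(Q i) ≤ C) :
    Measure.infinitePi P ≪ Measure.infinitePi Q := by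
  refine absolutelyContinuous_of_sq_le (isSetRing_measurableCylinders X)
    (univ_mem_measurableCylinders X) generateFrom_measurableCylinders.symm hC fun A hA => ?_
  obtain ⟨s, S, hS, rfl⟩ := (mem_measurableCylinders A).1 hA
  have hprob : ∀ i, IsProbabilityMeasure ((Q i).withDensity (g i)) := fun i => by
    rw [← hP]; infer_instance
  rw [Measure.infinitePi_cylinder _ hS, Measure.infinitePi_cylinder _ hS]
  simp_rw [hP]
  rw [pi_withDensity (fun i : s => Q i) (fun i => hg i), withDensity_apply _ hS,
    ← lintegral_indicator hS]
  set G : (∀ i : s, X i) → ℝ≥0∞ := fun x => ∏ i : s, g i (x i)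
  have hG : Measurable G := Finset.measurable_fun_prod _ fun i _ =>
    (hg i).comp (measurable_pi_apply i)
  -- Cauchy–Schwarz for the density against the indicator of `S`: the squared mass under `P` is at
  -- most the integral of the squared density times the mass under `Q`.
  have hcs := ENNReal.lintegral_mul_le_Lp_mul_Lq (Measure.pi fun i : s => Q i)
    Real.HolderConjugate.two_two hG.aemeasurable
    ((measurable_const (a := (1 : ℝ≥0∞))).indicator hS).aemeasurable
  have e1 : ∀ x, S.indicator G x = (G * S.indicator fun _ => (1 : ℝ≥0∞)) x := by
    intro x
    by_cases hx : x ∈ S <;> simp [hx]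
  have e2 : ∀ x, (S.indicator (fun _ => (1 : ℝ≥0∞)) x) ^ (2 : ℝ) = S.indicator (fun _ => 1) x := by
    intro x
    by_cases hx : x ∈ S <;> simp [hx]
  have e3 : ∫⁻ x, G x ^ (2 : ℝ) ∂(Measure.pi fun i : s => Q i) ≤ C := by
    refine le_trans (le_of_eq ?_) (h s)
    rw [← Finset.prod_coe_sort, ← lintegral_finsetProd_infinitePi (fun i : s => Q i) Finset.univ
      (f := fun i x => g i x ^ 2) (fun i => (hg i).pow_const 2), Measure.infinitePi_eq_pi]
    refine lintegral_congr fun x => ?_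
    simp only [G, ENNReal.rpow_two, Finset.prod_pow]
  simp_rw [e1]
  simp_rw [e2] at hcs
  rw [lintegral_indicator hS, setLIntegral_const, one_mul] at hcs
  calc _ ≤ _ := pow_le_pow_left' hcs 2
    _ = (∫⁻ x, G x ^ (2 : ℝ) ∂(Measure.pi fun i : s => Q i)) * (Measure.pi fun i : s => Q i) S := by
        rw [mul_pow, ← ENNReal.rpow_natCast, ← ENNReal.rpow_natCast, ← ENNReal.rpow_mul,
          ← ENNReal.rpow_mul]
        norm_num
    _ ≤ C * (Measure.pi fun i : s => Q i) S := by gcongr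

end AbsoluteContinuity

/-! ### Gaussian likelihood ratios and the one-dimensional posterior -/

section GaussianOneDim

/-- The likelihood ratio of `N(a, v)` with respect to `N(b, v)`. -/
def gaussianRatio (v : ℝ≥0) (a b x : ℝ) : ℝ≥0∞ :=
  ENNReal.ofReal (Real.exp (((x - b) ^ 2 - (x - a) ^ 2) / (2 * v)))

lemma measurable_gaussianRatio (v : ℝ≥0) (a b : ℝ) : Measurable (gaussianRatio v a b) := by
  unfold gaussianRatio; fun_prop

lemma gaussianPDF_mul_gaussianRatio (v : ℝ≥0) (a b x : ℝ) :
    gaussianPDF b v x * gaussianRatio v a b x = gaussianPDF a v x := by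
  simp only [gaussianPDF, gaussianRatio, gaussianPDFReal]
  rw [← ENNReal.ofReal_mul (by positivity), mul_assoc, ← Real.exp_add]
  congr 3
  ring

lemma gaussianReal_eq_withDensity {v : ℝ≥0} (hv : v ≠ 0) (a b : ℝ) :
    gaussianReal a v = (gaussianReal b v).withDensity (gaussianRatio v a b) := by
  rw [gaussianReal_of_var_ne_zero _ hv, gaussianReal_of_var_ne_zero _ hv,
    ← withDensity_mul _ (measurable_gaussianPDF _ _) (measurable_gaussianRatio _ _ _)]
  congr 1
  ext x
  exact (gaussianPDF_mul_gaussianRatio v a b x).symm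

/-- Completing the square: the density of `N(b, v)` times the squared ratio is `exp ((a - b)² / v)`
times the density of `N(2a - b, v)`. -/
lemma lintegral_gaussianRatio_sq {v : ℝ≥0} (hv : v ≠ 0) (a b : ℝ) :
    ∫⁻ x, gaussianRatio v a b x ^ 2 ∂(gaussianReal b v) =
      ENNReal.ofReal (Real.exp ((a - b) ^ 2 / v)) := by
  rw [gaussianReal_of_var_ne_zero _ hv, lintegral_withDensity_eq_lintegral_mul _
    (measurable_gaussianPDF _ _) ((measurable_gaussianRatio _ _ _).pow_const 2)]
  have hv' : (v : ℝ) ≠ 0 := by exact_mod_cast hv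
  have : ∀ x, (gaussianPDF b v * fun x => gaussianRatio v a b x ^ 2) x =
      ENNReal.ofReal (Real.exp ((a - b) ^ 2 / v)) * gaussianPDF (2 * a - b) v x := by
    intro x
    simp only [Pi.mul_apply, gaussianPDF, gaussianRatio, gaussianPDFReal]
    rw [← ENNReal.ofReal_pow (by positivity), ← ENNReal.ofReal_mul (by positivity),
      ← ENNReal.ofReal_mul (by positivity), ← Real.exp_nat_mul, mul_assoc, ← Real.exp_add,
      mul_left_comm, ← Real.exp_add]
    congr 3
    field_simp
    push_cast
    ring
  simp_rw [this]
  rw [lintegral_const_mul _ (measurable_gaussianPDF _ _), lintegral_gaussianPDF_eq_one _ hv, mul_one]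

/-- `u ↦ N(u, v)`. -/
def gaussianKernel (v : ℝ≥0) : Kernel ℝ ℝ where
  toFun u := gaussianReal u v
  measurable' := by fun_prop

lemma gaussianKernel_apply (v : ℝ≥0) (u : ℝ) : gaussianKernel v u = gaussianReal u v := rfl

instance (v : ℝ≥0) : IsMarkovKernel (gaussianKernel v) :=
  ⟨fun u => by rw [gaussianKernel_apply]; infer_instance⟩

/-- `x ↦ N(x, v)` conditioned on `[p, q]`. -/
def truncatedKernel (v : ℝ≥0) (p q : ℝ) : Kernel ℝ ℝ where
  toFun x := ProbabilityTheory.cond (gaussianReal x v) (Set.Icc p q)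
  measurable' := by
    refine Measure.measurable_of_measurable_coe _ fun s hs => ?_
    simp_rw [cond_apply measurableSet_Icc]
    have h (t : Set ℝ) (ht : MeasurableSet t) : Measurable fun x => gaussianReal x v t :=
      (gaussianKernel v).measurable_coe ht
    exact (h _ measurableSet_Icc).inv.mul (h _ (measurableSet_Icc.inter hs))

lemma truncatedKernel_apply (v : ℝ≥0) (p q x : ℝ) :
    truncatedKernel v p q x = ProbabilityTheory.cond (gaussianReal x v) (Set.Icc p q) := rfl

lemma gaussianReal_Icc_ne_zero {v : ℝ≥0} (hv : v ≠ 0) {p q : ℝ} (hpq : p < q) (x : ℝ) :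
    gaussianReal x v (Set.Icc p q) ≠ 0 := fun h => by
  have := gaussianReal_absolutelyContinuous' x hv h
  simp only [Real.volume_Icc, ENNReal.ofReal_eq_zero] at this
  linarith

lemma isMarkovKernel_truncatedKernel {v : ℝ≥0} (hv : v ≠ 0) {p q : ℝ} (hpq : p < q) :
    IsMarkovKernel (truncatedKernel v p q) :=
  ⟨fun x => cond_isProbabilityMeasure (gaussianReal_Icc_ne_zero hv hpq x)⟩

/-- The uniform distribution on `[p, q]`. -/
abbrev uniformIcc (p q : ℝ) : Measure ℝ := ProbabilityTheory.cond volume (Set.Icc p q)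

lemma isProbabilityMeasure_uniformIcc {p q : ℝ} (hpq : p < q) :
    IsProbabilityMeasure (uniformIcc p q) :=
  cond_isProbabilityMeasure_of_finite (by simp [hpq]) (by simp)

lemma gaussianPDF_comm (v : ℝ≥0) (a x : ℝ) : gaussianPDF a v x = gaussianPDF x v a := by
  simp only [gaussianPDF, gaussianPDFReal]
  congr 4
  ring

/-- Bayes' rule for a uniform prior and Gaussian noise: the posterior is a truncated Gaussian. -/
lemma uniformIcc_compProd_swap {v : ℝ≥0} (hv : v ≠ 0) {p q : ℝ} (hpq : p < q) :
    (gaussianKernel v ∘ₘ uniformIcc p q) ⊗ₘ truncatedKernel v p q =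
      (uniformIcc p q ⊗ₘ gaussianKernel v).map Prod.swap := by
  have := isMarkovKernel_truncatedKernel hv hpq
  have := isProbabilityMeasure_uniformIcc hpq
  have hpdf : Measurable fun z : ℝ × ℝ => gaussianPDF z.1 v z.2 := by
    have : Measurable fun z : ℝ × ℝ => ((z.1, v, z.2) : ℝ × ℝ≥0 × ℝ) := by fun_prop
    exact measurable_uncurry_gaussianPDF.comp this
  have hmeas : ∀ B : Set ℝ, MeasurableSet B → Measurable fun x => gaussianReal x v B :=
    fun B hB => (gaussianKernel v).measurable_coe hB
  set c : ℝ≥0∞ := (volume (Set.Icc p q))⁻¹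
  -- The Gaussian density is symmetric in mean and argument, so after Fubini the joint law is read
  -- as `dx` times the `N(x, v)` measure of the parameter.
  have hjoint : ∀ A B : Set ℝ, MeasurableSet A → MeasurableSet B →
      (uniformIcc p q ⊗ₘ gaussianKernel v) (B ×ˢ A) =
        c * ∫⁻ x in A, gaussianReal x v (Set.Icc p q ∩ B) := by
    intro A B hA hB
    have hIB : MeasurableSet (Set.Icc p q ∩ B) := measurableSet_Icc.inter hB
    rw [Measure.compProd_apply_prod hB hA]
    simp_rw [gaussianKernel_apply, gaussianReal_apply _ hv]
    rw [uniformIcc, ProbabilityTheory.cond, Measure.restrict_smul, lintegral_smul_measure, smul_eq_mul,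
      Measure.restrict_restrict hB, Set.inter_comm B]
    rw [lintegral_lintegral_swap (by exact hpdf.aemeasurable)]
    simp_rw [gaussianPDF_comm v]
    rfl
  have hmarg : gaussianKernel v ∘ₘ uniformIcc p q =
      volume.withDensity fun x => c * gaussianReal x v (Set.Icc p q) := by
    ext A hA
    rw [withDensity_apply _ hA, lintegral_const_mul _ (hmeas _ measurableSet_Icc), ← Measure.snd_compProd, Measure.snd_apply hA, ← Set.univ_prod,
      hjoint A _ hA MeasurableSet.univ, Set.inter_univ]
  refine Measure.ext_prod fun {A B} hA hB => ?_
  rw [Measure.map_apply measurable_swap (hA.prod hB), Set.preimage_swap_prod, hjoint A B hA hB,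
    Measure.compProd_apply_prod hA hB, hmarg, setLIntegral_withDensity_eq_setLIntegral_mul _
      ((hmeas _ measurableSet_Icc).const_mul c)
      ((truncatedKernel v p q).measurable_coe hB) hA,
    ← lintegral_const_mul _ (hmeas _ (measurableSet_Icc.inter hB))]
  refine lintegral_congr fun x => ?_
  simp only [Pi.mul_apply, truncatedKernel_apply]
  -- The normalising constant of the truncated law cancels against the marginal density of the data.
  rw [cond_apply measurableSet_Icc, mul_assoc, ← mul_assoc (gaussianReal x v _),
    ENNReal.mul_inv_cancel (gaussianReal_Icc_ne_zero hv hpq x) (measure_ne_top _ _), one_mul]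

end GaussianOneDim

/-! ### Moments of truncated normal laws -/

section TruncatedMoments

/-- The standard normal distribution conditioned on `[p, q]`. -/
abbrev truncatedNormal (p q : ℝ) : Measure ℝ :=
  ProbabilityTheory.cond (gaussianReal 0 1) (Set.Icc p q)

lemma isProbabilityMeasure_truncatedNormal {p q : ℝ} (hpq : p < q) :
    IsProbabilityMeasure (truncatedNormal p q) :=
  cond_isProbabilityMeasure (gaussianReal_Icc_ne_zero one_ne_zero hpq 0)

lemma integrable_sq_gaussianReal : Integrable (fun x : ℝ => x ^ 2) (gaussianReal 0 1) :=
  (memLp_id_gaussianReal' (μ := 0) (v := 1) 2 (by simp)).integrable_sq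

lemma integrable_id_gaussianReal : Integrable (fun x : ℝ => x) (gaussianReal 0 1) :=
  (memLp_id_gaussianReal' (μ := 0) (v := 1) 1 (by simp)).integrable (by simp)

lemma integrable_cond {α E : Type*} [MeasurableSpace α] [NormedAddCommGroup E] {μ : Measure α}
    {s : Set α} (hs : μ s ≠ 0) {f : α → E} (hf : Integrable f μ) :
    Integrable f (ProbabilityTheory.cond μ s) :=
  hf.restrict.smul_measure (ENNReal.inv_ne_top.2 hs)

lemma hasDerivAt_gaussianPDFReal_std (x : ℝ) :
    HasDerivAt (gaussianPDFReal 0 1) (-x * gaussianPDFReal 0 1 x) x := by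
  have h : HasDerivAt (fun x : ℝ => -(x - 0) ^ 2 / (2 * ((1 : ℝ≥0) : ℝ))) (-x) x := by
    have := (((hasDerivAt_id x).sub_const 0).pow 2).neg.div_const (2 * ((1 : ℝ≥0) : ℝ))
    refine this.congr_deriv ?_
    simp
    ring
  have := h.exp.const_mul (√(2 * Real.pi * ((1 : ℝ≥0) : ℝ)))⁻¹
  refine this.congr_deriv ?_
  simp only [gaussianPDFReal]
  ring

lemma setIntegral_gaussianReal_Icc {p q : ℝ} (hpq : p ≤ q) (f : ℝ → ℝ) :
    ∫ x in Set.Icc p q, f x ∂(gaussianReal 0 1) = ∫ x in p..q, gaussianPDFReal 0 1 x * f x := by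
  rw [intervalIntegral.integral_of_le hpq, ← integral_Icc_eq_integral_Ioc,
    ← integral_indicator measurableSet_Icc, integral_gaussianReal_eq_integral_smul one_ne_zero,
    ← integral_indicator measurableSet_Icc]
  refine integral_congr_ae (ae_of_all _ fun x => ?_)
  by_cases hx : x ∈ Set.Icc p q <;> simp [hx]

lemma continuous_gaussianPDFReal_std : Continuous (gaussianPDFReal 0 1) :=
  continuous_iff_continuousAt.2 fun x => (hasDerivAt_gaussianPDFReal_std x).continuousAt

/-- With `φ` the standard normal density, `((x - c) φ)' = φ - (x - c) x φ`, and the boundary terms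
have the favourable sign because `c` lies in `[p, q]`. -/
lemma setIntegral_mul_sub_le {p q c : ℝ} (hp : p ≤ c) (hq : c ≤ q) :
    ∫ x in Set.Icc p q, (x - c) * x ∂(gaussianReal 0 1) ≤
      (gaussianReal 0 1).real (Set.Icc p q) := by
  have hpq := hp.trans hq
  have hφ := continuous_gaussianPDFReal_std
  have h1 : (gaussianReal 0 1).real (Set.Icc p q) = ∫ x in p..q, gaussianPDFReal 0 1 x := by
    have := setIntegral_gaussianReal_Icc hpq fun _ => 1
    simpa using this
  have h2 : ∫ x in p..q, (gaussianPDFReal 0 1 x - gaussianPDFReal 0 1 x * ((x - c) * x)) =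
      (q - c) * gaussianPDFReal 0 1 q - (p - c) * gaussianPDFReal 0 1 p := by
    refine intervalIntegral.integral_eq_sub_of_hasDerivAt
      (f := fun x => (x - c) * gaussianPDFReal 0 1 x) (fun x _ => ?_)
      (Continuous.intervalIntegrable (by fun_prop) _ _)
    refine (((hasDerivAt_id x).sub_const c).mul (hasDerivAt_gaussianPDFReal_std x)).congr_deriv ?_
    simp
    ring
  rw [intervalIntegral.integral_sub (Continuous.intervalIntegrable (by fun_prop) _ _)
    (Continuous.intervalIntegrable (by fun_prop) _ _)] at h2
  rw [setIntegral_gaussianReal_Icc hpq, h1]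
  have h3 := mul_nonneg (sub_nonneg.2 hq) (gaussianPDFReal_nonneg 0 1 q)
  have h4 := mul_nonneg (sub_nonneg.2 hp) (gaussianPDFReal_nonneg 0 1 p)
  linarith

lemma integral_truncatedNormal (p q : ℝ) (f : ℝ → ℝ) :
    ∫ x, f x ∂(truncatedNormal p q) = ((gaussianReal 0 1).real (Set.Icc p q))⁻¹ *
      ∫ x in Set.Icc p q, f x ∂(gaussianReal 0 1) := by
  rw [truncatedNormal, ProbabilityTheory.cond, integral_smul_measure, ENNReal.toReal_inv, smul_eq_mul]
  rfl

/-- From `x² ≤ 2 (x - c) x + c²` and the integration by parts above. The bound depends on the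
interval only through one of its points `c`, hence is uniform over all truncations containing `c`;
it is used with `c = -w_i`. -/
lemma integral_sq_truncatedNormal_le {p q c : ℝ} (hpq : p < q) (hp : p ≤ c) (hq : c ≤ q) :
    ∫ x, x ^ 2 ∂(truncatedNormal p q) ≤ 2 + c ^ 2 := by
  have hpos : 0 < (gaussianReal 0 1).real (Set.Icc p q) :=
    ENNReal.toReal_pos (gaussianReal_Icc_ne_zero one_ne_zero hpq 0) (measure_ne_top _ _)
  rw [integral_truncatedNormal, inv_mul_le_iff₀ hpos]
  have hi1 := integrable_sq_gaussianReal.restrict (s := Set.Icc p q)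
  have hi2 := integrable_id_gaussianReal.restrict (s := Set.Icc p q)
  have hi3 : Integrable (fun x : ℝ => (x - c) * x) ((gaussianReal 0 1).restrict (Set.Icc p q)) :=
    (hi1.sub (hi2.const_mul c)).congr (ae_of_all _ fun x => by simp; ring)
  calc ∫ x in Set.Icc p q, x ^ 2 ∂(gaussianReal 0 1)
      ≤ ∫ x in Set.Icc p q, (2 * ((x - c) * x) + c ^ 2) ∂(gaussianReal 0 1) := by
        refine integral_mono hi1 ((hi3.const_mul 2).add (integrable_const _)) fun x => ?_
        simp only
        nlinarith [sq_nonneg (x - c)]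
    _ = 2 * ∫ x in Set.Icc p q, (x - c) * x ∂(gaussianReal 0 1) +
          (gaussianReal 0 1).real (Set.Icc p q) * c ^ 2 := by
        rw [integral_add (hi3.const_mul 2) (integrable_const _), integral_const_mul]
        simp
    _ ≤ _ := by nlinarith [setIntegral_mul_sub_le hp hq]

lemma integrable_sq_truncatedNormal {p q : ℝ} (hpq : p < q) :
    Integrable (fun x : ℝ => x ^ 2) (truncatedNormal p q) :=
  integrable_cond (gaussianReal_Icc_ne_zero one_ne_zero hpq 0) integrable_sq_gaussianReal

lemma integrable_id_truncatedNormal {p q : ℝ} (hpq : p < q) :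
    Integrable (fun x : ℝ => x) (truncatedNormal p q) :=
  integrable_cond (gaussianReal_Icc_ne_zero one_ne_zero hpq 0) integrable_id_gaussianReal

lemma sq_integral_truncatedNormal_le {p q c : ℝ} (hpq : p < q) (hp : p ≤ c) (hq : c ≤ q) :
    (∫ x, x ∂(truncatedNormal p q)) ^ 2 ≤ 2 + c ^ 2 := by
  have := isProbabilityMeasure_truncatedNormal hpq
  refine le_trans ?_ (integral_sq_truncatedNormal_le hpq hp hq)
  set m := ∫ x, x ∂(truncatedNormal p q) with hm
  have h : ∫ x, (2 * m * x - m ^ 2) ∂(truncatedNormal p q) ≤ ∫ x, x ^ 2 ∂(truncatedNormal p q) := by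
    refine integral_mono (((integrable_id_truncatedNormal hpq).const_mul _).sub
      (integrable_const _)) (integrable_sq_truncatedNormal hpq) fun x => ?_
    simp only
    nlinarith [sq_nonneg (x - m)]
  rw [integral_sub ((integrable_id_truncatedNormal hpq).const_mul _) (integrable_const _),
    integral_const_mul, ← hm] at h
  simp at h
  nlinarith

lemma tendsto_setIntegral_Icc {p q : ℕ → ℝ} (hp : Tendsto p atTop atBot)
    (hq : Tendsto q atTop atTop) {f : ℝ → ℝ} (hf : Integrable f (gaussianReal 0 1)) :
    Tendsto (fun n => ∫ x in Set.Icc (p n) (q n), f x ∂(gaussianReal 0 1)) atTop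
      (𝓝 (∫ x, f x ∂(gaussianReal 0 1))) :=
  (aecover_Icc hp hq).integral_tendsto_of_countably_generated hf

lemma tendsto_gaussianReal_Icc {p q : ℕ → ℝ} (hp : Tendsto p atTop atBot)
    (hq : Tendsto q atTop atTop) :
    Tendsto (fun n => gaussianReal 0 1 (Set.Icc (p n) (q n))) atTop (𝓝 1) := by
  have h := tendsto_setIntegral_Icc hp hq (integrable_const 1)
  simp only [integral_const, smul_eq_mul, mul_one, measureReal_restrict_apply_univ, probReal_univ] at h
  have := (ENNReal.continuous_ofReal.tendsto _).comp h
  simpa [Function.comp_def] using this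

lemma tendsto_integral_truncatedNormal {p q : ℕ → ℝ} (hp : Tendsto p atTop atBot)
    (hq : Tendsto q atTop atTop) :
    Tendsto (fun n => ∫ x, x ∂(truncatedNormal (p n) (q n))) atTop (𝓝 0) := by
  simp_rw [integral_truncatedNormal]
  have h1 := tendsto_setIntegral_Icc hp hq (integrable_const 1)
  have h2 := tendsto_setIntegral_Icc hp hq integrable_id_gaussianReal
  rw [integral_id_gaussianReal] at h2
  simp only [integral_const, smul_eq_mul, mul_one, measureReal_restrict_apply_univ, probReal_univ] at h1
  simpa using (h1.inv₀ one_ne_zero).mul h2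

end TruncatedMoments

/-! ### Weighted sums of squares with values in `[0, ∞]` -/

section Energy

variable {ι : Type*}

/-- The weighted sum of squares `∑ W_i c_i²`. -/
def energy (W : ι → ℝ) (c : ι → ℝ) : ℝ≥0∞ := ∑' i, ENNReal.ofReal (W i * c i ^ 2)

/-- The weighted `ℓ²` norm `(∑ W_i c_i²)^{1/2}`. -/
def energyNorm (W : ι → ℝ) (c : ι → ℝ) : ℝ≥0∞ := energy W c ^ (1 / 2 : ℝ)

lemma measurable_energy [Countable ι] (W : ι → ℝ) : Measurable (energy W) := by
  unfold energy
  exact Measurable.tsum fun i => by fun_prop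

lemma measurable_energyNorm [Countable ι] (W : ι → ℝ) : Measurable (energyNorm W) :=
  (measurable_energy W).pow_const _

lemma energyNorm_le_iff (W c : ι → ℝ) (s : ℝ≥0∞) : energyNorm W c ≤ s ↔ energy W c ≤ s ^ (2 : ℝ) := by
  rw [energyNorm, one_div, ENNReal.rpow_inv_le_iff (by norm_num)]

lemma energyNorm_le_energyNorm_iff (W c d : ι → ℝ) :
    energyNorm W c ≤ energyNorm W d ↔ energy W c ≤ energy W d :=
  ENNReal.rpow_le_rpow_iff (by norm_num)

/-- Minkowski's inequality for the counting measure, applied to the arrays `√W_i |c_i|`. -/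
lemma energyNorm_add_le {W : ι → ℝ} (hW : ∀ i, 0 ≤ W i) (c d : ι → ℝ) :
    energyNorm W (c + d) ≤ energyNorm W c + energyNorm W d := by
  let _ : MeasurableSpace ι := ⊤
  set F : (ι → ℝ) → ι → ℝ≥0∞ := fun c i => ENNReal.ofReal (√(W i) * |c i|)
  have hF : ∀ c : ι → ℝ, energy W c = ∫⁻ i, F c i ^ (2 : ℝ) ∂Measure.count := by
    intro c
    rw [lintegral_count, energy]
    refine tsum_congr fun i => ?_
    simp only [F]
    rw [ENNReal.rpow_two, ← ENNReal.ofReal_pow (by positivity), mul_pow, Real.sq_sqrt (hW i), sq_abs]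
  have h := ENNReal.lintegral_Lp_add_le (μ := Measure.count) (p := 2) (f := F c) (g := F d)
    (measurable_from_top.aemeasurable) (measurable_from_top.aemeasurable) (by norm_num)
  simp only [energyNorm, hF]
  refine le_trans ?_ h
  gcongr with i
  simp only [F, Pi.add_apply]
  rw [← ENNReal.ofReal_add (by positivity) (by positivity)]
  refine ENNReal.ofReal_le_ofReal ?_
  rw [← mul_add]
  exact mul_le_mul_of_nonneg_left (abs_add_le _ _) (Real.sqrt_nonneg _)

lemma energy_neg (W c : ι → ℝ) : energy W (-c) = energy W c := by simp [energy]

lemma energyNorm_neg (W c : ι → ℝ) : energyNorm W (-c) = energyNorm W c := by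
  rw [energyNorm, energy_neg, energyNorm]

lemma energyNorm_sub_le {W : ι → ℝ} (hW : ∀ i, 0 ≤ W i) (c d : ι → ℝ) :
    energyNorm W (c - d) ≤ energyNorm W c + energyNorm W d := by
  rw [sub_eq_add_neg, ← energyNorm_neg W d]
  exact energyNorm_add_le hW c (-d)

lemma energyNorm_le_sub_add {W : ι → ℝ} (hW : ∀ i, 0 ≤ W i) (c d : ι → ℝ) :
    energyNorm W c ≤ energyNorm W (c - d) + energyNorm W d := by
  simpa using energyNorm_add_le hW (c - d) d

lemma energyNorm_le_add_add {W : ι → ℝ} (hW : ∀ i, 0 ≤ W i) (c d : ι → ℝ) :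
    energyNorm W c ≤ energyNorm W (c + d) + energyNorm W d := by
  simpa using energyNorm_sub_le hW (c + d) d

lemma energy_smul (W c : ι → ℝ) (a : ℝ) : energy W (a • c) = ENNReal.ofReal (a ^ 2) * energy W c := by
  rw [energy, energy, ← ENNReal.tsum_mul_left]
  refine tsum_congr fun i => ?_
  rw [← ENNReal.ofReal_mul (by positivity)]
  congr 1
  simp only [Pi.smul_apply, smul_eq_mul]
  ring

lemma energy_eq_ofReal {W c : ι → ℝ} (hW : ∀ i, 0 ≤ W i) (h : Summable fun i => W i * c i ^ 2) :
    energy W c = ENNReal.ofReal (∑' i, W i * c i ^ 2) :=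
  (ENNReal.ofReal_tsum_of_nonneg (fun i => mul_nonneg (hW i) (sq_nonneg _)) h).symm

lemma energy_lt_top_iff {W c : ι → ℝ} (hW : ∀ i, 0 ≤ W i) :
    energy W c < ∞ ↔ Summable fun i => W i * c i ^ 2 := by
  refine ⟨fun h => ?_, fun h => by rw [energy_eq_ofReal hW h]; exact ENNReal.ofReal_lt_top⟩
  have := ENNReal.summable_toReal h.ne
  refine this.congr fun i => ENNReal.toReal_ofReal (mul_nonneg (hW i) (sq_nonneg _))

lemma energy_eq_add_update [DecidableEq ι] (W : ι → ℝ) (i₀ : ι) (c : ι → ℝ) (x : ℝ) :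
    energy W (Function.update c i₀ x) =
      ENNReal.ofReal (W i₀ * x ^ 2) + energy W (Function.update c i₀ 0) := by
  rw [energy, ENNReal.tsum_eq_add_tsum_ite i₀, energy]
  simp only [Function.update_self]
  congr 1
  refine tsum_congr fun i => ?_
  by_cases h : i = i₀ <;> simp [h]

end Energy

/-! ### Energy of white noise -/

section StandardGaussian

variable {ι : Type*}

/-- The law of independent standard normal coordinates. -/
abbrev stdGaussian (ι : Type*) : Measure (ι → ℝ) := Measure.infinitePi fun _ : ι => gaussianReal 0 1

lemma measurable_update_prod [DecidableEq ι] (i₀ : ι) :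
    Measurable fun z : (ι → ℝ) × ℝ => Function.update z.1 i₀ z.2 := by
  refine measurable_pi_lambda _ fun i => ?_
  by_cases h : i = i₀
  · subst h; simpa using measurable_snd
  · simpa [Function.update_of_ne h] using
      show Measurable fun z : (ι → ℝ) × ℝ => z.1 i by fun_prop

/-- Resampling one coordinate independently preserves the law. This allows one to argue
conditionally on all the other coordinates without splitting the index set. -/
lemma infinitePi_map_update [DecidableEq ι] (i₀ : ι) (μ : ι → Measure ℝ)
    [∀ i, IsProbabilityMeasure (μ i)] :
    ((Measure.infinitePi μ).prod (μ i₀)).map (fun z => Function.update z.1 i₀ z.2) =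
      Measure.infinitePi μ := by
  have hm := measurable_update_prod i₀
  refine Measure.eq_infinitePi _ fun s t ht => ?_
  rw [Measure.map_apply hm (MeasurableSet.pi s.countable_toSet fun i _ => ht i)]
  by_cases h : i₀ ∈ s
  · have : (fun z : (ι → ℝ) × ℝ => Function.update z.1 i₀ z.2) ⁻¹' Set.pi s t =
        Set.pi (s.erase i₀ : Finset ι) t ×ˢ t i₀ := by
      ext ⟨v, x⟩
      simp only [Set.mem_preimage, Set.mem_pi, Finset.mem_coe, Set.mem_prod, Finset.mem_erase]
      constructor
      · intro hz
        refine ⟨fun i hi => ?_, by simpa using hz i₀ h⟩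
        simpa [Function.update_of_ne hi.1] using hz i hi.2
      · rintro ⟨h1, h2⟩ i hi
        by_cases hii : i = i₀
        · subst hii; simpa using h2
        · simpa [Function.update_of_ne hii] using h1 i ⟨hii, hi⟩
    rw [this, Measure.prod_prod, Measure.infinitePi_pi _ (fun i _ => ht i), Finset.prod_erase_mul _ _ h]
  · have : (fun z : (ι → ℝ) × ℝ => Function.update z.1 i₀ z.2) ⁻¹' Set.pi s t =
        Set.pi s t ×ˢ Set.univ := by
      ext ⟨v, x⟩
      simp only [Set.mem_preimage, Set.mem_pi, Finset.mem_coe, Set.mem_prod, Set.mem_univ, and_true]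
      refine forall₂_congr fun i hi => ?_
      rw [Function.update_of_ne (fun h' : i = i₀ => h (h' ▸ Finset.mem_coe.1 hi))]
    rw [this, Measure.prod_prod, Measure.infinitePi_pi _ (fun i _ => ht i), measure_univ, mul_one]

/-- With all coordinates but `i₀` frozen, the equation `W_{i₀} x² + rest = t` has at most two
solutions `x`, a null set for the Gaussian. Finiteness of `t` makes it possible to cancel the rest.
-/
lemma measure_energy_eq [Countable ι] {W : ι → ℝ} {i₀ : ι} (hi₀ : 0 < W i₀) {t : ℝ≥0∞} (ht : t ≠ ∞) :
    stdGaussian ι {v | energy W v = t} = 0 := by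
  classical
  have hm := measurable_update_prod i₀
  have hs : MeasurableSet {v : ι → ℝ | energy W v = t} :=
    measurable_energy W (measurableSet_singleton t)
  rw [stdGaussian, ← infinitePi_map_update i₀, Measure.map_apply hm hs,
    Measure.prod_apply (hm hs), lintegral_eq_zero_iff (measurable_measure_prodMk_left (hm hs))]
  refine ae_of_all _ fun v => ?_
  have := nullSingletonClass_gaussianReal (μ := 0) (v := 1) one_ne_zero
  have hfin : (Prod.mk v ⁻¹' ((fun z : (ι → ℝ) × ℝ => Function.update z.1 i₀ z.2) ⁻¹'
      {v | energy W v = t})).Finite := by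
    by_cases hne : (Prod.mk v ⁻¹' ((fun z : (ι → ℝ) × ℝ => Function.update z.1 i₀ z.2) ⁻¹'
      {v | energy W v = t})).Nonempty
    · obtain ⟨x₀, hx₀⟩ := hne
      refine (Set.toFinite {x₀, -x₀}).subset fun x hx => ?_
      replace hx : energy W (Function.update v i₀ x) = t := hx
      replace hx₀ : energy W (Function.update v i₀ x₀) = t := hx₀
      rw [energy_eq_add_update] at hx hx₀
      have hrest : energy W (Function.update v i₀ 0) ≠ ∞ := fun h => by
        rw [h, add_top] at hx; exact ht hx.symm
      have h1 := (ENNReal.add_left_inj hrest).1 (hx.trans hx₀.symm)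
      rw [ENNReal.ofReal_eq_ofReal_iff (by positivity) (by positivity)] at h1
      exact sq_eq_sq_iff_eq_or_eq_neg.1 (mul_left_cancel₀ hi₀.ne' h1)
    · rw [Set.not_nonempty_iff_eq_empty.1 hne]
      exact Set.finite_empty
  exact hfin.measure_zero _

lemma lintegral_energy [Countable ι] {W : ι → ℝ} (hW : ∀ i, 0 ≤ W i) (μ : ι → Measure ℝ)
    [∀ i, IsProbabilityMeasure (μ i)] :
    ∫⁻ v, energy W v ∂(Measure.infinitePi μ) =
      ∑' i, ENNReal.ofReal (W i) * ∫⁻ x, ENNReal.ofReal (x ^ 2) ∂(μ i) := by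
  unfold energy
  rw [lintegral_tsum fun i => Measurable.aemeasurable (by fun_prop)]
  refine tsum_congr fun i => ?_
  rw [← lintegral_const_mul _ (by fun_prop)]
  rw [← (measurePreserving_eval_infinitePi μ i).lintegral_comp (by fun_prop)]
  simp_rw [ENNReal.ofReal_mul (hW i)]

lemma lintegral_sq_gaussianReal : ∫⁻ x, ENNReal.ofReal (x ^ 2) ∂(gaussianReal 0 1) = 1 := by
  rw [← ofReal_integral_eq_lintegral_ofReal integrable_sq_gaussianReal
    (ae_of_all _ fun x => sq_nonneg x)]
  have := variance_id_gaussianReal (μ := 0) (v := 1)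
  rw [variance_of_integral_eq_zero (by fun_prop) (by simp)] at this
  simp at this
  simp [this]

lemma ae_energy_lt_top [Countable ι] {W : ι → ℝ} (hW : ∀ i, 0 ≤ W i) (hs : Summable W) :
    ∀ᵐ v ∂(stdGaussian ι), energy W v < ∞ := by
  refine ae_lt_top (measurable_energy W) ?_
  rw [lintegral_energy hW]
  simp_rw [lintegral_sq_gaussianReal, mul_one]
  rw [← ENNReal.ofReal_tsum_of_nonneg hW hs]
  exact ENNReal.ofReal_ne_top

end StandardGaussian

/-! ### Products of truncated normals on cylinders -/

section TruncatedProducts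

variable {ι : Type*}

lemma lintegral_sq_truncatedNormal_le {p q c : ℝ} (hpq : p < q) (hp : p ≤ c) (hq : c ≤ q) :
    ∫⁻ x, ENNReal.ofReal (x ^ 2) ∂(truncatedNormal p q) ≤ ENNReal.ofReal (2 + c ^ 2) := by
  rw [← ofReal_integral_eq_lintegral_ofReal (integrable_sq_truncatedNormal hpq)
    (ae_of_all _ fun x => sq_nonneg x)]
  exact ENNReal.ofReal_le_ofReal (integral_sq_truncatedNormal_le hpq hp hq)

lemma pi_cond [Fintype ι] {X : ι → Type*} [∀ i, MeasurableSpace (X i)] (μ : ∀ i, Measure (X i))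
    [∀ i, IsProbabilityMeasure (μ i)] {B : ∀ i, Set (X i)} (hB : ∀ i, MeasurableSet (B i))
    (hB0 : ∀ i, μ i (B i) ≠ 0) :
    Measure.pi (fun i => ProbabilityTheory.cond (μ i) (B i)) =
      ProbabilityTheory.cond (Measure.pi μ) (Set.univ.pi B) := by
  have : ∀ i, IsProbabilityMeasure (ProbabilityTheory.cond (μ i) (B i)) := fun i =>
    cond_isProbabilityMeasure (hB0 i)
  refine Measure.pi_eq fun s hs => ?_
  rw [cond_apply (MeasurableSet.univ_pi hB), ← Set.pi_inter_distrib, Measure.pi_pi, Measure.pi_pi,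
    ENNReal.prod_inv_distrib (fun i _ j _ _ => Or.inr (measure_ne_top _ _)), ← Finset.prod_mul_distrib]
  exact Finset.prod_congr rfl fun i _ => (cond_apply (hB i) _ _).symm

/-- Cylinder probabilities converge when the truncation limits diverge. -/
lemma tendsto_infinitePi_truncatedNormal_cylinder {p q : ℕ → ι → ℝ} (hpq : ∀ n i, p n i < q n i)
    (hp : ∀ i, Tendsto (fun n => p n i) atTop atBot) (hq : ∀ i, Tendsto (fun n => q n i) atTop atTop)
    (F : Finset ι) {S : Set (F → ℝ)} (hS : MeasurableSet S) :
    Tendsto (fun n => Measure.infinitePi (fun i => truncatedNormal (p n i) (q n i)) (F.restrict ⁻¹' S))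
      atTop (𝓝 (stdGaussian ι (F.restrict ⁻¹' S))) := by
  have hprob : ∀ n i, IsProbabilityMeasure (truncatedNormal (p n i) (q n i)) := fun n i =>
    isProbabilityMeasure_truncatedNormal (hpq n i)
  set μ := Measure.pi fun _ : F => gaussianReal 0 1
  set box : ℕ → Set (F → ℝ) := fun n => Set.univ.pi fun i : F => Set.Icc (p n i) (q n i)
  have hbox : ∀ n, MeasurableSet (box n) := fun n => MeasurableSet.univ_pi fun i => measurableSet_Icc
  have e1 : ∀ n, Measure.infinitePi (fun i => truncatedNormal (p n i) (q n i)) (F.restrict ⁻¹' S) =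
      (μ (box n))⁻¹ * μ (box n ∩ S) := by
    intro n
    have := Measure.infinitePi_cylinder (fun i => truncatedNormal (p n i) (q n i)) hS
    rw [cylinder] at this
    rw [this, ← cond_apply (hbox n), pi_cond (fun _ : F => gaussianReal 0 1)
      (fun i => measurableSet_Icc) (fun i => gaussianReal_Icc_ne_zero one_ne_zero (hpq n i) 0)]
  have e2 : stdGaussian ι (F.restrict ⁻¹' S) = μ S :=
    Measure.infinitePi_cylinder (fun _ : ι => gaussianReal 0 1) hS
  simp_rw [e1, e2]
  have h1 : Tendsto (fun n => μ (box n)) atTop (𝓝 1) := by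
    simp_rw [μ, box, Measure.pi_pi]
    rw [show (1 : ℝ≥0∞) = ∏ _i : F, 1 by simp]
    refine ENNReal.tendsto_finsetProd_of_ne_top _ (fun i _ => tendsto_gaussianReal_Icc (hp i) (hq i)) ?_
    simp
  have h2 : Tendsto (fun n => μ (box n)ᶜ) atTop (𝓝 0) := by
    simp_rw [fun n => prob_compl_eq_one_sub (μ := μ) (hbox n)]
    simpa using ENNReal.Tendsto.sub (tendsto_const_nhds (x := (1 : ℝ≥0∞))) h1 (Or.inl (by simp))
  have h3 : Tendsto (fun n => μ (box n ∩ S)) atTop (𝓝 (μ S)) := by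
    refine tendsto_of_tendsto_of_tendsto_of_le_of_le
      (g := fun n => μ S - μ (box n)ᶜ) ?_ tendsto_const_nhds (fun n => ?_)
      (fun n => measure_mono Set.inter_subset_right)
    · simpa using ENNReal.Tendsto.sub (tendsto_const_nhds (x := μ S)) h2 (Or.inl (measure_ne_top _ _))
    · refine tsub_le_iff_right.2 ((measure_mono ?_).trans (measure_union_le _ _))
      intro x hx
      by_cases hxb : x ∈ box n
      · exact Or.inl ⟨hxb, hx⟩
      · exact Or.inr hxb
  have := ENNReal.Tendsto.mul (h1.inv) (Or.inl (by simp)) h3 (Or.inr (by simp))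
  simpa using this

end TruncatedProducts

/-! ### Convergence of the rescaled posterior in energy balls -/

section BernsteinVonMises

variable {ι : Type*}

/-- The energy carried by the coordinates in `F`. -/
def partialEnergy (W : ι → ℝ) (F : Finset ι) (v : ι → ℝ) : ℝ≥0∞ :=
  ∑ i ∈ F, ENNReal.ofReal (W i * v i ^ 2)

lemma partialEnergy_le_energy (W : ι → ℝ) (F : Finset ι) (v : ι → ℝ) :
    partialEnergy W F v ≤ energy W v :=
  ENNReal.sum_le_tsum F

lemma measurable_partialEnergy (W : ι → ℝ) (F : Finset ι) : Measurable (partialEnergy W F) :=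
  Finset.measurable_fun_sum _ fun i _ => by fun_prop

lemma energy_eq_partialEnergy_add (W : ι → ℝ) (F : Finset ι) (v : ι → ℝ) :
    energy W v = partialEnergy W F v + energy ((F : Set ι)ᶜ.indicator W) v := by
  have h : energy ((F : Set ι)ᶜ.indicator W) v =
      ∑' i : ((F : Set ι)ᶜ : Set ι), ENNReal.ofReal (W i * v i ^ 2) := by
    rw [tsum_subtype ((F : Set ι)ᶜ) fun i => ENNReal.ofReal (W i * v i ^ 2), energy]
    refine tsum_congr fun i => ?_
    by_cases hi : i ∈ (F : Set ι)ᶜ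
    · simp only [Set.indicator_of_mem hi]
    · simp only [Set.indicator_of_notMem hi, zero_mul, ENNReal.ofReal_zero]
  rw [h, partialEnergy, ← Finset.tsum_subtype' F fun i => ENNReal.ofReal (W i * v i ^ 2)]
  exact (ENNReal.summable.tsum_add_tsum_compl ENNReal.summable).symm

lemma exists_measurableSet_partialEnergy_le (W : ι → ℝ) (F : Finset ι) (s : ℝ≥0∞) :
    ∃ S : Set (F → ℝ), MeasurableSet S ∧ {v | partialEnergy W F v ≤ s} = F.restrict ⁻¹' S := by
  refine ⟨{y | ∑ i : F, ENNReal.ofReal (W i * y i ^ 2) ≤ s},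
    measurableSet_le (Finset.measurable_fun_sum _ fun i _ => by fun_prop) measurable_const, ?_⟩
  ext v
  change partialEnergy W F v ≤ s ↔ ∑ i : F, ENNReal.ofReal (W i * v i ^ 2) ≤ s
  rw [partialEnergy, Finset.sum_coe_sort F fun i => ENNReal.ofReal (W i * v i ^ 2)]

lemma tendsto_measure_partialEnergy_le [Countable ι] (W : ι → ℝ) (μ : Measure (ι → ℝ))
    [IsFiniteMeasure μ] (s : ℝ≥0∞) :
    Tendsto (fun F => μ {v | partialEnergy W F v ≤ s}) atTop (𝓝 (μ {v | energy W v ≤ s})) := by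
  have h : {v | energy W v ≤ s} = ⋂ F : Finset ι, {v | partialEnergy W F v ≤ s} := by
    ext v
    simp only [Set.mem_iInter]
    change energy W v ≤ s ↔ ∀ F, partialEnergy W F v ≤ s
    rw [energy, ENNReal.tsum_eq_iSup_sum, iSup_le_iff]
    rfl
  rw [h]
  refine tendsto_measure_iInter_atTop (fun F => (measurableSet_le (measurable_partialEnergy W F)
    measurable_const).nullMeasurableSet) ?_ ⟨∅, measure_ne_top _ _⟩
  intro F F' hFF' v hv
  exact (Finset.sum_le_sum_of_subset hFF').trans (show partialEnergy W F' v ≤ s from hv)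

variable {W : ι → ℝ} {w : ι → ℝ} {p q : ℕ → ι → ℝ}

/-- Dropping coordinates only enlarges an energy ball, so for upper bounds the convergence on
cylinders suffices and no control of the tail is needed. -/
lemma eventually_measure_energy_le_lt [Countable ι] (hpq : ∀ n i, p n i < q n i)
    (hp : ∀ i, Tendsto (fun n => p n i) atTop atBot) (hq : ∀ i, Tendsto (fun n => q n i) atTop atTop)
    {s c : ℝ≥0∞} (hc : stdGaussian ι {v | energy W v ≤ s} < c) :
    ∀ᶠ n in atTop, Measure.infinitePi (fun i => truncatedNormal (p n i) (q n i))
      {v | energy W v ≤ s} < c := by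
  obtain ⟨F, hF⟩ := ((tendsto_order.1
    (tendsto_measure_partialEnergy_le W (stdGaussian ι) s)).2 c hc).exists
  obtain ⟨S, hS, hSe⟩ := exists_measurableSet_partialEnergy_le W F s
  rw [hSe] at hF
  filter_upwards [(tendsto_order.1
    (tendsto_infinitePi_truncatedNormal_cylinder hpq hp hq F hS)).2 c hF] with n hn
  refine lt_of_le_of_lt (measure_mono ?_) hn
  rw [← hSe]
  exact fun v hv => (partialEnergy_le_energy W F v).trans hv

/-- A uniform bound for the expected energy of the truncated product. -/
lemma lintegral_energy_truncatedNormal_le [Countable ι] (hW : ∀ i, 0 ≤ W i) {p q : ι → ℝ} (hpq : ∀ i, p i < q i)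
    (hpw : ∀ i, p i ≤ -w i) (hqw : ∀ i, -w i ≤ q i) :
    ∫⁻ v, energy W v ∂(Measure.infinitePi fun i => truncatedNormal (p i) (q i)) ≤
      ∑' i, ENNReal.ofReal (W i * (2 + w i ^ 2)) := by
  have hprob : ∀ i, IsProbabilityMeasure (truncatedNormal (p i) (q i)) := fun i =>
    isProbabilityMeasure_truncatedNormal (hpq i)
  rw [lintegral_energy hW]
  refine ENNReal.tsum_le_tsum fun i => ?_
  rw [ENNReal.ofReal_mul (hW i)]
  gcongr
  simpa using lintegral_sq_truncatedNormal_le (hpq i) (hpw i) (hqw i)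

/-- For lower bounds the coordinates outside a finite set `F` have to be controlled. Their expected
energy is bounded by a tail of a convergent series, uniformly in `n`; by Markov's inequality it
exceeds the slack `s' - s` only with small probability. -/
lemma eventually_lt_measure_energy_le [Countable ι] (hW : ∀ i, 0 ≤ W i)
    (hw : ∑' i, ENNReal.ofReal (W i * (2 + w i ^ 2)) ≠ ∞) (hpq : ∀ n i, p n i < q n i)
    (hpw : ∀ n i, p n i ≤ -w i) (hqw : ∀ n i, -w i ≤ q n i)
    (hp : ∀ i, Tendsto (fun n => p n i) atTop atBot) (hq : ∀ i, Tendsto (fun n => q n i) atTop atTop)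
    {s s' c : ℝ≥0∞} (hs : s < s') (hs' : s' ≠ ∞) (hc : c < stdGaussian ι {v | energy W v ≤ s}) :
    ∀ᶠ n in atTop, c < Measure.infinitePi (fun i => truncatedNormal (p n i) (q n i))
      {v | energy W v ≤ s'} := by
  obtain ⟨c', hcc', hc'⟩ := exists_between hc
  have hδ : s' - s ≠ 0 := (tsub_pos_of_lt hs).ne'
  have hδ' : s' - s ≠ ∞ := ENNReal.sub_ne_top hs'
  have hpos : 0 < (c' - c) * (s' - s) := ENNReal.mul_pos (tsub_pos_of_lt hcc').ne' hδ
  obtain ⟨F, hF⟩ := ((tendsto_order.1 (ENNReal.tendsto_tsum_compl_atTop_zero hw)).2 _ hpos).exists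
  have htail : ∀ n, Measure.infinitePi (fun i => truncatedNormal (p n i) (q n i))
      {v | s' - s ≤ energy ((F : Set ι)ᶜ.indicator W) v} ≤ c' - c := by
    intro n
    refine (meas_ge_le_lintegral_div (measurable_energy _).aemeasurable hδ hδ').trans ?_
    rw [ENNReal.div_le_iff hδ hδ']
    refine (lintegral_energy_truncatedNormal_le (fun i => Set.indicator_nonneg (fun i _ => hW i) i)
      (hpq n) (hpw n) (hqw n)).trans (le_trans (le_of_eq ?_) hF.le)
    change _ = ∑' i : ((F : Set ι)ᶜ : Set ι), ENNReal.ofReal (W i * (2 + w i ^ 2))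
    rw [tsum_subtype ((F : Set ι)ᶜ) fun i => ENNReal.ofReal (W i * (2 + w i ^ 2))]
    refine tsum_congr fun i => ?_
    by_cases hi : i ∈ (F : Set ι)ᶜ
    · simp only [Set.indicator_of_mem hi]
    · simp only [Set.indicator_of_notMem hi, zero_mul, ENNReal.ofReal_zero]
  obtain ⟨S, hS, hSe⟩ := exists_measurableSet_partialEnergy_le W F s
  have hFc : c' < stdGaussian ι (F.restrict ⁻¹' S) := by
    refine lt_of_lt_of_le hc' (measure_mono ?_)
    rw [← hSe]
    exact fun v hv => (partialEnergy_le_energy W F v).trans hv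
  filter_upwards [(tendsto_order.1
    (tendsto_infinitePi_truncatedNormal_cylinder hpq hp hq F hS)).1 c' hFc] with n hn
  rw [← hSe] at hn
  have hle : c' < Measure.infinitePi (fun i => truncatedNormal (p n i) (q n i))
      {v | energy W v ≤ s'} + (c' - c) := by
    refine hn.trans_le (le_trans (measure_mono ?_) ((measure_union_le _ _).trans
      (add_le_add le_rfl (htail n))))
    intro v hv
    replace hv : partialEnergy W F v ≤ s := hv
    by_cases h : s' - s ≤ energy ((F : Set ι)ᶜ.indicator W) v
    · exact Or.inr h
    · left
      change energy W v ≤ s'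
      rw [energy_eq_partialEnergy_add W F]
      calc _ ≤ s + (s' - s) := add_le_add hv (not_le.1 h).le
        _ = s' := add_tsub_cancel_of_le hs.le
  by_contra hcon
  have : c' < c' := by
    calc c' < _ := hle
      _ ≤ c + (c' - c) := by gcongr; exact not_lt.1 hcon
      _ = c' := add_tsub_cancel_of_le hcc'.le
  exact lt_irrefl _ this

/-- Dominated convergence: each truncated mean tends to `0`, and its square is at most `2 + w_i²`
for every `n`. -/
lemma tendsto_energy_integral_truncatedNormal (hW : ∀ i, 0 ≤ W i)
    (hw : Summable fun i => W i * (2 + w i ^ 2)) (hpq : ∀ n i, p n i < q n i)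
    (hpw : ∀ n i, p n i ≤ -w i) (hqw : ∀ n i, -w i ≤ q n i)
    (hp : ∀ i, Tendsto (fun n => p n i) atTop atBot)
    (hq : ∀ i, Tendsto (fun n => q n i) atTop atTop) :
    Tendsto (fun n => energy W fun i => ∫ x, x ∂(truncatedNormal (p n i) (q n i))) atTop (𝓝 0) := by
  have hbd : ∀ n i, W i * (∫ x, x ∂(truncatedNormal (p n i) (q n i))) ^ 2 ≤ W i * (2 + w i ^ 2) := by
    intro n i
    refine mul_le_mul_of_nonneg_left ?_ (hW i)
    simpa using sq_integral_truncatedNormal_le (hpq n i) (hpw n i) (hqw n i)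
  have hsum : ∀ n, Summable fun i => W i * (∫ x, x ∂(truncatedNormal (p n i) (q n i))) ^ 2 :=
    fun n => Summable.of_nonneg_of_le (fun i => mul_nonneg (hW i) (sq_nonneg _)) (hbd n) hw
  simp_rw [fun n => energy_eq_ofReal hW (hsum n)]
  have h0 : Tendsto (fun n => ∑' i, W i * (∫ x, x ∂(truncatedNormal (p n i) (q n i))) ^ 2) atTop
      (𝓝 (∑' _ : ι, (0 : ℝ))) := by
    refine tendsto_tsum_of_dominated_convergence hw (fun i => ?_) (Eventually.of_forall fun n i => ?_)
    · simpa using ((tendsto_integral_truncatedNormal (hp i) (hq i)).pow 2).const_mul (W i)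
    · rw [Real.norm_of_nonneg (mul_nonneg (hW i) (sq_nonneg _))]
      exact hbd n i
  simpa [Function.comp_def] using (ENNReal.continuous_ofReal.tendsto _).comp h0

/-- A Bernstein-von Mises theorem for products of truncated Gaussians: the probability that the
centred product has smaller energy than the centred noise converges. -/
lemma tendsto_infinitePi_truncatedNormal_energy_le [Countable ι] (hW : ∀ i, 0 ≤ W i) {i₀ : ι} (hi₀ : 0 < W i₀)
    (hWs : Summable W) (hw : energy W w < ∞) (hpq : ∀ n i, p n i < q n i)
    (hpw : ∀ n i, p n i ≤ -w i) (hqw : ∀ n i, -w i ≤ q n i)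
    (hp : ∀ i, Tendsto (fun n => p n i) atTop atBot)
    (hq : ∀ i, Tendsto (fun n => q n i) atTop atTop) :
    Tendsto (fun n => Measure.infinitePi (fun i => truncatedNormal (p n i) (q n i))
        {v | energy W (v - fun i => ∫ x, x ∂(truncatedNormal (p n i) (q n i))) ≤
          energy W (w + fun i => ∫ x, x ∂(truncatedNormal (p n i) (q n i)))}) atTop
      (𝓝 (stdGaussian ι {v | energy W v ≤ energy W w})) := by
  have hsum : Summable fun i => W i * (2 + w i ^ 2) := by
    have := (hWs.mul_left 2).add ((energy_lt_top_iff hW).1 hw)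
    exact this.congr fun i => by ring
  have hsum' : ∑' i, ENNReal.ofReal (W i * (2 + w i ^ 2)) ≠ ∞ := by
    rw [← ENNReal.ofReal_tsum_of_nonneg (fun i => mul_nonneg (hW i) (by positivity)) hsum]
    exact ENNReal.ofReal_ne_top
  set m : ℕ → ι → ℝ := fun n i => ∫ x, x ∂(truncatedNormal (p n i) (q n i)) with hm
  set Q : ℕ → Measure (ι → ℝ) := fun n =>
    Measure.infinitePi (fun i => truncatedNormal (p n i) (q n i)) with hQ
  have hm0 : Tendsto (fun n => energyNorm W (m n)) atTop (𝓝 0) := by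
    have := ((ENNReal.continuous_rpow_const (y := 1 / 2)).tendsto _).comp
      (tendsto_energy_integral_truncatedNormal hW hsum hpq hpw hqw hp hq)
    simpa [Function.comp_def, energyNorm] using this
  have ht : energyNorm W w ≠ ∞ := (ENNReal.rpow_lt_top_of_nonneg (by norm_num) hw.ne).ne
  have hG : ∀ s, {v | energy W v ≤ s ^ (2 : ℝ)} = {v | energyNorm W v ≤ s} := fun s => by
    ext v; exact (energyNorm_le_iff W v s).symm
  have hset : ∀ n, {v | energy W (v - m n) ≤ energy W (w + m n)} =
      {v | energyNorm W (v - m n) ≤ energyNorm W (w + m n)} := fun n => by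
    ext v; exact (energyNorm_le_energyNorm_iff W _ _).symm
  have hset' : {v | energy W v ≤ energy W w} = {v | energyNorm W v ≤ energyNorm W w} := by
    ext v; exact (energyNorm_le_energyNorm_iff W _ _).symm
  have hmeas : ∀ s, MeasurableSet {v | energyNorm W v ≤ s} := fun s =>
    measurableSet_le (measurable_energyNorm W) measurable_const
  change Tendsto (fun n => Q n {v | energy W (v - m n) ≤ energy W (w + m n)}) atTop _
  simp_rw [hset]
  rw [hset']
  refine tendsto_order.2 ⟨fun c hc => ?_, fun c hc => ?_⟩
  -- Absence of atoms replaces the closed ball by the open one, which is exhausted by smaller balls.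
  -- Their smaller radius leaves room for the shifts by `m n` on both sides.
  · have hc' : c < stdGaussian ι {v | energyNorm W v < energyNorm W w} := by
      refine hc.trans_le ?_
      have h0 := measure_energy_eq (W := W) hi₀ hw.ne
      calc _ ≤ stdGaussian ι ({v | energyNorm W v < energyNorm W w} ∪
              {v | energy W v = energy W w}) := measure_mono fun v hv => by
            rcases lt_or_eq_of_le (show energyNorm W v ≤ energyNorm W w from hv) with h | h
            · exact Or.inl h
            · exact Or.inr (le_antisymm ((energyNorm_le_energyNorm_iff W _ _).1 h.le)
                ((energyNorm_le_energyNorm_iff W _ _).1 h.ge))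
        _ ≤ _ := measure_union_le _ _
        _ = _ := by rw [h0, add_zero]
    have ht0 : 0 < energyNorm W w := by
      by_contra h
      have : {v : ι → ℝ | energyNorm W v < energyNorm W w} = ∅ := by
        ext v; exact iff_of_false (fun hv => h (lt_of_le_of_lt zero_le hv)) id
      rw [this, measure_empty] at hc'
      exact not_lt_zero hc'
    obtain ⟨u, hu, hut, hulim⟩ := exists_seq_strictMono_tendsto' ht0
    have hun : {v : ι → ℝ | energyNorm W v < energyNorm W w} =
        ⋃ k, {v | energyNorm W v ≤ u k} := by
      ext v
      simp only [Set.mem_iUnion]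
      constructor
      · intro hv
        obtain ⟨k, hk⟩ := ((tendsto_order.1 hulim).1 _ hv).exists
        exact ⟨k, show energyNorm W v ≤ u k from hk.le⟩
      · rintro ⟨k, hk⟩
        exact lt_of_le_of_lt (show energyNorm W v ≤ u k from hk) (hut k).2
    have hlim : Tendsto (fun k => stdGaussian ι {v | energyNorm W v ≤ u k}) atTop
        (𝓝 (stdGaussian ι {v | energyNorm W v < energyNorm W w})) := by
      rw [hun]
      exact tendsto_measure_iUnion_atTop fun k l hkl v hv =>
        (show energyNorm W v ≤ u k from hv).trans (hu.monotone hkl)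
    obtain ⟨k, hk⟩ := ((tendsto_order.1 hlim).1 _ hc').exists
    obtain ⟨s', hs', hs't⟩ := exists_between (hut k).2
    have h1 := eventually_lt_measure_energy_le hW hsum' hpq hpw hqw hp hq
      (s := u k ^ (2 : ℝ)) (s' := s' ^ (2 : ℝ)) (c := c)
      (ENNReal.rpow_lt_rpow hs' (by norm_num))
      (ENNReal.rpow_lt_top_of_nonneg (by norm_num) hs't.ne_top).ne (by rwa [hG])
    have h2 : Tendsto (fun n => s' + energyNorm W (m n) + energyNorm W (m n)) atTop
        (𝓝 (s' + 0 + 0)) := (tendsto_const_nhds.add hm0).add hm0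
    have h3 := (tendsto_order.1 h2).2 (energyNorm W w) (by simpa using hs't)
    filter_upwards [h1, h3] with n hn hn3
    refine hn.trans_le (measure_mono ?_)
    rw [hG]
    intro v hv
    replace hv : energyNorm W v ≤ s' := hv
    have h4 : energyNorm W (v - m n) ≤ s' + energyNorm W (m n) :=
      (energyNorm_sub_le hW _ _).trans (by gcongr)
    have h5 := energyNorm_le_add_add hW w (m n)
    have h6 : s' + energyNorm W (m n) + energyNorm W (m n) ≤
        energyNorm W (w + m n) + energyNorm W (m n) := hn3.le.trans h5
    have hfin : energyNorm W (m n) ≠ ∞ := fun h => by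
      rw [h, add_top] at hn3; exact not_top_lt hn3
    exact h4.trans ((ENNReal.add_le_add_iff_right hfin).1 h6)
  -- The upper bound needs no absence of atoms: the closed ball is the intersection of the larger
  -- balls of radii `u k`, and these absorb the shifts.
  · obtain ⟨u, hu, hut, hulim⟩ := exists_seq_strictAnti_tendsto' (lt_top_iff_ne_top.2 ht)
    have hint : {v : ι → ℝ | energyNorm W v ≤ energyNorm W w} =
        ⋂ k, {v | energyNorm W v ≤ u k} := by
      ext v
      simp only [Set.mem_iInter]
      constructor
      · intro hv k
        exact (show energyNorm W v ≤ energyNorm W w from hv).trans (hut k).1.le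
      · intro hv
        exact ge_of_tendsto' hulim hv
    have hlim : Tendsto (fun k => stdGaussian ι {v | energyNorm W v ≤ u k}) atTop
        (𝓝 (stdGaussian ι {v | energyNorm W v ≤ energyNorm W w})) := by
      rw [hint]
      exact tendsto_measure_iInter_atTop (fun k => (hmeas _).nullMeasurableSet)
        (fun k l hkl v hv => (show energyNorm W v ≤ u l from hv).trans (hu.antitone hkl))
        ⟨0, measure_ne_top _ _⟩
    obtain ⟨k, hk⟩ := ((tendsto_order.1 hlim).2 _ hc).exists
    have h1 := eventually_measure_energy_le_lt (W := W) hpq hp hq (s := u k ^ (2 : ℝ)) (c := c)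
      (by rwa [hG])
    have h2 : Tendsto (fun n => energyNorm W w + energyNorm W (m n) + energyNorm W (m n)) atTop
        (𝓝 (energyNorm W w + 0 + 0)) := (tendsto_const_nhds.add hm0).add hm0
    have h3 := (tendsto_order.1 h2).2 (u k) (by simpa using (hut k).1)
    filter_upwards [h1, h3] with n hn hn3
    refine lt_of_le_of_lt (measure_mono ?_) hn
    rw [hG]
    intro v hv
    replace hv : energyNorm W (v - m n) ≤ energyNorm W (w + m n) := hv
    change energyNorm W v ≤ u k
    calc energyNorm W v ≤ energyNorm W (v - m n) + energyNorm W (m n) := energyNorm_le_sub_add hW _ _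
      _ ≤ energyNorm W w + energyNorm W (m n) + energyNorm W (m n) := by
          gcongr
          exact hv.trans (energyNorm_add_le hW _ _)
      _ ≤ u k := hn3.le

end BernsteinVonMises

variable {J₀ K : ℕ}

/-! ### Summability of the weights and of the prior half-widths -/

section Weights

/-- The weights of `H(δ)` as a function of the index. -/
abbrev idxWeight (J₀ K : ℕ) (δ : ℝ) : Idx J₀ K → ℝ := fun i => weight δ i.1

lemma idxWeight_nonneg (δ : ℝ) (i : Idx J₀ K) : 0 ≤ idxWeight J₀ K δ i := weight_nonneg δ i.1

lemma weight_pos (δ : ℝ) (l : ℕ) : 0 < weight δ l := by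
  have h := charSeq_ge l
  have h1 : 0 < Real.log (charSeq l) := Real.log_pos (by linarith)
  unfold weight
  positivity

lemma charSeq_eq {l : ℕ} (hl : 1 ≤ l) : charSeq l = 2 ^ l :=
  max_eq_right (le_self_pow₀ (by norm_num) (by omega))

lemma log_charSeq {l : ℕ} (hl : 1 ≤ l) : Real.log (charSeq l) = l * Real.log 2 := by
  rw [charSeq_eq hl, Real.log_pow]

lemma summable_idx {f : ℕ → ℝ} (hf : ∀ l, 0 ≤ f l) (h : Summable fun l => (2 : ℝ) ^ l * f l) :
    Summable fun i : Idx J₀ K => f i.1 := by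
  rw [summable_sigma_of_nonneg fun i => hf i.1]
  refine ⟨fun l => Summable.of_finite, ?_⟩
  refine Summable.of_norm_bounded_eventually_nat h ?_
  filter_upwards [eventually_ge_atTop J₀] with l hl
  rw [tsum_fintype]
  simp only [Finset.sum_const, Finset.card_univ, Fintype.card_fin, nsmul_eq_mul]
  rw [Real.norm_of_nonneg (mul_nonneg (Nat.cast_nonneg _) (hf l)), levelSize, if_pos hl]
  push_cast
  exact le_rfl

/-- A level `l ≥ J₀` carries `2^l` coefficients, so for `l ≥ 1` its total weight is `(l log
2)^{-2δ}`. This is where `δ > 1/2` enters. -/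
lemma summable_idxWeight {δ : ℝ} (hδ : 1 / 2 < δ) : Summable (idxWeight J₀ K δ) := by
  refine summable_idx (weight_nonneg δ) ?_
  have h := (Real.summable_nat_rpow (p := -2 * δ)).2 (by linarith)
  refine Summable.of_norm_bounded_eventually_nat (h.mul_right (Real.log 2 ^ (-2 * δ))) ?_
  filter_upwards [eventually_ge_atTop 1] with l hl
  have h2 : 0 < Real.log 2 := Real.log_pos (by norm_num)
  rw [weight, log_charSeq hl, charSeq_eq hl, mul_inv_cancel_left₀ (by positivity),
    Real.mul_rpow (by positivity) h2.le, Real.norm_of_nonneg (by positivity)]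

/-- The half-width `2^{-l(γ+1/2)} M` of the support of the prior in each coordinate. -/
def halfWidth (J₀ K : ℕ) (γ M : ℝ) (i : Idx J₀ K) : ℝ := (2 : ℝ) ^ (-(i.1 : ℝ) * (γ + 1 / 2)) * M

lemma halfWidth_pos (γ : ℝ) {M : ℝ} (hM : 0 < M) (i : Idx J₀ K) : 0 < halfWidth J₀ K γ M i :=
  mul_pos (Real.rpow_pos_of_pos two_pos _) hM

/-- The squared half-widths of a full level add up to a multiple of `2^{-2γl}`; this gives the bias
term of the rate. -/
lemma two_pow_mul_sq_rpow (γ : ℝ) (l : ℕ) :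
    (2 : ℝ) ^ l * ((2 : ℝ) ^ (-(l : ℝ) * (γ + 1 / 2))) ^ 2 = ((2 : ℝ) ^ (-2 * γ)) ^ l := by
  rw [← Real.rpow_natCast ((2 : ℝ) ^ (-2 * γ)), ← Real.rpow_natCast _ 2, ← Real.rpow_mul two_pos.le,
    ← Real.rpow_mul two_pos.le, ← Real.rpow_natCast, ← Real.rpow_add two_pos]
  congr 1
  push_cast
  ring

lemma two_rpow_neg_lt_one {γ : ℝ} (hγ : 0 < γ) : (2 : ℝ) ^ (-2 * γ) < 1 :=
  Real.rpow_lt_one_of_one_lt_of_neg (by norm_num) (by linarith)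

lemma summable_halfWidth_sq {γ : ℝ} (hγ : 0 < γ) (M : ℝ) :
    Summable fun i : Idx J₀ K => halfWidth J₀ K γ M i ^ 2 := by
  refine summable_idx (f := fun l => ((2 : ℝ) ^ (-(l : ℝ) * (γ + 1 / 2)) * M) ^ 2)
    (fun l => sq_nonneg _) ?_
  simp_rw [mul_pow, ← mul_assoc, two_pow_mul_sq_rpow]
  exact (summable_geometric_of_lt_one (by positivity) (two_rpow_neg_lt_one hγ)).mul_right _

end Weights

/-! ### White noise and the observation in coordinates -/

section NoiseSpace

lemma mem_H_iff {δ : ℝ} (c : Idx J₀ K → ℝ) : c ∈ H J₀ K δ ↔ energy (idxWeight J₀ K δ) c < ∞ :=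
  (energy_lt_top_iff (idxWeight_nonneg δ)).symm

lemma measurableSet_H (δ : ℝ) : MeasurableSet (H J₀ K δ : Set (Idx J₀ K → ℝ)) := by
  have : (H J₀ K δ : Set (Idx J₀ K → ℝ)) = {c | energy (idxWeight J₀ K δ) c < ∞} := by
    ext c; exact mem_H_iff c
  rw [this]
  exact measurableSet_lt (measurable_energy _) measurable_const

lemma measurableEmbedding_val (δ : ℝ) :
    MeasurableEmbedding (Subtype.val : H J₀ K δ → Idx J₀ K → ℝ) :=
  MeasurableEmbedding.subtype_coe (measurableSet_H δ)

/-- Restricting the product measure to `H(δ)` loses nothing, as the energy of white noise is almost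
surely finite. -/
lemma map_val_gaussianH {δ : ℝ} (hδ : 1 / 2 < δ) :
    (gaussianH J₀ K δ).map Subtype.val = stdGaussian (Idx J₀ K) := by
  rw [gaussianH, (measurableEmbedding_val δ).map_comap]
  refine Measure.restrict_eq_self_of_ae_mem ?_
  filter_upwards [ae_energy_lt_top (idxWeight_nonneg δ) (summable_idxWeight hδ)] with v hv
  exact ⟨⟨v, (mem_H_iff v).2 hv⟩, rfl⟩

/-- The sign condition has to be kept, since `r ^ 2` does not see a negative radius, whose ball is
empty. -/
lemma hNorm_le_iff {δ : ℝ} (c : H J₀ K δ) (r : ℝ) :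
    hNorm c ≤ r ↔ 0 ≤ r ∧ energy (idxWeight J₀ K δ) c ≤ ENNReal.ofReal (r ^ 2) := by
  rw [hNorm, Real.sqrt_le_iff, energy_eq_ofReal (idxWeight_nonneg δ) c.2]
  refine and_congr_right fun hr => ?_
  rw [ENNReal.ofReal_le_ofReal_iff (sq_nonneg r)]

lemma mem_hBall_iff (ψ : HilbertBasis (Idx J₀ K) ℝ L2) (δ : ℝ) (f g : L2) (r : ℝ) :
    f ∈ hBall ψ δ g r ↔
      0 ≤ r ∧ energy (idxWeight J₀ K δ) (coeff ψ f - coeff ψ g) ≤ ENNReal.ofReal (r ^ 2) :=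
  hNorm_le_iff (toH ψ δ f - toH ψ δ g) r

/-- The variance `1 / n` of the coordinates of the observation. -/
abbrev noiseVar (n : ℕ) : ℝ≥0 := (n : ℝ≥0)⁻¹

lemma noiseVar_ne_zero {n : ℕ} (hn : 1 ≤ n) : noiseVar n ≠ 0 := by
  have : (n : ℝ≥0) ≠ 0 := by exact_mod_cast (by omega : n ≠ 0)
  exact inv_ne_zero this

lemma gaussianReal_map_affine (n : ℕ) (a : ℝ) :
    (gaussianReal 0 1).map (fun x => a + (√(n : ℝ))⁻¹ * x) = gaussianReal a (noiseVar n) := by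
  have h := Measure.map_map (μ := gaussianReal 0 1) (g := fun y => a + y)
    (f := fun x => (√(n : ℝ))⁻¹ * x) (by fun_prop) (by fun_prop)
  rw [Function.comp_def] at h
  rw [← h, gaussianReal_map_const_mul, gaussianReal_map_const_add]
  congr 1
  · ring
  · ext
    simp

/-- The observation in coordinates. -/
def observeCoord (n : ℕ) (c w : Idx J₀ K → ℝ) : Idx J₀ K → ℝ := fun i => c i + (√(n : ℝ))⁻¹ * w i

lemma map_observeCoord (n : ℕ) (c : Idx J₀ K → ℝ) :
    (stdGaussian (Idx J₀ K)).map (observeCoord n c) =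
      Measure.infinitePi fun i => gaussianReal (c i) (noiseVar n) := by
  refine (Measure.infinitePi_map_pi (fun _ : Idx J₀ K => gaussianReal 0 1)
    (f := fun i x => c i + (√(n : ℝ))⁻¹ * x) (fun i => by fun_prop)).trans ?_
  simp_rw [gaussianReal_map_affine]

lemma measurable_observeCoord (n : ℕ) (c : Idx J₀ K → ℝ) : Measurable (observeCoord n c) := by
  unfold observeCoord; fun_prop

variable (ψ : HilbertBasis (Idx J₀ K) ℝ L2)

lemma model_apply (δ : ℝ) (n : ℕ) (f : L2) :
    model ψ δ n f = (gaussianH J₀ K δ).map (observe ψ δ n f) := rfl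

lemma map_val_model_eq_observeCoord {δ : ℝ} (hδ : 1 / 2 < δ) (n : ℕ) (f : L2) :
    (model ψ δ n f).map Subtype.val = (stdGaussian (Idx J₀ K)).map (observeCoord n (coeff ψ f)) := by
  have hm : Measurable (observe ψ δ n f) :=
    (measurable_observe ψ δ n).comp measurable_prodMk_left
  rw [model_apply, Measure.map_map measurable_subtype_coe hm, ← map_val_gaussianH hδ,
    Measure.map_map (measurable_observeCoord n _) measurable_subtype_coe]
  rfl

lemma map_val_model {δ : ℝ} (hδ : 1 / 2 < δ) (n : ℕ) (f : L2) :
    (model ψ δ n f).map Subtype.val =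
      Measure.infinitePi fun i => gaussianReal (coeff ψ f i) (noiseVar n) := by
  rw [map_val_model_eq_observeCoord ψ hδ, map_observeCoord]

lemma summable_coeff_sq (f : L2) : Summable fun i => coeff ψ f i ^ 2 := by
  have h : Summable fun i => ‖inner ℝ (ψ i) f‖ ^ 2 := ψ.orthonormal.inner_products_summable f
  refine h.congr fun i => ?_
  rw [Real.norm_eq_abs, sq_abs]
  rfl

/-- The laws of the observation for two signals in `L²` are mutually absolutely continuous. -/
lemma model_absolutelyContinuous {δ : ℝ} (hδ : 1 / 2 < δ) {n : ℕ} (hn : 1 ≤ n) (f g : L2) :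
    model ψ δ n f ≪ model ψ δ n g := by
  have hv := noiseVar_ne_zero hn
  -- By Parseval the exponents `n (f_i - g_i)²` of the coordinate integrals are summable, so the
  -- finite products are bounded by the exponential of their sum.
  have hsum : Summable fun i => (coeff ψ f i - coeff ψ g i) ^ 2 / (noiseVar n : ℝ) := by
    refine Summable.div_const ?_ _
    refine (summable_coeff_sq ψ (f - g)).congr fun i => ?_
    simp only [coeff, inner_sub_right]
  have hac : (Measure.infinitePi fun i => gaussianReal (coeff ψ f i) (noiseVar n)) ≪
      Measure.infinitePi fun i => gaussianReal (coeff ψ g i) (noiseVar n) := by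
    refine infinitePi_absolutelyContinuous _ _
      (fun i => measurable_gaussianRatio (noiseVar n) (coeff ψ f i) (coeff ψ g i))
      (fun i => gaussianReal_eq_withDensity hv _ _)
      (C := ENNReal.ofReal (Real.exp (∑' i, (coeff ψ f i - coeff ψ g i) ^ 2 / (noiseVar n : ℝ))))
      ENNReal.ofReal_ne_top fun s => ?_
    simp_rw [lintegral_gaussianRatio_sq hv]
    rw [← ENNReal.ofReal_prod_of_nonneg fun i _ => (Real.exp_pos _).le, ← Real.exp_sum]
    refine ENNReal.ofReal_le_ofReal (Real.exp_le_exp.2 (hsum.sum_le_tsum s fun i _ => ?_))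
    positivity
  refine Measure.AbsolutelyContinuous.mk fun A hA h => ?_
  obtain ⟨A', hA', rfl⟩ := hA
  rw [← Measure.map_apply measurable_subtype_coe hA', map_val_model ψ hδ] at h ⊢
  exact hac h

end NoiseSpace

/-! ### Functions from truncated coefficient arrays -/

section Synthesis

variable (ψ : HilbertBasis (Idx J₀ K) ℝ L2)

/-- The function with given wavelet coefficients. -/
def synth (c : Idx J₀ K → ℝ) : L2 := ∑' i, c i • ψ i

lemma synth_eq {c : Idx J₀ K → ℝ} (hc : Memℓp c 2) : synth ψ c = ψ.repr.symm ⟨c, hc⟩ :=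
  (ψ.hasSum_repr_symm ⟨c, hc⟩).tsum_eq

lemma coeff_eq_repr (f : L2) (i : Idx J₀ K) : coeff ψ f i = ψ.repr f i :=
  (ψ.repr_apply_apply f i).symm

lemma coeff_synth {c : Idx J₀ K → ℝ} (hc : Memℓp c 2) : coeff ψ (synth ψ c) = c := by
  ext i
  rw [synth_eq ψ hc, coeff_eq_repr, LinearIsometryEquiv.apply_symm_apply]

lemma memℓp_of_abs_le {a c : Idx J₀ K → ℝ} (ha : Summable fun i => a i ^ 2) (h : ∀ i, |c i| ≤ a i) :
    Memℓp c 2 := by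
  refine memℓp_gen ?_
  simp only [ENNReal.toReal_ofNat, Real.rpow_two, Real.norm_eq_abs]
  exact Summable.of_nonneg_of_le (fun i => sq_nonneg _)
    (fun i => pow_le_pow_left₀ (abs_nonneg _) (h i) 2) ha

/-- Coordinatewise truncation to `[-a_i, a_i]`. -/
def clip (a c : Idx J₀ K → ℝ) : Idx J₀ K → ℝ := fun i => max (-a i) (min (a i) (c i))

lemma measurable_clip (a : Idx J₀ K → ℝ) : Measurable (clip a) := by
  unfold clip; fun_prop

lemma clip_eq_self {a c : Idx J₀ K → ℝ} (h : ∀ i, c i ∈ Set.Icc (-a i) (a i)) : clip a c = c := by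
  ext i
  rw [clip, min_eq_right (h i).2, max_eq_right (h i).1]

lemma abs_clip_le {a : Idx J₀ K → ℝ} (ha : ∀ i, 0 ≤ a i) (c : Idx J₀ K → ℝ) (i : Idx J₀ K) :
    |clip a c i| ≤ a i :=
  abs_le.2 ⟨le_max_left _ _, max_le (by linarith [ha i]) (min_le_left _ _)⟩

/-- The function whose coefficients are the truncations of `c`. -/
def synthClip (a c : Idx J₀ K → ℝ) : L2 := synth ψ (clip a c)

variable {a : Idx J₀ K → ℝ}

lemma memℓp_clip (ha : ∀ i, 0 ≤ a i) (has : Summable fun i => a i ^ 2) (c : Idx J₀ K → ℝ) :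
    Memℓp (clip a c) 2 :=
  memℓp_of_abs_le has (abs_clip_le ha c)

lemma coeff_synthClip (ha : ∀ i, 0 ≤ a i) (has : Summable fun i => a i ^ 2) (c : Idx J₀ K → ℝ) :
    coeff ψ (synthClip ψ a c) = clip a c :=
  coeff_synth ψ (memℓp_clip ha has c)

/-- Truncation makes the series converge for every array, so the synthesis map is a pointwise limit
of measurable partial sums everywhere and not only almost surely. -/
lemma measurable_synthClip (ha : ∀ i, 0 ≤ a i) (has : Summable fun i => a i ^ 2) :
    Measurable (synthClip ψ a) := by
  have : Fact ((2 : ℝ≥0∞) ≠ ∞) := ⟨by simp⟩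
  have : SecondCountableTopology L2 := Lp.SecondCountableTopology
  refine measurable_of_tendsto_metrizable' (f := fun (s : Finset (Idx J₀ K)) c =>
    ∑ i ∈ s, clip a c i • ψ i) atTop (fun s => ?_) (tendsto_pi_nhds.2 fun c => ?_)
  · exact Finset.measurable_fun_sum _ fun i _ =>
      ((measurable_pi_apply i).comp (measurable_clip a)).smul_const (ψ i)
  · have h := ψ.hasSum_repr_symm ⟨clip a c, memℓp_clip ha has c⟩
    rw [← synth_eq] at h
    exact h

lemma norm_sq_eq_tsum (f : L2) : ‖f‖ ^ 2 = ∑' i, coeff ψ f i ^ 2 := by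
  have h := ψ.tsum_inner_mul_inner f f
  rw [← real_inner_self_eq_norm_sq, ← h]
  refine tsum_congr fun i => ?_
  rw [coeff, real_inner_comm, sq]

lemma norm_synthClip_sq_le (ha : ∀ i, 0 ≤ a i) (has : Summable fun i => a i ^ 2)
    (c : Idx J₀ K → ℝ) : ‖synthClip ψ a c‖ ^ 2 ≤ ∑' i, a i ^ 2 := by
  rw [norm_sq_eq_tsum ψ]
  refine (summable_coeff_sq ψ _).tsum_le_tsum (fun i => ?_) has
  rw [coeff_synthClip ψ ha has, ← sq_abs]
  exact pow_le_pow_left₀ (abs_nonneg _) (abs_clip_le ha c i) 2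

end Synthesis

/-! ### The prior as an image of a product of uniform laws -/

section Prior

lemma uniformIcc_map_mul {s M : ℝ} (hs : 0 < s) :
    (uniformIcc (-M) M).map (fun x => s * x) = uniformIcc (-(s * M)) (s * M) := by
  have hI : Set.Icc (-M) M = (fun x => s * x) ⁻¹' Set.Icc (-(s * M)) (s * M) := by
    ext x
    simp only [Set.mem_preimage, Set.mem_Icc]
    rw [← mul_neg, mul_le_mul_iff_right₀ hs, mul_le_mul_iff_right₀ hs]
  ext A hA
  have hk : ENNReal.ofReal |s⁻¹| ≠ 0 := by simp [hs.ne']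
  rw [Measure.map_apply (by fun_prop) hA, cond_apply measurableSet_Icc, cond_apply measurableSet_Icc,
    hI, ← Set.preimage_inter, Real.volume_preimage_mul_left hs.ne',
    Real.volume_preimage_mul_left hs.ne', ENNReal.mul_inv (Or.inl hk) (Or.inl (by simp)),
    mul_mul_mul_comm, ENNReal.inv_mul_cancel hk (by simp), one_mul]

lemma ae_infinitePi_mem {ι : Type*} [Countable ι] {μ : ι → Measure ℝ}
    [∀ i, IsProbabilityMeasure (μ i)] {B : ι → Set ℝ} (h : ∀ i, ∀ᵐ x ∂(μ i), x ∈ B i) :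
    ∀ᵐ c ∂(Measure.infinitePi μ), ∀ i, c i ∈ B i :=
  ae_all_iff.2 fun i => (measurePreserving_eval_infinitePi μ i).quasiMeasurePreserving.ae (h i)

variable (ψ : HilbertBasis (Idx J₀ K) ℝ L2)

/-- The prior in coordinates. -/
abbrev priorCoord (J₀ K : ℕ) (γ M : ℝ) : Measure (Idx J₀ K → ℝ) :=
  Measure.infinitePi fun i => uniformIcc (-halfWidth J₀ K γ M i) (halfWidth J₀ K γ M i)

lemma isProbabilityMeasure_uniformIcc_halfWidth (γ : ℝ) {M : ℝ} (hM : 0 < M) (i : Idx J₀ K) :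
    IsProbabilityMeasure (uniformIcc (-halfWidth J₀ K γ M i) (halfWidth J₀ K γ M i)) :=
  isProbabilityMeasure_uniformIcc (by linarith [halfWidth_pos γ hM i])

/-- Almost every array drawn from the prior lies in the box, where truncation is the identity. -/
lemma uniformPrior_eq_map {γ M : ℝ} (hγ : 0 < γ) (hM : 0 < M) :
    uniformPrior ψ γ M = (priorCoord J₀ K γ M).map (synthClip ψ (halfWidth J₀ K γ M)) := by
  have hprob : IsProbabilityMeasure (uniformIcc (-M) M) :=
    isProbabilityMeasure_uniformIcc (by linarith)
  have hm := measurable_synthClip ψ (fun i => (halfWidth_pos γ hM i).le)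
    (summable_halfWidth_sq (J₀ := J₀) (K := K) hγ M)
  set s : Idx J₀ K → ℝ := fun i => (2 : ℝ) ^ (-(i.1 : ℝ) * (γ + 1 / 2))
  have hs : ∀ i, 0 < s i := fun i => Real.rpow_pos_of_pos two_pos _
  have hmap : priorCoord J₀ K γ M = (uniformArray J₀ K M).map fun u i => s i * u i := by
    refine Eq.trans ?_ (Measure.infinitePi_map_pi (fun _ : Idx J₀ K => uniformIcc (-M) M)
      (f := fun i x => s i * x) (fun i => by fun_prop)).symm
    simp_rw [uniformIcc_map_mul (hs _)]
    rfl
  rw [uniformPrior, hmap, Measure.map_map hm (by fun_prop)]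
  refine Measure.map_congr ?_
  filter_upwards [ae_infinitePi_mem (μ := fun _ : Idx J₀ K => uniformIcc (-M) M)
    (fun i => ae_cond_mem measurableSet_Icc)] with u hu
  have hclip : clip (halfWidth J₀ K γ M) (fun i => s i * u i) = fun i => s i * u i := by
    refine clip_eq_self fun i => ⟨?_, mul_le_mul_of_nonneg_left (hu i).2 (hs i).le⟩
    rw [halfWidth, ← mul_neg]
    exact mul_le_mul_of_nonneg_left (hu i).1 (hs i).le
  rw [Function.comp_apply, synthClip, hclip]
  rfl

end Prior

/-! ### The posterior as a product of truncated Gaussians -/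

section Posterior

/-- The posterior in coordinates: independent truncated Gaussians. -/
abbrev posteriorCoord (n : ℕ) (a x : Idx J₀ K → ℝ) : Measure (Idx J₀ K → ℝ) :=
  Measure.infinitePi fun i => truncatedKernel (noiseVar n) (-a i) (a i) (x i)

lemma isMarkovKernel_truncatedKernel_noise {n : ℕ} (hn : 1 ≤ n) {a : Idx J₀ K → ℝ}
    (ha : ∀ i, 0 < a i) (i : Idx J₀ K) :
    IsMarkovKernel (truncatedKernel (noiseVar n) (-a i) (a i)) :=
  isMarkovKernel_truncatedKernel (noiseVar_ne_zero hn) (by linarith [ha i])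

/-- The posterior kernel in coordinates. -/
def posteriorCoordKernel {n : ℕ} (hn : 1 ≤ n) {a : Idx J₀ K → ℝ} (ha : ∀ i, 0 < a i) :
    Kernel (Idx J₀ K → ℝ) (Idx J₀ K → ℝ) :=
  haveI := isMarkovKernel_truncatedKernel_noise hn ha
  piKernel fun i => truncatedKernel (noiseVar n) (-a i) (a i)

lemma posteriorCoordKernel_apply {n : ℕ} (hn : 1 ≤ n) {a : Idx J₀ K → ℝ} (ha : ∀ i, 0 < a i)
    (x : Idx J₀ K → ℝ) : posteriorCoordKernel hn ha x = posteriorCoord n a x := rfl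

instance {n : ℕ} (hn : 1 ≤ n) {a : Idx J₀ K → ℝ} (ha : ∀ i, 0 < a i) :
    IsMarkovKernel (posteriorCoordKernel hn ha) := by
  have := isMarkovKernel_truncatedKernel_noise hn ha
  unfold posteriorCoordKernel
  infer_instance

variable (ψ : HilbertBasis (Idx J₀ K) ℝ L2) {γ M δ : ℝ}

/-- The explicit posterior on `L²`. -/
def productPosterior (γ : ℝ) (hM : 0 < M) (δ : ℝ) {n : ℕ} (hn : 1 ≤ n) : Kernel (H J₀ K δ) L2 :=
  ((posteriorCoordKernel hn (halfWidth_pos (J₀ := J₀) (K := K) γ hM)).comap Subtype.val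
    measurable_subtype_coe).map (synthClip ψ (halfWidth J₀ K γ M))

lemma measurable_synthClip_halfWidth (hγ : 0 < γ) (hM : 0 < M) :
    Measurable (synthClip ψ (halfWidth J₀ K γ M)) :=
  measurable_synthClip ψ (fun i => (halfWidth_pos γ hM i).le) (summable_halfWidth_sq hγ M)

lemma productPosterior_apply (hγ : 0 < γ) (hM : 0 < M) {n : ℕ} (hn : 1 ≤ n) (x : H J₀ K δ) :
    productPosterior ψ γ hM δ hn x = (posteriorCoord n (halfWidth J₀ K γ M) x.1).map
      (synthClip ψ (halfWidth J₀ K γ M)) := by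
  rw [productPosterior, Kernel.map_apply _ (measurable_synthClip_halfWidth ψ hγ hM),
    Kernel.comap_apply, posteriorCoordKernel_apply]

lemma isMarkovKernel_productPosterior (hγ : 0 < γ) (hM : 0 < M) {n : ℕ} (hn : 1 ≤ n) :
    IsMarkovKernel (productPosterior ψ γ hM δ hn) := by
  unfold productPosterior
  exact Kernel.IsMarkovKernel.map _ (measurable_synthClip_halfWidth ψ hγ hM)

lemma posterior_joint_coord (γ : ℝ) (hM : 0 < M) {n : ℕ} (hn : 1 ≤ n) :
    (Measure.infinitePi fun i => gaussianKernel (noiseVar n) ∘ₘ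
      uniformIcc (-halfWidth J₀ K γ M i) (halfWidth J₀ K γ M i)) ⊗ₘ
        posteriorCoordKernel hn (halfWidth_pos γ hM) =
      (priorCoord J₀ K γ M ⊗ₘ piKernel fun _ => gaussianKernel (noiseVar n)).map Prod.swap := by
  have h1 := isProbabilityMeasure_uniformIcc_halfWidth (J₀ := J₀) (K := K) γ hM
  have h2 := isMarkovKernel_truncatedKernel_noise hn (halfWidth_pos (J₀ := J₀) (K := K) γ hM)
  have h3 : ∀ i : Idx J₀ K, IsProbabilityMeasure (gaussianKernel (noiseVar n) ∘ₘ
      uniformIcc (-halfWidth J₀ K γ M i) (halfWidth J₀ K γ M i)) := fun i => by infer_instance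
  exact infinitePi_compProd_piKernel_swap fun i => uniformIcc_compProd_swap (noiseVar_ne_zero hn)
    (by linarith [halfWidth_pos γ hM i])

lemma isProbabilityMeasure_uniformPrior (hγ : 0 < γ) (hM : 0 < M) :
    IsProbabilityMeasure (uniformPrior ψ γ M) := by
  have h1 := isProbabilityMeasure_uniformIcc_halfWidth (J₀ := J₀) (K := K) γ hM
  rw [uniformPrior_eq_map ψ hγ hM]
  exact Measure.isProbabilityMeasure_map (measurable_synthClip_halfWidth ψ hγ hM).aemeasurable

lemma joint_apply (hγ : 0 < γ) (hM : 0 < M) (hδ : 1 / 2 < δ) (n : ℕ) {A : Set (Idx J₀ K → ℝ)}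
    (hA : MeasurableSet A) {B : Set L2} (hB : MeasurableSet B) :
    (uniformPrior ψ γ M ⊗ₘ model ψ δ n) (B ×ˢ (Subtype.val ⁻¹' A)) =
      (priorCoord J₀ K γ M ⊗ₘ piKernel fun _ => gaussianKernel (noiseVar n))
        ((synthClip ψ (halfWidth J₀ K γ M) ⁻¹' B) ×ˢ A) := by
  have h1 := isProbabilityMeasure_uniformIcc_halfWidth (J₀ := J₀) (K := K) γ hM
  have hm := measurable_synthClip_halfWidth ψ hγ hM
  have hA' : MeasurableSet ((Subtype.val : H J₀ K δ → _) ⁻¹' A) := measurable_subtype_coe hA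
  rw [Measure.compProd_apply_prod hB hA', Measure.compProd_apply_prod (hm hB) hA,
    uniformPrior_eq_map ψ hγ hM, setLIntegral_map hB ((model ψ δ n).measurable_coe hA') hm]
  refine lintegral_congr_ae (ae_restrict_of_ae ?_)
  filter_upwards [ae_infinitePi_mem
    (μ := fun i => uniformIcc (-halfWidth J₀ K γ M i) (halfWidth J₀ K γ M i))
    (fun i => ae_cond_mem measurableSet_Icc)] with c hc
  rw [← Measure.map_apply measurable_subtype_coe hA, map_val_model ψ hδ,
    coeff_synthClip ψ (fun i => (halfWidth_pos γ hM i).le) (summable_halfWidth_sq hγ M),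
    clip_eq_self hc]
  rfl

/-- Both joint laws are compared on rectangles and pulled back to coordinates, where the identity is
`posterior_joint_coord`; measurable sets of `H(δ)` are traces of measurable sets of arrays. -/
lemma productPosterior_joint (hγ : 0 < γ) (hM : 0 < M) (hδ : 1 / 2 < δ) {n : ℕ} (hn : 1 ≤ n) :
    (model ψ δ n ∘ₘ uniformPrior ψ γ M) ⊗ₘ productPosterior ψ γ hM δ hn =
      (uniformPrior ψ γ M ⊗ₘ model ψ δ n).map Prod.swap := by
  have h1 := isProbabilityMeasure_uniformIcc_halfWidth (J₀ := J₀) (K := K) γ hM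
  have h2 := isMarkovKernel_productPosterior (δ := δ) ψ hγ hM hn
  have h3 : ∀ i : Idx J₀ K, IsProbabilityMeasure (gaussianKernel (noiseVar n) ∘ₘ
      uniformIcc (-halfWidth J₀ K γ M i) (halfWidth J₀ K γ M i)) := fun i => by infer_instance
  have hm := measurable_synthClip_halfWidth ψ hγ hM
  have hj : ∀ A B : Set (Idx J₀ K → ℝ), MeasurableSet A → MeasurableSet B →
      (priorCoord J₀ K γ M ⊗ₘ piKernel fun _ => gaussianKernel (noiseVar n)) (B ×ˢ A) =
        ((Measure.infinitePi fun i => gaussianKernel (noiseVar n) ∘ₘ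
          uniformIcc (-halfWidth J₀ K γ M i) (halfWidth J₀ K γ M i)) ⊗ₘ
            posteriorCoordKernel hn (halfWidth_pos γ hM)) (A ×ˢ B) := by
    intro A B hA hB
    rw [posterior_joint_coord γ hM, Measure.map_apply measurable_swap (hA.prod hB),
      Set.preimage_swap_prod]
  have hmarg : (model ψ δ n ∘ₘ uniformPrior ψ γ M).map Subtype.val =
      Measure.infinitePi fun i => gaussianKernel (noiseVar n) ∘ₘ
        uniformIcc (-halfWidth J₀ K γ M i) (halfWidth J₀ K γ M i) := by
    ext A hA
    rw [Measure.map_apply measurable_subtype_coe hA, ← Measure.snd_compProd,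
      Measure.snd_apply (measurable_subtype_coe hA), ← Set.univ_prod,
      joint_apply ψ hγ hM hδ n hA MeasurableSet.univ, Set.preimage_univ,
      hj A _ hA MeasurableSet.univ, Measure.compProd_apply_prod hA MeasurableSet.univ]
    simp
  refine Measure.ext_prod fun {A B} hA hB => ?_
  obtain ⟨A', hA', rfl⟩ := hA
  have hA := measurable_subtype_coe (p := fun c => c ∈ H J₀ K δ) hA'
  rw [Measure.map_apply measurable_swap (hA.prod hB), Set.preimage_swap_prod,
    joint_apply ψ hγ hM hδ n hA' hB, hj A' _ hA' (hm hB), Measure.compProd_apply_prod hA hB,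
    Measure.compProd_apply_prod hA' (hm hB), ← hmarg,
    setLIntegral_map hA' (Kernel.measurable_coe _ (hm hB)) measurable_subtype_coe]
  refine lintegral_congr fun x => ?_
  rw [productPosterior_apply ψ hγ hM hn, Measure.map_apply hm hB, posteriorCoordKernel_apply]

/-- Under `P_f^n`, the posterior is almost surely the explicit product of truncated Gaussians. -/
lemma ae_uniformPosterior_eq (hγ : 0 < γ) (hM : 0 < M) (hδ : 1 / 2 < δ) {n : ℕ} (hn : 1 ≤ n)
    (f : L2) :
    ∀ᵐ x ∂(model ψ δ n f), uniformPosterior ψ γ M δ n x = productPosterior ψ γ hM δ hn x := by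
  have h1 := isMarkovKernel_productPosterior (δ := δ) ψ hγ hM hn
  have h2 := isProbabilityMeasure_uniformPrior ψ hγ hM
  have h := ae_eq_posterior_of_compProd_eq (productPosterior_joint ψ hγ hM hδ hn)
  have hac : model ψ δ n f ≪ model ψ δ n ∘ₘ uniformPrior ψ γ M := by
    refine Measure.AbsolutelyContinuous.mk fun A hA hA0 => ?_
    rw [Measure.bind_apply hA (model ψ δ n).aemeasurable,
      lintegral_eq_zero_iff ((model ψ δ n).measurable_coe hA)] at hA0
    -- A null set of the marginal law is `P_g^n`-null for almost every `g` under the prior. A single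
    -- such `g` suffices, since `P_f^n ≪ P_g^n`.
    obtain ⟨g, hg⟩ := hA0.exists
    exact model_absolutelyContinuous ψ hδ hn f g hg
  filter_upwards [hac.ae_le h] with x hx
  exact hx.symm

/-- The coordinates of the posterior mean. -/
def meanCoord (n : ℕ) (a x : Idx J₀ K → ℝ) : Idx J₀ K → ℝ :=
  fun i => ∫ t, t ∂(truncatedKernel (noiseVar n) (-a i) (a i) (x i))

lemma measurable_meanCoord {n : ℕ} (hn : 1 ≤ n) {a : Idx J₀ K → ℝ} (ha : ∀ i, 0 < a i) :
    Measurable (meanCoord n a) := by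
  refine measurable_pi_lambda _ fun i => ?_
  have := isMarkovKernel_truncatedKernel_noise hn ha i
  have h : StronglyMeasurable fun x : ℝ => ∫ t, t ∂(truncatedKernel (noiseVar n) (-a i) (a i) x) :=
    StronglyMeasurable.integral_kernel (f := fun t : ℝ => t) stronglyMeasurable_id
  exact h.measurable.comp (measurable_pi_apply i)

lemma ae_posteriorCoord_mem {n : ℕ} (hn : 1 ≤ n) {a : Idx J₀ K → ℝ} (ha : ∀ i, 0 < a i)
    (x : Idx J₀ K → ℝ) : ∀ᵐ c ∂(posteriorCoord n a x), ∀ i, c i ∈ Set.Icc (-a i) (a i) := by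
  have := isMarkovKernel_truncatedKernel_noise hn ha
  exact ae_infinitePi_mem fun i => ae_cond_mem measurableSet_Icc

/-- The posterior lives on a bounded set of `L²`, so the Bochner mean exists and commutes with
taking coefficients. -/
lemma coeff_integral_productPosterior (hγ : 0 < γ) (hM : 0 < M) {n : ℕ} (hn : 1 ≤ n)
    (x : H J₀ K δ) :
    coeff ψ (∫ f, f ∂(productPosterior ψ γ hM δ hn x)) = meanCoord n (halfWidth J₀ K γ M) x.1 := by
  have h1 := isMarkovKernel_productPosterior (δ := δ) ψ hγ hM hn
  have h2 := isMarkovKernel_truncatedKernel_noise hn (halfWidth_pos (J₀ := J₀) (K := K) γ hM)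
  have h3 : Fact ((2 : ℝ≥0∞) ≠ ∞) := ⟨by simp⟩
  have h4 : SecondCountableTopology L2 := Lp.SecondCountableTopology
  have hm := measurable_synthClip_halfWidth ψ hγ hM
  have ha : ∀ i : Idx J₀ K, 0 ≤ halfWidth J₀ K γ M i := fun i => (halfWidth_pos γ hM i).le
  have has := summable_halfWidth_sq (J₀ := J₀) (K := K) hγ M
  have hint : Integrable (fun c => synthClip ψ (halfWidth J₀ K γ M) c)
      (posteriorCoord n (halfWidth J₀ K γ M) x.1) := by
    refine Integrable.of_bound hm.aestronglyMeasurable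
      (√(∑' i, halfWidth J₀ K γ M i ^ 2)) (ae_of_all _ fun c => ?_)
    exact Real.le_sqrt_of_sq_le (norm_synthClip_sq_le ψ ha has c)
  rw [productPosterior_apply ψ hγ hM hn, integral_map hm.aemeasurable (by fun_prop)]
  ext i
  rw [coeff, ← integral_inner hint, meanCoord,
    ← (measurePreserving_eval_infinitePi (fun i => truncatedKernel (noiseVar n)
      (-halfWidth J₀ K γ M i) (halfWidth J₀ K γ M i) (x.1 i)) i).map_eq,
    integral_map (measurable_pi_apply i).aemeasurable (by fun_prop)]
  refine integral_congr_ae ?_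
  filter_upwards [ae_posteriorCoord_mem hn (halfWidth_pos γ hM) x.1] with c hc
  have := congrFun (coeff_synthClip ψ ha has c) i
  rw [clip_eq_self hc] at this
  exact this

lemma measurableSet_hBall (g : L2) (r : ℝ) : MeasurableSet (hBall ψ δ g r) := by
  have : hBall ψ δ g r = {f | 0 ≤ r ∧ energy (idxWeight J₀ K δ) (coeff ψ f - coeff ψ g) ≤
      ENNReal.ofReal (r ^ 2)} := by
    ext f; exact mem_hBall_iff ψ δ f g r
  rw [this]
  refine (MeasurableSet.const _).inter (measurableSet_le ((measurable_energy _).comp ?_)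
    measurable_const)
  exact (measurable_subtype_coe.comp (measurable_toH ψ δ)).sub_const _

lemma productPosterior_hBall (hγ : 0 < γ) (hM : 0 < M) {n : ℕ} (hn : 1 ≤ n) (x : H J₀ K δ) (r : ℝ) :
    productPosterior ψ γ hM δ hn x (hBall ψ δ (∫ f, f ∂(productPosterior ψ γ hM δ hn x)) r) =
      posteriorCoord n (halfWidth J₀ K γ M) x.1
        {c | 0 ≤ r ∧ energy (idxWeight J₀ K δ) (c - meanCoord n (halfWidth J₀ K γ M) x.1) ≤
          ENNReal.ofReal (r ^ 2)} := by
  have ha : ∀ i : Idx J₀ K, 0 ≤ halfWidth J₀ K γ M i := fun i => (halfWidth_pos γ hM i).le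
  have has := summable_halfWidth_sq (J₀ := J₀) (K := K) hγ M
  set g := ∫ f, f ∂(productPosterior ψ γ hM δ hn x) with hg
  rw [productPosterior_apply ψ hγ hM hn, Measure.map_apply (measurable_synthClip_halfWidth ψ hγ hM)
    (measurableSet_hBall ψ g r)]
  refine measure_congr ?_
  filter_upwards [ae_posteriorCoord_mem hn (halfWidth_pos γ hM) x.1] with c hc
  refine propext ?_
  change synthClip ψ _ c ∈ hBall ψ δ g r ↔ _
  rw [mem_hBall_iff, coeff_synthClip ψ ha has, clip_eq_self hc, hg,
    coeff_integral_productPosterior ψ hγ hM hn]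
  rfl

end Posterior

/-! ### Magnification of the posterior by `√n` around the data -/

section Rescaling

/-- Lower truncation limit of the rescaled posterior at signal `f` and noise `w`. -/
abbrev lowerLimit (n : ℕ) (a f w : Idx J₀ K → ℝ) (i : Idx J₀ K) : ℝ := √(n : ℝ) * (-a i - f i) - w i

/-- Upper truncation limit of the rescaled posterior at signal `f` and noise `w`. -/
abbrev upperLimit (n : ℕ) (a f w : Idx J₀ K → ℝ) (i : Idx J₀ K) : ℝ := √(n : ℝ) * (a i - f i) - w i

/-- The law of the rescaled posterior. -/
abbrev rescaledPosterior (n : ℕ) (a f w : Idx J₀ K → ℝ) : Measure (Idx J₀ K → ℝ) :=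
  Measure.infinitePi fun i => truncatedNormal (lowerLimit n a f w i) (upperLimit n a f w i)

/-- The mean of the rescaled posterior. -/
abbrev rescaledMean (n : ℕ) (a f w : Idx J₀ K → ℝ) : Idx J₀ K → ℝ :=
  fun i => ∫ t, t ∂(truncatedNormal (lowerLimit n a f w i) (upperLimit n a f w i))

variable {n : ℕ} {a f : Idx J₀ K → ℝ}

lemma sqrt_natCast_pos (hn : 1 ≤ n) : 0 < √(n : ℝ) := Real.sqrt_pos.2 (by exact_mod_cast hn)

lemma lowerLimit_lt_upperLimit (hn : 1 ≤ n) (ha : ∀ i, 0 < a i) (w : Idx J₀ K → ℝ) (i : Idx J₀ K) :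
    lowerLimit n a f w i < upperLimit n a f w i := by
  have := mul_lt_mul_of_pos_left (show -a i - f i < a i - f i by linarith [ha i]) (sqrt_natCast_pos hn)
  exact sub_lt_sub_right this _

/-- In the rescaled picture the true coefficient `f i` sits at `-w i`. It satisfies the prior
constraint, so this point belongs to every truncation interval. -/
lemma lowerLimit_le (hf : ∀ i, |f i| < a i) (w : Idx J₀ K → ℝ) (i : Idx J₀ K) :
    lowerLimit n a f w i ≤ -w i := by
  have h := (abs_lt.1 (hf i)).1
  have := mul_nonpos_of_nonneg_of_nonpos (Real.sqrt_nonneg n) (show -a i - f i ≤ 0 by linarith)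
  unfold lowerLimit
  linarith

lemma le_upperLimit (hf : ∀ i, |f i| < a i) (w : Idx J₀ K → ℝ) (i : Idx J₀ K) :
    -w i ≤ upperLimit n a f w i := by
  have h := (abs_lt.1 (hf i)).2
  have := mul_nonneg (Real.sqrt_nonneg n) (show 0 ≤ a i - f i by linarith)
  unfold upperLimit
  linarith

lemma tendsto_sqrt_natCast : Tendsto (fun n : ℕ => √(n : ℝ)) atTop atTop :=
  Real.tendsto_sqrt_atTop.comp tendsto_natCast_atTop_atTop

/-- Strictness of `|f i| < a i` is essential: with `f i = -a i` the limit would stay at `-w i`, and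
the truncation would persist asymptotically. -/
lemma tendsto_lowerLimit (hf : ∀ i, |f i| < a i) (w : Idx J₀ K → ℝ) (i : Idx J₀ K) :
    Tendsto (fun n => lowerLimit n a f w i) atTop atBot := by
  have h := (abs_lt.1 (hf i)).1
  exact tendsto_atBot_add_const_right _ _
    (tendsto_sqrt_natCast.atTop_mul_const_of_neg (show -a i - f i < 0 by linarith))

lemma tendsto_upperLimit (hf : ∀ i, |f i| < a i) (w : Idx J₀ K → ℝ) (i : Idx J₀ K) :
    Tendsto (fun n => upperLimit n a f w i) atTop atTop := by
  have h := (abs_lt.1 (hf i)).2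
  exact tendsto_atTop_add_const_right _ _
    (tendsto_sqrt_natCast.atTop_mul_const (show 0 < a i - f i by linarith))

lemma cond_map {α β : Type*} [MeasurableSpace α] [MeasurableSpace β] (μ : Measure α) {e : α → β}
    (he : Measurable e) {B : Set β} (hB : MeasurableSet B) :
    ProbabilityTheory.cond (μ.map e) B = (ProbabilityTheory.cond μ (e ⁻¹' B)).map e := by
  ext A hA
  rw [cond_apply hB, Measure.map_apply he hA, cond_apply (he hB), Measure.map_apply he hB,
    Measure.map_apply he (hB.inter hA), Set.preimage_inter]

/-- The Gaussian `N(x, 1/n)` is the image of `N(0, 1)` under `t ↦ x + t/√n`, and conditioning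
commutes with images. -/
lemma truncatedKernel_observeCoord (hn : 1 ≤ n) (w : Idx J₀ K → ℝ) (i : Idx J₀ K) :
    truncatedKernel (noiseVar n) (-a i) (a i) (observeCoord n f w i) =
      (truncatedNormal (lowerLimit n a f w i) (upperLimit n a f w i)).map
        fun t => observeCoord n f w i + (√(n : ℝ))⁻¹ * t := by
  have hs := sqrt_natCast_pos hn
  rw [truncatedKernel_apply, ← gaussianReal_map_affine, cond_map _ (by fun_prop) measurableSet_Icc]
  congr 2
  ext t
  have h1 : observeCoord n f w i + (√(n : ℝ))⁻¹ * t = f i + (w i + t) / √(n : ℝ) := by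
    rw [observeCoord]
    field_simp
    ring
  simp only [Set.mem_preimage, Set.mem_Icc, h1]
  rw [← sub_le_iff_le_add', ← le_sub_iff_add_le', le_div_iff₀ hs, div_le_iff₀ hs]
  constructor
  · rintro ⟨h2, h3⟩
    exact ⟨by unfold lowerLimit; linarith, by unfold upperLimit; linarith⟩
  · rintro ⟨h2, h3⟩
    unfold lowerLimit at h2
    unfold upperLimit at h3
    exact ⟨by linarith, by linarith⟩

lemma posteriorCoord_observeCoord (hn : 1 ≤ n) (ha : ∀ i, 0 < a i) (w : Idx J₀ K → ℝ) :
    posteriorCoord n a (observeCoord n f w) =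
      (rescaledPosterior n a f w).map (observeCoord n (observeCoord n f w)) := by
  have hprob : ∀ i, IsProbabilityMeasure
      (truncatedNormal (lowerLimit n a f w i) (upperLimit n a f w i)) := fun i =>
    isProbabilityMeasure_truncatedNormal (lowerLimit_lt_upperLimit hn ha w i)
  refine Eq.trans ?_ (Measure.infinitePi_map_pi
    (fun i => truncatedNormal (lowerLimit n a f w i) (upperLimit n a f w i))
    (f := fun i t => observeCoord n f w i + (√(n : ℝ))⁻¹ * t) (fun i => by fun_prop)).symm
  simp_rw [← truncatedKernel_observeCoord hn]

lemma meanCoord_observeCoord (hn : 1 ≤ n) (ha : ∀ i, 0 < a i) (w : Idx J₀ K → ℝ) :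
    meanCoord n a (observeCoord n f w) =
      observeCoord n (observeCoord n f w) (rescaledMean n a f w) := by
  ext i
  have hpq := lowerLimit_lt_upperLimit (f := f) hn ha w i
  have := isProbabilityMeasure_truncatedNormal hpq
  rw [meanCoord, truncatedKernel_observeCoord hn, integral_map (by fun_prop) (by fun_prop),
    integral_add (integrable_const _) ((integrable_id_truncatedNormal hpq).const_mul _),
    integral_const_mul, integral_const, probReal_univ, one_smul]
  rfl

lemma energy_observeCoord_sub (W c v m : Idx J₀ K → ℝ) :
    energy W (observeCoord n c v - observeCoord n c m) =
      ENNReal.ofReal ((√(n : ℝ))⁻¹ ^ 2) * energy W (v - m) := by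
  rw [← energy_smul]
  congr 1
  ext i
  simp [observeCoord]
  ring

lemma energy_signal_sub (W w m : Idx J₀ K → ℝ) :
    energy W (f - observeCoord n (observeCoord n f w) m) =
      ENNReal.ofReal ((√(n : ℝ))⁻¹ ^ 2) * energy W (w + m) := by
  rw [← energy_neg, ← energy_smul]
  congr 1
  ext i
  simp [observeCoord]
  ring

/-- The posterior mass of the smallest ball around the posterior mean containing the signal. -/
def signalDepth (W : Idx J₀ K → ℝ) (n : ℕ) (a f x : Idx J₀ K → ℝ) : ℝ≥0∞ :=
  posteriorCoord n a x {c | energy W (c - meanCoord n a x) ≤ energy W (f - meanCoord n a x)}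

lemma measurable_signalDepth (W : Idx J₀ K → ℝ) (hn : 1 ≤ n) (ha : ∀ i, 0 < a i) :
    Measurable (signalDepth W n a f) := by
  have hmean := measurable_meanCoord hn ha
  have hset : MeasurableSet {z : (Idx J₀ K → ℝ) × (Idx J₀ K → ℝ) |
      energy W (z.2 - meanCoord n a z.1) ≤ energy W (f - meanCoord n a z.1)} := by
    refine measurableSet_le ((measurable_energy W).comp ?_) ((measurable_energy W).comp ?_)
    · exact measurable_snd.sub (hmean.comp measurable_fst)
    · exact (hmean.comp measurable_fst).const_sub f
  exact Kernel.measurable_kernel_prodMk_left (κ := posteriorCoordKernel hn ha) hset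

lemma signalDepth_observeCoord (W : Idx J₀ K → ℝ) (hn : 1 ≤ n) (ha : ∀ i, 0 < a i)
    (w : Idx J₀ K → ℝ) :
    signalDepth W n a f (observeCoord n f w) = rescaledPosterior n a f w
      {v | energy W (v - rescaledMean n a f w) ≤ energy W (w + rescaledMean n a f w)} := by
  have hs := sqrt_natCast_pos hn
  have hm : Measurable (observeCoord n (observeCoord n f w)) := measurable_observeCoord n _
  rw [signalDepth, posteriorCoord_observeCoord hn ha, meanCoord_observeCoord hn ha,
    Measure.map_apply hm (measurableSet_le
      (show Measurable fun c : Idx J₀ K → ℝ => energy W (c - _) from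
        (measurable_energy W).comp (measurable_id.sub_const _)) measurable_const)]
  congr 1
  ext v
  change energy W (observeCoord n _ v - _) ≤ _ ↔ energy W _ ≤ _
  rw [energy_observeCoord_sub, energy_signal_sub]
  have h0 : ENNReal.ofReal ((√(n : ℝ))⁻¹ ^ 2) ≠ 0 := by
    rw [Ne, ENNReal.ofReal_eq_zero, not_le]; positivity
  exact ENNReal.mul_le_mul_iff_right h0 ENNReal.ofReal_ne_top

lemma tendsto_signalDepth {W : Idx J₀ K → ℝ} (hW : ∀ i, 0 ≤ W i) {i₀ : Idx J₀ K} (hi₀ : 0 < W i₀)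
    (hWs : Summable W) (hf : ∀ i, |f i| < a i) {w : Idx J₀ K → ℝ} (hw : energy W w < ∞) :
    Tendsto (fun n => signalDepth W n a f (observeCoord n f w)) atTop
      (𝓝 (stdGaussian (Idx J₀ K) {v | energy W v ≤ energy W w})) := by
  have ha : ∀ i, 0 < a i := fun i => (abs_nonneg _).trans_lt (hf i)
  -- The index is shifted because for `n = 0` the truncation interval degenerates to a point.
  rw [← tendsto_add_atTop_iff_nat 1]
  simp_rw [fun n : ℕ => signalDepth_observeCoord (f := f) W (Nat.le_add_left 1 n) ha w]
  exact tendsto_infinitePi_truncatedNormal_energy_le hW hi₀ hWs hw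
    (p := fun n => lowerLimit (n + 1) a f w) (q := fun n => upperLimit (n + 1) a f w)
    (fun n => lowerLimit_lt_upperLimit (Nat.le_add_left 1 n) ha w) (fun n => lowerLimit_le hf w)
    (fun n => le_upperLimit hf w)
    (fun i => (tendsto_add_atTop_iff_nat 1).2 (tendsto_lowerLimit hf w i))
    (fun i => (tendsto_add_atTop_iff_nat 1).2 (tendsto_upperLimit hf w i))

end Rescaling

/-! ### The probability integral transform and its limit version -/

section ProbabilityIntegralTransform

variable {Ω : Type*} [MeasurableSpace Ω] {μ : Measure Ω}

/-- The levels `s` with `G s ≤ b` form the set `D`. Either its supremum belongs to it, and then `{X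
∈ D}` lies in a sublevel set of mass at most `b`, or `{X ∈ D}` is covered by an increasing union of
such sets. Continuity of `G` plays no role, and the general order allows an application to the
reversed order. -/
lemma measure_measure_le_le {α : Type*} [CompleteLinearOrder α] [TopologicalSpace α] [OrderTopology α]
    [FirstCountableTopology α] (X : Ω → α) (b : ℝ≥0∞) :
    μ {ω | μ {ω' | X ω' ≤ X ω} ≤ b} ≤ b := by
  set D : Set α := {s | μ {ω' | X ω' ≤ s} ≤ b} with hD
  change μ {ω | X ω ∈ D} ≤ b
  by_cases hmem : sSup D ∈ D
  · exact (measure_mono fun ω (hω : X ω ∈ D) => show X ω ≤ sSup D from le_sSup hω).trans hmem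
  by_cases hne : D.Nonempty
  · obtain ⟨u, hu, hlim, huD⟩ := exists_seq_tendsto_sSup hne (OrderTop.bddAbove D)
    have hsub : {ω | X ω ∈ D} ⊆ ⋃ k, {ω | X ω ≤ u k} := by
      intro ω hω
      have hlt : X ω < sSup D := lt_of_le_of_ne (le_sSup hω) fun h => hmem (h ▸ hω)
      obtain ⟨k, hk⟩ := ((tendsto_order.1 hlim).1 _ hlt).exists
      exact Set.mem_iUnion.2 ⟨k, show X ω ≤ u k from hk.le⟩
    refine (measure_mono hsub).trans ?_
    have hmono : Monotone fun k => {ω | X ω ≤ u k} := fun k l hkl ω hω =>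
      (show X ω ≤ u k from hω).trans (hu hkl)
    rw [hmono.measure_iUnion]
    exact iSup_le fun k => huD k
  · rw [Set.not_nonempty_iff_eq_empty] at hne
    simp [hne]

/-- The previous lemma for the reversed order bounds the probability that `P(X' ≥ X) ≤ 1 - b`.
Without atoms at finite values, `P(X' ≥ X)` is `1 - G(X)`, and one passes to complements. -/
lemma le_measure_measure_le_lt [IsProbabilityMeasure μ] {X : Ω → ℝ≥0∞} (hX : Measurable X)
    (hfin : ∀ᵐ ω ∂μ, X ω < ∞) (hatom : ∀ t ≠ ∞, μ {ω | X ω = t} = 0) {b : ℝ≥0∞} (hb : b ≤ 1) :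
    b ≤ μ {ω | μ {ω' | X ω' ≤ X ω} < b} := by
  have hG : Measurable fun s => μ {ω' | X ω' ≤ s} :=
    Monotone.measurable fun s t hst => measure_mono fun ω hω =>
      (show X ω ≤ s from hω).trans hst
  have hmeas : MeasurableSet {ω | μ {ω' | X ω' ≤ X ω} < b} :=
    measurableSet_lt (hG.comp hX) measurable_const
  have h := measure_measure_le_le (μ := μ) (fun ω => OrderDual.toDual (X ω)) (1 - b)
  have hsub : μ {ω | μ {ω' | X ω' ≤ X ω} < b}ᶜ ≤ 1 - b := by
    refine le_trans (measure_mono_ae ?_) h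
    filter_upwards [hfin] with ω hω hωb
    replace hωb : ¬ (μ {ω' | X ω' ≤ X ω} < b) := hωb
    change μ {ω' | X ω ≤ X ω'} ≤ 1 - b
    have e1 : μ {ω' | X ω < X ω'} = 1 - μ {ω' | X ω' ≤ X ω} := by
      rw [← prob_compl_eq_one_sub (measurableSet_le hX measurable_const)]
      congr 1
      ext ω'
      exact (not_le (a := X ω') (b := X ω)).symm
    calc μ {ω' | X ω ≤ X ω'} ≤ μ ({ω' | X ω < X ω'} ∪ {ω' | X ω' = X ω}) :=
          measure_mono fun ω' hω' => (lt_or_eq_of_le (show X ω ≤ X ω' from hω')).imp id Eq.symm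
      _ ≤ μ {ω' | X ω < X ω'} + μ {ω' | X ω' = X ω} := measure_union_le _ _
      _ = 1 - μ {ω' | X ω' ≤ X ω} := by rw [hatom _ hω.ne, add_zero, e1]
      _ ≤ 1 - b := tsub_le_tsub_left (not_lt.1 hωb) 1
  rw [prob_compl_eq_one_sub hmeas] at hsub
  exact (ENNReal.sub_le_sub_iff_left hb ENNReal.one_ne_top).1 hsub

/-- Fatou's lemma for sets: `F` is almost surely contained in the lower limit of the sets `E n`. -/
lemma eventually_lt_measure_of_ae_eventually_mem {E : ℕ → Set Ω} {F : Set Ω}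
    (h : ∀ᵐ ω ∂μ, ω ∈ F → ∀ᶠ n in atTop, ω ∈ E n) {c : ℝ≥0∞} (hc : c < μ F) :
    ∀ᶠ n in atTop, c < μ (E n) := by
  have hmono : Monotone fun n => ⋂ m ≥ n, E m := fun k l hkl =>
    Set.biInter_subset_biInter_left fun m hm => le_trans hkl hm
  have hle : μ F ≤ μ (⋃ n, ⋂ m ≥ n, E m) := by
    refine measure_mono_ae ?_
    filter_upwards [h] with ω hω hF
    obtain ⟨n, hn⟩ := eventually_atTop.1 (hω hF)
    exact Set.mem_iUnion.2 ⟨n, Set.mem_iInter₂.2 hn⟩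
  filter_upwards [(tendsto_order.1 (tendsto_measure_iUnion_atTop hmono)).1 c (hc.trans_le hle)]
    with n hn
  exact lt_of_lt_of_le hn (measure_mono (Set.biInter_subset_of_mem (Set.mem_Ici.2 le_rfl)))

/-- If `U_n → G(X)` almost surely, where `G` is the continuous distribution function of `X`, then
sets squeezed between `{U_n < b}` and `{U_n ≤ b}` have probability tending to `b`. -/
lemma tendsto_measure_of_tendsto_cdf [IsProbabilityMeasure μ] {X : Ω → ℝ≥0∞} (hX : Measurable X)
    (hfin : ∀ᵐ ω ∂μ, X ω < ∞) (hatom : ∀ t ≠ ∞, μ {ω | X ω = t} = 0) {b : ℝ≥0∞} (hb : b ≤ 1)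
    {U : ℕ → Ω → ℝ≥0∞} (hU : ∀ᶠ n in atTop, Measurable (U n))
    (hlim : ∀ᵐ ω ∂μ, Tendsto (fun n => U n ω) atTop (𝓝 (μ {ω' | X ω' ≤ X ω})))
    {A : ℕ → ℝ≥0∞} (hA1 : ∀ᶠ n in atTop, μ {ω | U n ω < b} ≤ A n)
    (hA2 : ∀ᶠ n in atTop, A n ≤ μ {ω | U n ω ≤ b}) :
    Tendsto A atTop (𝓝 b) := by
  have hG : Measurable fun s => μ {ω' | X ω' ≤ s} :=
    Monotone.measurable fun s t hst => measure_mono fun ω hω =>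
      (show X ω ≤ s from hω).trans hst
  refine tendsto_order.2 ⟨fun c hc => ?_, fun c hc => ?_⟩
  · filter_upwards [hA1, eventually_lt_measure_of_ae_eventually_mem (μ := μ)
      (E := fun n => {ω | U n ω < b}) (F := {ω | μ {ω' | X ω' ≤ X ω} < b})
      (by
        filter_upwards [hlim] with ω hω hωb
        exact (tendsto_order.1 hω).2 b hωb)
      (hc.trans_le (le_measure_measure_le_lt hX hfin hatom hb))] with n h1 h2
    exact h2.trans_le h1
  · by_cases hc1 : 1 < c
    · filter_upwards [hA2] with n hn
      exact hn.trans_lt (prob_le_one.trans_lt hc1)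
    rw [not_lt] at hc1
    have hm : MeasurableSet {ω | μ {ω' | X ω' ≤ X ω} ≤ b} :=
      measurableSet_le (hG.comp hX) measurable_const
    -- The upper bound comes from the complement: almost surely, `b < G(X)` implies `b < U n`
    -- eventually.
    have h0 : 1 - c < μ {ω | b < μ {ω' | X ω' ≤ X ω}} := by
      have e : {ω | b < μ {ω' | X ω' ≤ X ω}} = {ω | μ {ω' | X ω' ≤ X ω} ≤ b}ᶜ := by
        ext ω; exact (not_le (a := μ {ω' | X ω' ≤ X ω}) (b := b)).symm
      rw [e, prob_compl_eq_one_sub hm]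
      calc 1 - c < 1 - b := not_le.1 fun h =>
            hc.not_ge ((ENNReal.sub_le_sub_iff_left hc1 ENNReal.one_ne_top).1 h)
        _ ≤ _ := tsub_le_tsub_left (measure_measure_le_le X b) 1
    filter_upwards [hU, hA2, eventually_lt_measure_of_ae_eventually_mem (μ := μ)
      (E := fun n => {ω | b < U n ω}) (F := {ω | b < μ {ω' | X ω' ≤ X ω}})
      (by
        filter_upwards [hlim] with ω hω hωb
        exact (tendsto_order.1 hω).1 b hωb) h0] with n hUn h1 h2
    have e : {ω | b < U n ω} = {ω | U n ω ≤ b}ᶜ := by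
      ext ω; exact (not_le (a := U n ω) (b := b)).symm
    rw [e, prob_compl_eq_one_sub (measurableSet_le hUn measurable_const)] at h2
    refine h1.trans_lt ?_
    by_contra hcon
    exact absurd (tsub_le_tsub_left (not_lt.1 hcon) 1) (not_le.2 h2)

end ProbabilityIntegralTransform

/-! ### Hölder balls as coordinate boxes -/

section HolderBall

variable (ψ : HilbertBasis (Idx J₀ K) ℝ L2) {γ M : ℝ}

lemma two_rpow_mul_halfWidth (γ M : ℝ) (i : Idx J₀ K) :
    (2 : ℝ) ^ ((i.1 : ℝ) * (γ + 1 / 2)) * halfWidth J₀ K γ M i = M := by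
  rw [halfWidth, ← mul_assoc, ← Real.rpow_add two_pos, neg_mul, add_neg_cancel, Real.rpow_zero,
    one_mul]

lemma abs_coeff_lt_halfWidth (hM : 0 < M) {f : L2} (hf : holderNorm ψ γ f < ENNReal.ofReal M)
    (i : Idx J₀ K) : |coeff ψ f i| < halfWidth J₀ K γ M i := by
  have h := (le_iSup (fun i : Idx J₀ K =>
    ENNReal.ofReal ((2 : ℝ) ^ ((i.1 : ℝ) * (γ + 1 / 2)) * |coeff ψ f i|)) i).trans_lt hf
  rw [ENNReal.ofReal_lt_ofReal_iff hM, ← two_rpow_mul_halfWidth γ M i] at h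
  exact lt_of_mul_lt_mul_left h (by positivity)

lemma abs_coeff_le_halfWidth (hM : 0 < M) {f : L2} (hf : holderNorm ψ γ f ≤ ENNReal.ofReal M)
    (i : Idx J₀ K) : |coeff ψ f i| ≤ halfWidth J₀ K γ M i := by
  have h := (le_iSup (fun i : Idx J₀ K =>
    ENNReal.ofReal ((2 : ℝ) ^ ((i.1 : ℝ) * (γ + 1 / 2)) * |coeff ψ f i|)) i).trans hf
  rw [ENNReal.ofReal_le_ofReal_iff hM.le, ← two_rpow_mul_halfWidth γ M i] at h
  exact le_of_mul_le_mul_left h (by positivity)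

end HolderBall

/-! ### The radius of the credible ball -/

section Radius

lemma energy_sub_le {ι : Type*} {W : ι → ℝ} (hW : ∀ i, 0 ≤ W i) (c d : ι → ℝ) :
    energy W (c - d) ≤ 2 * energy W c + 2 * energy W d := by
  rw [energy, energy, energy, ← ENNReal.tsum_mul_left, ← ENNReal.tsum_mul_left, ← ENNReal.tsum_add]
  refine ENNReal.tsum_le_tsum fun i => ?_
  have h := hW i
  rw [← ENNReal.ofReal_ofNat 2, ← ENNReal.ofReal_mul (by norm_num),
    ← ENNReal.ofReal_mul (by norm_num), ← ENNReal.ofReal_add (by positivity) (by positivity)]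
  refine ENNReal.ofReal_le_ofReal ?_
  have := mul_nonneg h (sq_nonneg (c i + d i))
  simp only [Pi.sub_apply]
  nlinarith

variable {n : ℕ} {a f : Idx J₀ K → ℝ}

/-- The noise reconstructed from the observation and the signal. -/
def noiseCoord (n : ℕ) (f x : Idx J₀ K → ℝ) : Idx J₀ K → ℝ := fun i => √(n : ℝ) * (x i - f i)

lemma observeCoord_noiseCoord (hn : 1 ≤ n) (x : Idx J₀ K → ℝ) :
    observeCoord n f (noiseCoord n f x) = x := by
  have := sqrt_natCast_pos hn
  ext i
  rw [observeCoord, noiseCoord, inv_mul_cancel_left₀ this.ne']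
  ring

lemma noiseCoord_observeCoord (hn : 1 ≤ n) (w : Idx J₀ K → ℝ) :
    noiseCoord n f (observeCoord n f w) = w := by
  have := sqrt_natCast_pos hn
  ext i
  rw [noiseCoord, observeCoord, add_sub_cancel_left, mul_inv_cancel_left₀ this.ne']

lemma measurable_noiseCoord (n : ℕ) (f : Idx J₀ K → ℝ) : Measurable (noiseCoord n f) := by
  unfold noiseCoord; fun_prop

lemma energy_rescaledMean_le {W : Idx J₀ K → ℝ} (hW : ∀ i, 0 ≤ W i) (hn : 1 ≤ n)
    (hf : ∀ i, |f i| < a i) (w : Idx J₀ K → ℝ) :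
    energy W (rescaledMean n a f w) ≤ ∑' i, ENNReal.ofReal (W i * (2 + w i ^ 2)) := by
  refine ENNReal.tsum_le_tsum fun i => ENNReal.ofReal_le_ofReal (mul_le_mul_of_nonneg_left ?_ (hW i))
  simpa using sq_integral_truncatedNormal_le
    (lowerLimit_lt_upperLimit hn (fun i => (abs_nonneg _).trans_lt (hf i)) w i)
    (lowerLimit_le hf w i) (le_upperLimit hf w i)

/-- The posterior spread around the posterior mean is of order `n⁻¹`. -/
lemma lintegral_energy_posteriorCoord_le {W : Idx J₀ K → ℝ} (hW : ∀ i, 0 ≤ W i) (hn : 1 ≤ n)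
    (hf : ∀ i, |f i| < a i) (w : Idx J₀ K → ℝ) :
    ∫⁻ c, energy W (c - meanCoord n a (observeCoord n f w))
        ∂(posteriorCoord n a (observeCoord n f w)) ≤
      ENNReal.ofReal ((√(n : ℝ))⁻¹ ^ 2) * (4 * ∑' i, ENNReal.ofReal (W i * (2 + w i ^ 2))) := by
  have ha : ∀ i, 0 < a i := fun i => (abs_nonneg _).trans_lt (hf i)
  have hprob : ∀ i, IsProbabilityMeasure
      (truncatedNormal (lowerLimit n a f w i) (upperLimit n a f w i)) := fun i =>
    isProbabilityMeasure_truncatedNormal (lowerLimit_lt_upperLimit hn ha w i)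
  rw [posteriorCoord_observeCoord hn ha, meanCoord_observeCoord hn ha, lintegral_map
    (show Measurable fun c : Idx J₀ K → ℝ => energy W (c - _) from
      (measurable_energy W).comp (measurable_id.sub_const _)) (measurable_observeCoord n _)]
  simp only [energy_observeCoord_sub]
  set S := ∑' i, ENNReal.ofReal (W i * (2 + w i ^ 2))
  rw [lintegral_const_mul' _ _ ENNReal.ofReal_ne_top]
  gcongr
  calc ∫⁻ v, energy W (v - rescaledMean n a f w) ∂(rescaledPosterior n a f w)
      ≤ ∫⁻ v, (2 * energy W v + 2 * S) ∂(rescaledPosterior n a f w) := by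
        refine lintegral_mono fun v => (energy_sub_le hW _ _).trans ?_
        gcongr
        exact energy_rescaledMean_le hW hn hf w
    _ = 2 * ∫⁻ v, energy W v ∂(rescaledPosterior n a f w) + 2 * S := by
        rw [lintegral_add_right _ measurable_const, lintegral_const_mul _ (measurable_energy W),
          lintegral_const, measure_univ, mul_one]
    _ ≤ 2 * S + 2 * S := by
        gcongr
        exact lintegral_energy_truncatedNormal_le hW (lowerLimit_lt_upperLimit hn ha w)
          (lowerLimit_le hf w) (le_upperLimit hf w)
    _ = 4 * S := by ring

/-- Markov's inequality read backwards: a ball of mass exactly `b` leaves mass `1 - b` beyond its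
radius, so the radius is controlled by the mean. -/
lemma mul_radius_le {α : Type*} [MeasurableSpace α] {μ : Measure α} [IsProbabilityMeasure μ]
    {X : α → ℝ≥0∞} (hX : Measurable X) {t b : ℝ≥0∞} (h : μ {c | X c ≤ t} = b) :
    (1 - b) * t ≤ ∫⁻ c, X c ∂μ := by
  have h1 : μ {c | t < X c} = 1 - b := by
    rw [← h, ← prob_compl_eq_one_sub (measurableSet_le hX measurable_const)]
    congr 1
    ext c
    exact (not_le (a := X c) (b := t)).symm
  calc (1 - b) * t = t * μ {c | t < X c} := by rw [h1, mul_comm]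
    _ ≤ t * μ {c | t ≤ X c} := by
        gcongr with c
        exact fun h => le_of_lt h
    _ ≤ _ := mul_meas_ge_le_lintegral hX t

end Radius

/-! ### Interpolation between `H(δ)` and the Hölder ball -/

section Diameter

lemma weight_antitone {δ : ℝ} (hδ : 0 ≤ δ) : Antitone (weight δ) := by
  intro l m hlm
  have h2 := charSeq_ge l
  have hmono : charSeq l ≤ charSeq m :=
    max_le_max le_rfl (pow_le_pow_right₀ (by norm_num) hlm)
  have h3 : 0 < Real.log (charSeq l) := Real.log_pos (by linarith)
  refine mul_le_mul (inv_anti₀ (by linarith) hmono) ?_ (by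
    have : 0 ≤ Real.log (charSeq m) := Real.log_nonneg (by linarith)
    positivity) (inv_nonneg.2 (by linarith))
  exact Real.rpow_le_rpow_of_nonpos h3 (Real.log_le_log (by linarith) hmono) (by linarith)

/-- A geometric tail. As `J₀ ≤ L`, every level above `L` consists of exactly `2^l` wavelets. -/
lemma tsum_highLevel_le {γ : ℝ} (hγ : 0 < γ) (M : ℝ) {L : ℕ} (hL : J₀ ≤ L) :
    ∑' i : Idx J₀ K, ENNReal.ofReal (if L < i.1 then 4 * halfWidth J₀ K γ M i ^ 2 else 0) ≤
      ENNReal.ofReal (4 * M ^ 2 * (1 - (2 : ℝ) ^ (-2 * γ))⁻¹ * ((2 : ℝ) ^ (-2 * γ)) ^ L) := by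
  set r : ℝ := (2 : ℝ) ^ (-2 * γ) with hr
  have hr0 : 0 ≤ r := by positivity
  have hr1 : r < 1 := two_rpow_neg_lt_one hγ
  set g : ℕ → ℝ≥0∞ := fun l => if L < l then ENNReal.ofReal (4 * M ^ 2 * r ^ l) else 0
  have h1 : ∑' i : Idx J₀ K, ENNReal.ofReal (if L < i.1 then 4 * halfWidth J₀ K γ M i ^ 2 else 0) ≤
      ∑' l, g l := by
    rw [ENNReal.tsum_sigma']
    refine ENNReal.tsum_le_tsum fun l => ?_
    simp only [g]
    split_ifs with h
    · rw [tsum_fintype]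
      simp only [halfWidth, Finset.sum_const, Finset.card_univ, Fintype.card_fin]
      rw [levelSize, if_pos (by omega : J₀ ≤ l), nsmul_eq_mul, ← ENNReal.ofReal_natCast,
        ← ENNReal.ofReal_mul (by positivity), hr, ← two_pow_mul_sq_rpow]
      refine ENNReal.ofReal_le_ofReal (le_of_eq ?_)
      push_cast
      ring
    · simp
  refine h1.trans ?_
  rw [← ENNReal.summable.sum_add_tsum_nat_add' (k := L), Finset.sum_eq_zero fun l hl => by
    simp [g, (Finset.mem_range.1 hl).le], zero_add]
  calc ∑' l, g (l + L) ≤ ∑' l, ENNReal.ofReal (4 * M ^ 2 * r ^ (l + L)) := by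
        refine ENNReal.tsum_le_tsum fun l => ?_
        simp only [g]
        split_ifs
        · exact le_rfl
        · exact zero_le
    _ = ENNReal.ofReal (∑' l, 4 * M ^ 2 * r ^ (l + L)) := by
        refine (ENNReal.ofReal_tsum_of_nonneg (fun l => by positivity) ?_).symm
        simp_rw [pow_add]
        exact ((summable_geometric_of_lt_one hr0 hr1).mul_right _).mul_left _
    _ = _ := by
        congr 1
        simp_rw [pow_add]
        rw [tsum_mul_left, tsum_mul_right, tsum_geometric_of_lt_one hr0 hr1]
        ring

variable (ψ : HilbertBasis (Idx J₀ K) ℝ L2)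

lemma ofReal_norm_sq (f : L2) : ENNReal.ofReal (‖f‖ ^ 2) = energy (fun _ => 1) (coeff ψ f) := by
  rw [energy_eq_ofReal (fun _ => zero_le_one) (by simpa using summable_coeff_sq ψ f),
    norm_sq_eq_tsum ψ]
  simp

/-- Interpolation: the `L²` norm is controlled by the `H(δ)` norm up to level `L` and by the
Hölder-type bound beyond. -/
lemma norm_sq_le_of_energy_le {γ M δ : ℝ} (hγ : 0 < γ) (hδ : 0 ≤ δ) {L : ℕ} (hL : J₀ ≤ L) {f : L2}
    {E : ℝ} (hE : 0 ≤ E) (hfE : energy (idxWeight J₀ K δ) (coeff ψ f) ≤ ENNReal.ofReal E)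
    (hf : ∀ i, |coeff ψ f i| ≤ 2 * halfWidth J₀ K γ M i) :
    ‖f‖ ^ 2 ≤ (weight δ L)⁻¹ * E +
      4 * M ^ 2 * (1 - (2 : ℝ) ^ (-2 * γ))⁻¹ * ((2 : ℝ) ^ (-2 * γ)) ^ L := by
  have hwL := weight_pos δ L
  have hr1 := sub_pos.2 (two_rpow_neg_lt_one hγ)
  rw [← ENNReal.ofReal_le_ofReal_iff (by positivity), ofReal_norm_sq ψ,
    ENNReal.ofReal_add (by positivity) (by positivity), ENNReal.ofReal_mul (by positivity)]
  refine le_trans ?_ (add_le_add (mul_le_mul_right hfE _) (tsum_highLevel_le (K := K) hγ M hL))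
  rw [energy, energy, ← ENNReal.tsum_mul_left, ← ENNReal.tsum_add]
  refine ENNReal.tsum_le_tsum fun i => ?_
  rw [← ENNReal.ofReal_mul (by positivity), one_mul]
  by_cases h : L < i.1
  · refine le_add_left (ENNReal.ofReal_le_ofReal ?_)
    rw [if_pos h, ← sq_abs]
    calc |coeff ψ f i| ^ 2 ≤ (2 * halfWidth J₀ K γ M i) ^ 2 :=
          pow_le_pow_left₀ (abs_nonneg _) (hf i) 2
      _ = _ := by ring
  · refine le_add_right (ENNReal.ofReal_le_ofReal ?_)
    rw [← mul_assoc]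
    refine le_mul_of_one_le_left (sq_nonneg _) ?_
    rw [inv_mul_eq_div, one_le_div hwL]
    exact weight_antitone hδ (not_lt.1 h)

/-- The resolution level balancing the two terms of the interpolation bound. -/
lemma exists_level_rate {γ δ : ℝ} (hγ : 0 < γ) (hδ : 0 < δ) (J : ℕ) :
    ∀ᶠ n : ℕ in atTop, ∃ L : ℕ, J ≤ L ∧
      (weight δ L)⁻¹ * (n : ℝ)⁻¹ ≤ 2 * (2 : ℝ) ^ (2 * δ) *
        ((n : ℝ) ^ (-γ / (2 * γ + 1)) * Real.log n ^ δ) ^ 2 ∧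
      ((2 : ℝ) ^ (-2 * γ)) ^ L ≤ ((n : ℝ) ^ (-γ / (2 * γ + 1)) * Real.log n ^ δ) ^ 2 := by
  have hlog : Tendsto (fun n : ℕ => Real.log n) atTop atTop :=
    Real.tendsto_log_atTop.comp tendsto_natCast_atTop_atTop
  have h2 : 0 < Real.log 2 := Real.log_pos (by norm_num)
  have hlog2 : Real.log 2 ≤ 1 := by
    have := Real.log_le_sub_one_of_pos (x := 2) two_pos
    linarith
  filter_upwards [hlog.eventually_ge_atTop 1,
    hlog.eventually_ge_atTop ((J + 1) * Real.log 2 * (2 * γ + 1)), eventually_ge_atTop 1]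
    with n hn1 hnJ hn
  have hn0 : (0 : ℝ) < n := by exact_mod_cast hn
  have hg : 0 < 2 * γ + 1 := by linarith
  set y := Real.log n / (2 * γ + 1) with hy
  have hyn : y * (2 * γ + 1) = Real.log n := div_mul_cancel₀ _ hg.ne'
  have hy0 : 0 ≤ y := div_nonneg (by linarith) hg.le
  -- Then `2^L` lies between `n^{1/(2γ+1)}` and twice that value; rounding up costs the factor `2`
  -- in the first bound and nothing in the second.
  set L := ⌈y / Real.log 2⌉₊
  have hL1 : y ≤ L * Real.log 2 := (div_le_iff₀ h2).1 (Nat.le_ceil _)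
  have hL2 : L * Real.log 2 ≤ y + Real.log 2 := by
    have := (Nat.ceil_lt_add_one (div_nonneg hy0 h2.le)).le
    calc (L : ℝ) * Real.log 2 ≤ (y / Real.log 2 + 1) * Real.log 2 :=
          mul_le_mul_of_nonneg_right this h2.le
      _ = y + Real.log 2 := by field_simp
  -- One more than `J`, so that `L ≥ 1` and the exceptional value of `charSeq` at level `0` is
  -- avoided.
  have hJL : J + 1 ≤ L := by
    have h3 : ((J + 1 : ℕ) : ℝ) ≤ y / Real.log 2 := by
      rw [le_div_iff₀ h2, hy, le_div_iff₀ hg]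
      push_cast
      exact hnJ
    exact_mod_cast h3.trans (Nat.le_ceil _)
  have hylog : y ≤ Real.log n := div_le_self (by linarith) (by linarith)
  have hpow : (2 : ℝ) ^ L = Real.exp (L * Real.log 2) := by
    rw [← Real.log_pow, Real.exp_log (by positivity)]
  have hrate : ((n : ℝ) ^ (-γ / (2 * γ + 1))) ^ 2 = Real.exp (-2 * γ * y) := by
    rw [Real.rpow_def_of_pos hn0, ← Real.exp_nat_mul]
    congr 1
    rw [hy]
    push_cast
    field_simp
  have hlogδ : (Real.log n ^ δ) ^ 2 = Real.log n ^ (2 * δ) := by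
    rw [← Real.rpow_natCast, ← Real.rpow_mul (by linarith)]
    congr 1
    push_cast
    ring
  have hlogone : 1 ≤ Real.log n ^ (2 * δ) := Real.one_le_rpow hn1 (by linarith)
  refine ⟨L, by omega, ?_, ?_⟩
  · have hL : 1 ≤ L := by omega
    have hLpos : 0 < (L : ℝ) * Real.log 2 := by
      have : (0 : ℝ) < L := by exact_mod_cast hL
      positivity
    rw [weight, log_charSeq hL, charSeq_eq hL, mul_inv, inv_inv, ← Real.rpow_neg hLpos.le, mul_pow,
      hrate, hlogδ, neg_mul, neg_neg, hpow]
    have e1 : Real.exp (L * Real.log 2) * (n : ℝ)⁻¹ ≤ 2 * Real.exp (-2 * γ * y) := by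
      calc Real.exp (L * Real.log 2) * (n : ℝ)⁻¹
          ≤ Real.exp (y + Real.log 2) * (n : ℝ)⁻¹ := by gcongr
        _ = 2 * Real.exp (-2 * γ * y) := by
            rw [Real.exp_add, Real.exp_log two_pos]
            have : (n : ℝ)⁻¹ = Real.exp (-(y * (2 * γ + 1))) := by
              rw [hyn, Real.exp_neg, Real.exp_log hn0]
            rw [this, mul_comm (Real.exp y), mul_assoc, ← Real.exp_add]
            congr 2
            ring
    -- Here `L log 2 ≤ y + log 2 ≤ 2 log n`, as `y ≤ log n` and `log 2 ≤ 1 ≤ log n`.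
    have e2 : ((L : ℝ) * Real.log 2) ^ (2 * δ) ≤ 2 ^ (2 * δ) * Real.log n ^ (2 * δ) := by
      rw [← Real.mul_rpow two_pos.le (by linarith)]
      exact Real.rpow_le_rpow hLpos.le (by linarith) (by linarith)
    calc Real.exp (L * Real.log 2) * ((L : ℝ) * Real.log 2) ^ (2 * δ) * (n : ℝ)⁻¹
        = (Real.exp (L * Real.log 2) * (n : ℝ)⁻¹) * ((L : ℝ) * Real.log 2) ^ (2 * δ) := by ring
      _ ≤ (2 * Real.exp (-2 * γ * y)) * (2 ^ (2 * δ) * Real.log n ^ (2 * δ)) := by gcongr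
      _ = _ := by ring
  · rw [mul_pow, hrate, hlogδ]
    calc ((2 : ℝ) ^ (-2 * γ)) ^ L = Real.exp (-2 * γ * (L * Real.log 2)) := by
          rw [Real.rpow_def_of_pos two_pos, ← Real.exp_nat_mul]
          congr 1
          ring
      _ ≤ Real.exp (-2 * γ * y) := by
          refine Real.exp_le_exp.2 ?_
          nlinarith
      _ ≤ _ := le_mul_of_one_le_right (Real.exp_pos _).le hlogone

end Diameter

/-! ### Coverage and diameter of the credible sets -/

section CredibleSet

variable (ψ : HilbertBasis (Idx J₀ K) ℝ L2) {γ M δ α : ℝ}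

lemma model_preimage_val (hδ : 1 / 2 < δ) (n : ℕ) (f : L2) {S : Set (Idx J₀ K → ℝ)}
    (hS : MeasurableSet S) :
    model ψ δ n f {x | x.1 ∈ S} = stdGaussian (Idx J₀ K) {w | observeCoord n (coeff ψ f) w ∈ S} := by
  have h := congrArg (fun μ : Measure (Idx J₀ K → ℝ) => μ S)
    (map_val_model_eq_observeCoord ψ hδ n f)
  change Measure.map _ _ S = Measure.map _ _ S at h
  rw [Measure.map_apply measurable_subtype_coe hS,
    Measure.map_apply (measurable_observeCoord n _) hS] at h
  exact h

/-- Almost surely, the credible ball is an energy ball around the mean of the product of truncated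
Gaussians, and this product gives it the prescribed mass. -/
lemma ae_credible_ball (hγ : 0 < γ) (hM : 0 < M) (hδ : 1 / 2 < δ) (hα₁ : α < 1) {n : ℕ} (hn : 1 ≤ n)
    (f₀ : L2) {R : H J₀ K δ → ℝ}
    (hR : ∀ᵐ x ∂(model ψ δ n f₀), uniformPosterior ψ γ M δ n x
      (hBall ψ δ (posteriorMean ψ γ M δ n x) (R x / √(n : ℝ))) = ENNReal.ofReal (1 - α)) :
    ∀ᵐ x ∂(model ψ δ n f₀),
      posteriorCoord n (halfWidth J₀ K γ M) x.1 {c | energy (idxWeight J₀ K δ)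
        (c - meanCoord n (halfWidth J₀ K γ M) x.1) ≤ ENNReal.ofReal ((R x / √(n : ℝ)) ^ 2)} =
          ENNReal.ofReal (1 - α) ∧
      ∀ f : L2, f ∈ hBall ψ δ (posteriorMean ψ γ M δ n x) (R x / √(n : ℝ)) ↔
        energy (idxWeight J₀ K δ) (coeff ψ f - meanCoord n (halfWidth J₀ K γ M) x.1) ≤
          ENNReal.ofReal ((R x / √(n : ℝ)) ^ 2) := by
  filter_upwards [hR, ae_uniformPosterior_eq ψ hγ hM hδ hn f₀] with x hx hpost
  rw [posteriorMean, hpost] at hx ⊢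
  rw [productPosterior_hBall ψ hγ hM hn] at hx
  -- A negative radius would give an empty ball, of mass `0` instead of `1 - α > 0`.
  have hr : 0 ≤ R x / √(n : ℝ) := by
    by_contra hneg
    simp only [hneg, false_and] at hx
    have h0 : {c : Idx J₀ K → ℝ | False} = ∅ := rfl
    rw [h0, measure_empty, eq_comm, ENNReal.ofReal_eq_zero] at hx
    linarith
  simp only [hr, true_and] at hx
  refine ⟨hx, fun f => ?_⟩
  rw [mem_hBall_iff, coeff_integral_productPosterior ψ hγ hM hn]
  exact and_iff_right hr

lemma nonempty_idx (J₀ K : ℕ) : Nonempty (Idx J₀ K) :=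
  ⟨⟨J₀, ⟨0, by rw [levelSize, if_pos le_rfl]; positivity⟩⟩⟩

/-- The credible sets have asymptotically exact coverage. -/
theorem tendsto_coverage (hγ : 0 < γ) (hM : 0 < M) (hδ : 1 / 2 < δ) (hα₀ : 0 < α)
    (hα₁ : α < 1) {f₀ : L2} (hf₀M : holderNorm ψ γ f₀ < ENNReal.ofReal M) {R : ℕ → H J₀ K δ → ℝ}
    (hR : ∀ n : ℕ, 1 ≤ n → ∀ᵐ x ∂(model ψ δ n f₀), uniformPosterior ψ γ M δ n x
      (hBall ψ δ (posteriorMean ψ γ M δ n x) (R n x / √(n : ℝ))) = ENNReal.ofReal (1 - α)) :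
    Tendsto (fun n : ℕ => model ψ δ n f₀ {x | f₀ ∈ credibleSet ψ γ M δ n (R n x) x}) atTop
      (𝓝 (ENNReal.ofReal (1 - α))) := by
  obtain ⟨i₀⟩ := nonempty_idx J₀ K
  have ha : ∀ i : Idx J₀ K, 0 < halfWidth J₀ K γ M i := halfWidth_pos γ hM
  have hf := abs_coeff_lt_halfWidth ψ hM hf₀M
  have hW := idxWeight_nonneg (J₀ := J₀) (K := K) δ
  have hWs := summable_idxWeight (J₀ := J₀) (K := K) hδ
  have hi₀ : 0 < idxWeight J₀ K δ i₀ := weight_pos δ _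
  have hfin := ae_energy_lt_top hW hWs
  refine tendsto_measure_of_tendsto_cdf (μ := stdGaussian (Idx J₀ K))
    (measurable_energy (idxWeight J₀ K δ)) hfin (fun t ht => measure_energy_eq hi₀ ht)
    (b := ENNReal.ofReal (1 - α)) (by rw [ENNReal.ofReal_le_one]; linarith)
    (U := fun n w => signalDepth (idxWeight J₀ K δ) n (halfWidth J₀ K γ M) (coeff ψ f₀)
      (observeCoord n (coeff ψ f₀) w)) ?_ ?_ ?_ ?_
  · filter_upwards [eventually_ge_atTop 1] with n hn
    exact (measurable_signalDepth _ hn ha).comp (measurable_observeCoord n _)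
  · filter_upwards [hfin] with w hw
    exact tendsto_signalDepth hW hi₀ hWs hf hw
  -- If `f₀` is not covered, the ball through `f₀` contains the credible ball, so the depth is at
  -- least `1 - α`. The Hölder constraint holds for `f₀` by assumption.
  · filter_upwards [eventually_ge_atTop 1] with n hn
    have hS : MeasurableSet {x | signalDepth (idxWeight J₀ K δ) n (halfWidth J₀ K γ M) (coeff ψ f₀) x <
        ENNReal.ofReal (1 - α)} :=
      measurableSet_lt (measurable_signalDepth _ hn ha) measurable_const
    refine (model_preimage_val ψ hδ n f₀ hS).symm.trans_le (measure_mono_ae ?_)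
    filter_upwards [ae_credible_ball ψ hγ hM hδ hα₁ hn f₀ (hR n hn)] with x hx hlt
    refine ⟨hf₀M.le, (hx.2 f₀).2 ?_⟩
    by_contra hcon
    refine absurd hlt (not_lt.2 ?_)
    rw [← hx.1]
    exact measure_mono fun c hc => le_trans hc (not_le.1 hcon).le
  -- If `f₀` is covered, the ball through `f₀` is contained in the credible ball, so the depth is at
  -- most `1 - α`.
  · filter_upwards [eventually_ge_atTop 1] with n hn
    have hS : MeasurableSet {x | signalDepth (idxWeight J₀ K δ) n (halfWidth J₀ K γ M) (coeff ψ f₀) x ≤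
        ENNReal.ofReal (1 - α)} :=
      measurableSet_le (measurable_signalDepth _ hn ha) measurable_const
    refine le_trans (measure_mono_ae ?_) (model_preimage_val ψ hδ n f₀ hS).le
    filter_upwards [ae_credible_ball ψ hγ hM hδ hα₁ hn f₀ (hR n hn)] with x hx hmem
    change signalDepth _ n _ _ x.1 ≤ _
    rw [← hx.1]
    exact measure_mono fun c hc => le_trans hc ((hx.2 f₀).1 hmem.2)

/-- With large probability the energy radius of the credible ball is of order `n⁻¹`. -/
lemma ae_radius_le (hγ : 0 < γ) (hM : 0 < M) (hδ : 1 / 2 < δ) (hα₀ : 0 < α)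
    (hα₁ : α < 1) {f₀ : L2} (hf₀M : holderNorm ψ γ f₀ < ENNReal.ofReal M) {n : ℕ} (hn : 1 ≤ n)
    {R : H J₀ K δ → ℝ}
    (hR : ∀ᵐ x ∂(model ψ δ n f₀), uniformPosterior ψ γ M δ n x
      (hBall ψ δ (posteriorMean ψ γ M δ n x) (R x / √(n : ℝ))) = ENNReal.ofReal (1 - α)) :
    ∀ᵐ x ∂(model ψ δ n f₀), ∀ t : ℝ, 0 ≤ t →
      energy (idxWeight J₀ K δ) (noiseCoord n (coeff ψ f₀) x.1) ≤ ENNReal.ofReal t →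
        (R x / √(n : ℝ)) ^ 2 ≤ 4 * (2 * ∑' i, idxWeight J₀ K δ i + t) / α * (n : ℝ)⁻¹ := by
  have hf := abs_coeff_lt_halfWidth ψ hM hf₀M
  have ha : ∀ i : Idx J₀ K, 0 < halfWidth J₀ K γ M i := halfWidth_pos γ hM
  have hW := idxWeight_nonneg (J₀ := J₀) (K := K) δ
  have hWs := summable_idxWeight (J₀ := J₀) (K := K) hδ
  have hprob := isMarkovKernel_truncatedKernel_noise hn ha
  filter_upwards [ae_credible_ball ψ hγ hM hδ hα₁ hn f₀ hR] with x hx t ht0 ht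
  set w := noiseCoord n (coeff ψ f₀) x.1
  have hxw : observeCoord n (coeff ψ f₀) w = x.1 := observeCoord_noiseCoord hn x.1
  have h1 := mul_radius_le (μ := posteriorCoord n (halfWidth J₀ K γ M) x.1)
    (show Measurable fun c : Idx J₀ K → ℝ => energy (idxWeight J₀ K δ) (c - _) from
      (measurable_energy _).comp (measurable_id.sub_const _)) hx.1
  have h2 := lintegral_energy_posteriorCoord_le hW hn hf w
  rw [hxw] at h2
  have hS : ∑' i, ENNReal.ofReal (idxWeight J₀ K δ i * (2 + w i ^ 2)) ≤
      ENNReal.ofReal (2 * ∑' i, idxWeight J₀ K δ i + t) := by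
    rw [ENNReal.ofReal_add (mul_nonneg two_pos.le (tsum_nonneg hW)) ht0, ← tsum_mul_left,
      ENNReal.ofReal_tsum_of_nonneg (fun i => mul_nonneg two_pos.le (hW i)) (hWs.mul_left 2)]
    refine le_trans (le_of_eq ?_) (add_le_add le_rfl ht)
    rw [energy, ← ENNReal.tsum_add]
    refine tsum_congr fun i => ?_
    rw [← ENNReal.ofReal_add (mul_nonneg two_pos.le (hW i)) (mul_nonneg (hW i) (sq_nonneg _))]
    congr 1
    ring
  have hσ : 0 ≤ 2 * ∑' i, idxWeight J₀ K δ i + t :=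
    add_nonneg (mul_nonneg two_pos.le (tsum_nonneg hW)) ht0
  have h3 : (1 - ENNReal.ofReal (1 - α)) * ENNReal.ofReal ((R x / √(n : ℝ)) ^ 2) ≤
      ENNReal.ofReal ((√(n : ℝ))⁻¹ ^ 2) * (4 * ENNReal.ofReal (2 * ∑' i, idxWeight J₀ K δ i + t)) :=
    h1.trans (h2.trans (by gcongr))
  have h4 : (1 : ℝ≥0∞) - ENNReal.ofReal (1 - α) = ENNReal.ofReal α := by
    rw [← ENNReal.ofReal_one, ← ENNReal.ofReal_sub _ (by linarith)]
    congr 1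
    ring
  rw [h4, ← ENNReal.ofReal_ofNat 4, ← ENNReal.ofReal_mul hα₀.le, ← ENNReal.ofReal_mul (by norm_num),
    ← ENNReal.ofReal_mul (by positivity), ENNReal.ofReal_le_ofReal_iff (by positivity), inv_pow,
    Real.sq_sqrt (Nat.cast_nonneg n)] at h3
  rw [div_mul_eq_mul_div, le_div_iff₀ hα₀]
  linarith

lemma energy_sub_le_of_mem_ball {W : Idx J₀ K → ℝ} (hW : ∀ i, 0 ≤ W i) {c d m : Idx J₀ K → ℝ}
    {t : ℝ} (ht : 0 ≤ t) (hc : energy W (c - m) ≤ ENNReal.ofReal t)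
    (hd : energy W (d - m) ≤ ENNReal.ofReal t) : energy W (c - d) ≤ ENNReal.ofReal (4 * t) := by
  have h := energy_sub_le hW (c - m) (d - m)
  rw [sub_sub_sub_cancel_right] at h
  calc energy W (c - d) ≤ 2 * ENNReal.ofReal t + 2 * ENNReal.ofReal t := h.trans (by gcongr)
    _ = ENNReal.ofReal (4 * t) := by
        rw [← ENNReal.ofReal_ofNat 2, ← ENNReal.ofReal_mul (by norm_num),
          ← ENNReal.ofReal_add (by positivity) (by positivity)]
        congr 1
        ring

/-- The `L²`-diameter of the credible sets is of the minimax order up to a logarithmic factor. -/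
theorem diameter_credibleSet (hγ : 0 < γ) (hM : 0 < M) (hδ : 1 / 2 < δ) (hα₀ : 0 < α)
    (hα₁ : α < 1) {f₀ : L2} (hf₀M : holderNorm ψ γ f₀ < ENNReal.ofReal M) {R : ℕ → H J₀ K δ → ℝ}
    (hR : ∀ n : ℕ, 1 ≤ n → ∀ᵐ x ∂(model ψ δ n f₀), uniformPosterior ψ γ M δ n x
      (hBall ψ δ (posteriorMean ψ γ M δ n x) (R n x / √(n : ℝ))) = ENNReal.ofReal (1 - α))
    {ε : ℝ} (hε : 0 < ε) :
    ∃ C : ℝ, ∀ᶠ n : ℕ in atTop, model ψ δ n f₀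
      {x | ENNReal.ofReal (C * ((n : ℝ) ^ (-γ / (2 * γ + 1)) * Real.log n ^ δ)) <
        Metric.ediam (credibleSet ψ γ M δ n (R n x) x)} ≤ ENNReal.ofReal ε := by
  have hW := idxWeight_nonneg (J₀ := J₀) (K := K) δ
  have hWs := summable_idxWeight (J₀ := J₀) (K := K) hδ
  have hr1 := sub_pos.2 (two_rpow_neg_lt_one hγ)
  set σ := ∑' i, idxWeight J₀ K δ i with hσ
  have hσ0 : 0 ≤ σ := tsum_nonneg hW
  -- White noise has expected energy `σ`, so its energy reaches `t` with probability at most `σ / t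
  -- ≤ ε`; the added `1` keeps `t` positive.
  set t := (σ + 1) / ε with ht
  have ht0 : 0 < t := by positivity
  -- The inner expression is `n` times the bound on the squared radius in `ae_radius_le`; the outer
  -- `4` comes from comparing two points of the ball through its centre.
  set E := 4 * (4 * (2 * σ + t) / α) with hE
  have hE0 : 0 ≤ E := by positivity
  set C := √(E * (2 * (2 : ℝ) ^ (2 * δ)) + 4 * M ^ 2 * (1 - (2 : ℝ) ^ (-2 * γ))⁻¹) with hC
  have hCsq : C ^ 2 = E * (2 * (2 : ℝ) ^ (2 * δ)) + 4 * M ^ 2 * (1 - (2 : ℝ) ^ (-2 * γ))⁻¹ :=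
    Real.sq_sqrt (by positivity)
  refine ⟨C, ?_⟩
  filter_upwards [exists_level_rate hγ (show 0 < δ by linarith) J₀, eventually_ge_atTop 1]
    with n ⟨L, hJL, hL1, hL2⟩ hn
  have hrate0 : 0 ≤ (n : ℝ) ^ (-γ / (2 * γ + 1)) * Real.log n ^ δ :=
    mul_nonneg (by positivity) (Real.rpow_nonneg (Real.log_natCast_nonneg n) _)
  set ρ := (n : ℝ) ^ (-γ / (2 * γ + 1)) * Real.log n ^ δ with hρ
  have hS : MeasurableSet {x | ENNReal.ofReal t ≤
      energy (idxWeight J₀ K δ) (noiseCoord n (coeff ψ f₀) x)} :=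
    measurableSet_le measurable_const ((measurable_energy _).comp (measurable_noiseCoord n _))
  have htail : model ψ δ n f₀ {x | x.1 ∈ {x | ENNReal.ofReal t ≤
      energy (idxWeight J₀ K δ) (noiseCoord n (coeff ψ f₀) x)}} ≤ ENNReal.ofReal ε := by
    rw [model_preimage_val ψ hδ n f₀ hS]
    have e : {w | observeCoord n (coeff ψ f₀) w ∈ {x | ENNReal.ofReal t ≤
        energy (idxWeight J₀ K δ) (noiseCoord n (coeff ψ f₀) x)}} =
        {w | ENNReal.ofReal t ≤ energy (idxWeight J₀ K δ) w} := by
      ext w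
      change _ ≤ energy _ (noiseCoord n _ (observeCoord n _ w)) ↔ _
      rw [noiseCoord_observeCoord hn]
      rfl
    rw [e]
    refine (meas_ge_le_lintegral_div (measurable_energy _).aemeasurable
      (by simpa using ht0) ENNReal.ofReal_ne_top).trans ?_
    rw [lintegral_energy hW]
    simp_rw [lintegral_sq_gaussianReal, mul_one]
    rw [← ENNReal.ofReal_tsum_of_nonneg hW hWs, ← ENNReal.ofReal_div_of_pos ht0]
    refine ENNReal.ofReal_le_ofReal ?_
    rw [div_le_iff₀ ht0, ht, mul_div_cancel₀ _ hε.ne', ← hσ]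
    linarith
  refine le_trans (measure_mono_ae ?_) htail
  filter_upwards [ae_credible_ball ψ hγ hM hδ hα₁ hn f₀ (hR n hn),
    ae_radius_le ψ hγ hM hδ hα₀ hα₁ hf₀M hn (hR n hn)] with x hball hrad hlt
  change ENNReal.ofReal t ≤ energy (idxWeight J₀ K δ) (noiseCoord n (coeff ψ f₀) x.1)
  by_contra hcon
  have hr := hrad t ht0.le (not_le.1 hcon).le
  refine absurd hlt (not_lt.2 (Metric.ediam_le fun f hf g hg => ?_))
  rw [edist_dist, dist_eq_norm]
  refine ENNReal.ofReal_le_ofReal (abs_le_of_sq_le_sq' ?_ (by positivity)).2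
  have hcoeff : coeff ψ (f - g) = coeff ψ f - coeff ψ g := by
    ext i
    simp only [coeff, inner_sub_right, Pi.sub_apply]
  have henergy : energy (idxWeight J₀ K δ) (coeff ψ (f - g)) ≤ ENNReal.ofReal (E * (n : ℝ)⁻¹) := by
    rw [hcoeff]
    refine (energy_sub_le_of_mem_ball hW (sq_nonneg _) ((hball.2 f).1 hf.2)
      ((hball.2 g).1 hg.2)).trans (ENNReal.ofReal_le_ofReal ?_)
    rw [hE]
    linarith
  have hbd : ∀ i, |coeff ψ (f - g) i| ≤ 2 * halfWidth J₀ K γ M i := fun i => by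
    rw [hcoeff, Pi.sub_apply, two_mul]
    exact (abs_sub _ _).trans (add_le_add (abs_coeff_le_halfWidth ψ hM hf.1 i)
      (abs_coeff_le_halfWidth ψ hM hg.1 i))
  have hnorm := norm_sq_le_of_energy_le ψ hγ (show 0 ≤ δ by linarith) hJL (by positivity) henergy hbd
  calc ‖f - g‖ ^ 2 ≤ E * ((weight δ L)⁻¹ * (n : ℝ)⁻¹) +
        4 * M ^ 2 * (1 - (2 : ℝ) ^ (-2 * γ))⁻¹ * ((2 : ℝ) ^ (-2 * γ)) ^ L :=
        hnorm.trans (le_of_eq (by ring))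
    _ ≤ E * (2 * (2 : ℝ) ^ (2 * δ) * ρ ^ 2) +
        4 * M ^ 2 * (1 - (2 : ℝ) ^ (-2 * γ))⁻¹ * ρ ^ 2 := by gcongr
    _ = (C * ρ) ^ 2 := by rw [mul_pow C ρ, hCsq]; ring

end CredibleSet

end

end WhiteNoise

theorem corollary2p1
    {J₀ K S : ℕ} (hJ₀ : 1 ≤ J₀)
    (γ M δ α : ℝ) (hγ : 0 < γ) (hM : 0 < M) (hδ : 1 / 2 < δ) (hα₀ : 0 < α) (hα₁ : α < 1)
    (hS : max γ (1 / 2) < (S : ℝ))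
    (ψ : HilbertBasis (WhiteNoise.Idx J₀ K) ℝ WhiteNoise.L2) (hψ : WhiteNoise.IsRegularBasis S ψ)
    (f₀ : WhiteNoise.L2) (hf₀ : f₀ ∈ WhiteNoise.holderSpace ψ γ)
    (hf₀M : WhiteNoise.holderNorm ψ γ f₀ < ENNReal.ofReal M)
    (R : ℕ → WhiteNoise.H J₀ K δ → ℝ)
    (hR : ∀ n : ℕ, 1 ≤ n → ∀ᵐ x ∂(WhiteNoise.model ψ δ n f₀),
      WhiteNoise.uniformPosterior ψ γ M δ n x
        (WhiteNoise.hBall ψ δ (WhiteNoise.posteriorMean ψ γ M δ n x) (R n x / √(n : ℝ))) =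
          ENNReal.ofReal (1 - α)) :
    Tendsto
      (fun n : ℕ => WhiteNoise.model ψ δ n f₀
        {x | f₀ ∈ WhiteNoise.credibleSet ψ γ M δ n (R n x) x})
      atTop (𝓝 (ENNReal.ofReal (1 - α))) ∧
    ∃ κ : ℝ, 0 < κ ∧ ∀ ε : ℝ, 0 < ε → ∃ C : ℝ, ∀ᶠ n : ℕ in atTop,
      WhiteNoise.model ψ δ n f₀
        {x | ENNReal.ofReal (C * ((n : ℝ) ^ (-γ / (2 * γ + 1)) * Real.log n ^ κ)) <
          Metric.ediam (WhiteNoise.credibleSet ψ γ M δ n (R n x) x)} ≤ ENNReal.ofReal ε :=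
  -- The exponent `κ = δ` is the logarithmic loss in the weights of `H(δ)`.
  ⟨WhiteNoise.tendsto_coverage ψ hγ hM hδ hα₀ hα₁ hf₀M hR, δ, by linarith, fun _ hε =>
    WhiteNoise.diameter_credibleSet ψ hγ hM hδ hα₀ hα₁ hf₀M hR hε⟩
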